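/- Let $d\ge 1$, $K>0$, and let $U$ be a non-negative real polynomial of degree $4$ with positive leading coefficient. For $i,j\in\mathbb Z^d$ put $|i-j|=\sum_{\ell=1}^d|i_\ell-j_\ell|$. Let $\mathcal X=(\mathbb R^2)^{\mathbb Z^d}$, with the product topology, be the set of states $x=\{x_i\}=\{(q_i,p_i)\}_{i\in\mathbb Z^d}$, and consider the equations of motion $$\dot q_i=p_i,\qquad \dot p_i=-U'(q_i)-K\sum_{j:|j-i|=1}(q_i-q_j),\qquad i\in\mathbb Z^d. \tag{1}$$ For $\nu\in\mathbb Z^d$ and $k\in\mathbb N$ let $\Lambda_{\nu,k}$ be the cube of center $\nu$ and side $2k+1$, and $$W_{\nu,k}(x)=\sum_{i\in\Lambda_{\nu,k}}\Big\{\frac{p_i^2}{2}+U(q_i)+1\Big\}+\sum_{i,j\in\Lambda_{\nu,k},\,|i-j|=1}\frac K4(q_i-q_j)^2,\qquad Q(x)=\sup_{\nu\in\mathbb Z^d}\ \sup_{k>\log^{1/d}(e+|\nu|)}\frac{W_{\nu,k}(x)}{(2k+1)^d},$$ where the second sum in $W_{\nu,k}$ is over ordered pairs, and let $\mathcal X_0=\{x\in\mathcal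 X: Q(x)<\infty\}$. For each $x\in\mathcal X_0$ there is exactly one solution $t\mapsto\Phi_t(x)$, $t\in\mathbb R$, of (1) with $\Phi_0(x)=x$ along which $Q$ is bounded on bounded time intervals, and $\Phi_t(x)_j$ is differentiable with respect to $x_i=(q_i,p_i)$ for all $i,j\in\mathbb Z^d$ and $t\in\mathbb R$. For an observable $F$ write $\Phi_tF=F\circ\Phi_t$, and let $$\{F,G\}=\sum_{k\in\mathbb Z^d}\Big(\frac{\partial F}{\partial q_k}\frac{\partial G}{\partial p_k}-\frac{\partial F}{\partial p_k}\frac{\partial G}{\partial q_k}\Big)$$ be the Poisson bracket. Let $\omega$ be a Borel probability measure on $\mathcal X$ such that (i) there is a constant $C_\omega>0$ such that, for all sufficiently small $\lambda>0$, $\int e^{\lambda W_{\nu,k}}\,d\omega\le e^{C_\omega(2k+1)^d}$ for all $\nu\in\mathbb Z^d$ and $k\in\mathbb N$; (ii) $\int \Phi_tF\,d\omega=\int F\,d\omega$ for all $t\in\mathbb R$ and every $F$ that is a function of finitely many of the variables $x_i$, differentiable, and bounded together with its first derivatives. Then $\omega(\mathcal X_0)=1$ and, for all differentiable $f,g:\mathbb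 R^2\to\mathbb R$ that are bounded together with their first derivatives, all $\alpha>1/2$, all $b>0$ and all $i\in\mathbb Z^d$, writing $f_i(x)=f(x_i)$ and $g_j(x)=g(x_j)$, $$\lim_{t\to\infty}\ \sup_{j\,:\,|i-j|>t\log^\alpha t}e^{bt}\,\big|\{f_i,\Phi_tg_j\}(x)\big|=0\qquad\text{for }\omega\text{-almost every }x.$$ -/

import Mathlib

open MeasureTheory Filter Topology
open scoped ENNReal NNReal

noncomputable section

namespace AnharmonicLattice

/-- The lattice `ℤ^d`. -/
abbrev Site (d : ℕ) : Type := Fin d → ℤ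

/-- The states `x = (q_i, p_i)_{i ∈ ℤ^d}`; the topology is the product topology, and the (product)
σ-algebra is its Borel σ-algebra, the index set being countable. -/
abbrev Config (d : ℕ) : Type := Site d → ℝ × ℝ

/-- The distance `|i - j| = ∑ l, |i_l - j_l|` on `ℤ^d`. -/
def siteDist {d : ℕ} (i j : Site d) : ℤ := ∑ l, |i l - j l|

/-- The sites `j` with `|j - i| = 1` (see `mem_neighbors`). -/
def neighbors {d : ℕ} (i : Site d) : Finset (Site d) :=
  (Finset.Icc (fun l => i l - 1) (fun l => i l + 1)).filter (fun j => siteDist j i = 1)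

theorem mem_neighbors {d : ℕ} (i j : Site d) : j ∈ neighbors i ↔ siteDist j i = 1 := by
  unfold neighbors
  rw [Finset.mem_filter, Finset.mem_Icc, and_iff_right_iff_imp]
  intro h
  have key : ∀ l, |j l - i l| ≤ 1 := fun l => by
    rw [← h]
    exact Finset.single_le_sum (f := fun l => |j l - i l|) (fun _ _ => abs_nonneg _)
      (Finset.mem_univ l)
  constructor <;> intro l <;> have := abs_le.mp (key l) <;> simp only <;> omega

/-- The cube `Λ_{ν,k}` of center `ν` and side `2k+1`. -/
def cube {d : ℕ} (ν : Site d) (k : ℕ) : Finset (Site d) :=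
  Finset.Icc (fun l => ν l - (k : ℤ)) (fun l => ν l + (k : ℤ))

/-- The force `F_i(x) = - U'(q_i) - K ∑_{|j-i|=1} (q_i - q_j)`. -/
def force {d : ℕ} (U : Polynomial ℝ) (K : ℝ) (i : Site d) (x : Config d) : ℝ :=
  -(U.derivative.eval (x i).1) - K * ∑ j ∈ neighbors i, ((x i).1 - (x j).1)

/-- The local energy `W_{ν,k}(x)`; the second sum runs over ordered pairs of neighbors. -/
def localEnergy {d : ℕ} (U : Polynomial ℝ) (K : ℝ) (ν : Site d) (k : ℕ) (x : Config d) : ℝ :=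
  ∑ i ∈ cube ν k, ((x i).2 ^ 2 / 2 + U.eval (x i).1 + 1) +
    ∑ i ∈ cube ν k, ∑ j ∈ (cube ν k).filter (fun j => siteDist j i = 1),
      K / 4 * ((x i).1 - (x j).1) ^ 2

/-- `Q(x) = sup_ν sup_{k > log^{1/d}(e+|ν|)} W_{ν,k}(x) / (2k+1)^d`, with values in `[0,∞]`
(the energies `W_{ν,k}` are positive when `U ≥ 0` and `K > 0`). -/
def Q {d : ℕ} (U : Polynomial ℝ) (K : ℝ) (x : Config d) : ℝ≥0∞ :=
  ⨆ (ν : Site d) (k : ℕ)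
    (_ : Real.log (Real.exp 1 + (siteDist ν 0 : ℝ)) ^ (1 / (d : ℝ)) < (k : ℝ)),
      ENNReal.ofReal (localEnergy U K ν k x / (2 * (k : ℝ) + 1) ^ d)

/-- The set `X₀` of the states with `Q(x) < ∞`. -/
def X0 {d : ℕ} (U : Polynomial ℝ) (K : ℝ) : Set (Config d) := {x | Q U K x < ∞}

/-- A global solution of the equations of motion `q̇_i = p_i`, `ṗ_i = F_i(x)` that moves inside
`X₀`, with `Q` bounded on bounded time intervals. (Some growth condition in space is needed for
uniqueness of solutions of the infinite system.) -/
structure IsSolution {d : ℕ} (U : Polynomial ℝ) (K : ℝ) (γ : ℝ → Config d) : Prop where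
  deriv_q : ∀ (i : Site d) (t : ℝ), HasDerivAt (fun s => (γ s i).1) (γ t i).2 t
  deriv_p : ∀ (i : Site d) (t : ℝ), HasDerivAt (fun s => (γ s i).2) (force U K i (γ t)) t
  locally_bounded : ∀ T : ℝ, ∃ M : ℝ≥0, ∀ t : ℝ, |t| ≤ T → Q U K (γ t) ≤ M

open Classical in
/-- The time evolution `Φ_t(x)`: the position at time `t` of the solution that starts from `x`.
(States from which no solution starts, all outside `X₀`, are left fixed.) -/
def flow {d : ℕ} (U : Polynomial ℝ) (K : ℝ) (t : ℝ) (x : Config d) : Config d :=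
  if h : ∃ γ : ℝ → Config d, IsSolution U K γ ∧ γ 0 = x then h.choose t else x

/-- A differentiable function that is bounded together with its derivative. -/
def BoundedDifferentiable {E : Type*} [NormedAddCommGroup E] [NormedSpace ℝ E] (φ : E → ℝ) :
    Prop :=
  Differentiable ℝ φ ∧ ∃ C : ℝ, ∀ y, |φ y| ≤ C ∧ ‖fderiv ℝ φ y‖ ≤ C

/-- The local observables: bounded differentiable functions, with bounded derivatives, of
finitely many of the variables `x_i`. -/
def IsLocalObservable {d : ℕ} (F : Config d → ℝ) : Prop :=
  ∃ (Λ : Finset (Site d)) (φ : (Λ → ℝ × ℝ) → ℝ),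
    BoundedDifferentiable φ ∧ ∀ x, F x = φ (fun i => x i)

/-- The superstability estimate: there is `C > 0` such that, for all small `λ > 0`,
`ω(e^{λ W_{ν,k}}) ≤ e^{C (2k+1)^d}` for all `ν`, `k`. -/
def Superstable {d : ℕ} (U : Polynomial ℝ) (K : ℝ) (ω : Measure (Config d)) : Prop :=
  ∃ C : ℝ, 0 < C ∧ ∃ lam₀ : ℝ, 0 < lam₀ ∧ ∀ lam : ℝ, 0 < lam → lam < lam₀ →
    ∀ (ν : Site d) (k : ℕ),
      ∫⁻ x, ENNReal.ofReal (Real.exp (lam * localEnergy U K ν k x)) ∂ω ≤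
        ENNReal.ofReal (Real.exp (C * (2 * (k : ℝ) + 1) ^ d))

/-- `ω(Φ_t F) = ω(F)` for all local observables `F` and all times `t`. -/
def TimeInvariant {d : ℕ} (U : Polynomial ℝ) (K : ℝ) (ω : Measure (Config d)) : Prop :=
  ∀ F : Config d → ℝ, IsLocalObservable F → ∀ t : ℝ,
    ∫ x, F (flow U K t x) ∂ω = ∫ x, F x ∂ω

/-- `∂F/∂q_i` at `x`. -/
def partialQ {d : ℕ} (i : Site d) (F : Config d → ℝ) (x : Config d) : ℝ :=
  deriv (fun s : ℝ => F (Function.update x i (s, (x i).2))) (x i).1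

/-- `∂F/∂p_i` at `x`. -/
def partialP {d : ℕ} (i : Site d) (F : Config d → ℝ) (x : Config d) : ℝ :=
  deriv (fun s : ℝ => F (Function.update x i ((x i).1, s))) (x i).2

/-- The Poisson bracket `{F, G}(x)`; only finitely many terms of the sum are nonzero if `F` or `G`
depends on finitely many sites. -/
def poissonBracket {d : ℕ} (F G : Config d → ℝ) (x : Config d) : ℝ :=
  ∑' i : Site d, (partialQ i F x * partialP i G x - partialP i F x * partialQ i G x)

/-- The single-site observable `f_i(x) = f(x_i)`. -/
def siteObs {d : ℕ} (f : ℝ × ℝ → ℝ) (i : Site d) : Config d → ℝ := fun x => f (x i)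

/-- `Φ_t F (x) = F(Φ_t(x))`. -/
def evolve {d : ℕ} (U : Polynomial ℝ) (K : ℝ) (t : ℝ) (F : Config d → ℝ) : Config d → ℝ :=
  fun x => F (flow U K t x)

end AnharmonicLattice

end

/-! The force of a quartic potential has an unbounded derivative, of order q_k^2 at the site k, and
this is the local rate at which perturbations grow. Energy controls q_k^4, so the rate is only of
the order of the square root of the local energy. If the local energies along a trajectory grow at
most like the logarithm of space and time, the rate up to time t is of order √(log t), and a
perturbation stays within a distance of order t·√(log t), up to exponentially small tails. The cone
t·log^α t with α > 1/2 outgrows this distance and leaves room for any factor e^{bt}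
(`LogGrowth.exists_decay`, `eventually_rate_le`). The bracket is bounded by the local Lipschitz
constant of the evolved observable in the variable x_i.

Logarithmic growth of the energies (`ae_logGrowth`) is probabilistic at integer times and
deterministic in between. Superstability makes large energies in a cube exponentially unlikely in
its volume, invariance carries the tails to every time (`measure_energy_flow_le`), and a
Borel–Cantelli argument runs over integer times, centers and sides of the cubes
(`ae_exists_energy_bound`). During a unit of time the energy can only spread: in the energy balance
the on-site force cancels, so the energy of a site changes at a rate bounded by a constant times the
energies nearby (`abs_deriv_siteEnergy_le`, `siteEnergy_le_tsum`).

The deterministic estimates rest on one comparison principle, `norm_le_of_supersolution`, with the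
weights exp((σ + s/T)|k - c| + ρs). The slowly growing exponent contributes |k - c|/T to the
logarithmic derivative, which dominates coefficients that grow linearly in the distance with a small
slope. By `exists_sq_position_le` the squared positions of states in `X0` grow in this way. The
resulting stability estimate `exists_stability` gives uniqueness, existence as a limit of systems
with finitely many moving sites, and continuity of the flow on sets of bounded energy averages; the
same comparison applied to the linearized system gives differentiability in the initial state. -/

noncomputable section

namespace AnharmonicLattice

open Set

/-! ### Geometry of the lattice -/

section Geometry

variable {d : ℕ}

/-- The distance `|i - j|` as a real number. -/
def sdist (i j : Site d) : ℝ := (siteDist i j : ℝ)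

/-- The site `i` together with its nearest neighbors. -/
def hood (i : Site d) : Finset (Site d) := insert i (neighbors i)

theorem siteDist_nonneg (i j : Site d) : 0 ≤ siteDist i j :=
  Finset.sum_nonneg fun _ _ => abs_nonneg _

theorem siteDist_comm (i j : Site d) : siteDist i j = siteDist j i :=
  Finset.sum_congr rfl fun _ _ => abs_sub_comm _ _

theorem siteDist_triangle (i j k : Site d) : siteDist i k ≤ siteDist i j + siteDist j k := by
  unfold siteDist
  rw [← Finset.sum_add_distrib]
  exact Finset.sum_le_sum fun _ _ => abs_sub_le _ _ _

theorem siteDist_self (i : Site d) : siteDist i i = 0 := by simp [siteDist]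

theorem sdist_nonneg (i j : Site d) : 0 ≤ sdist i j := by
  unfold sdist; exact_mod_cast siteDist_nonneg i j

theorem sdist_comm (i j : Site d) : sdist i j = sdist j i := by
  unfold sdist; rw [siteDist_comm]

theorem sdist_triangle (i j k : Site d) : sdist i k ≤ sdist i j + sdist j k := by
  unfold sdist; exact_mod_cast siteDist_triangle i j k

theorem sdist_self (i : Site d) : sdist i i = 0 := by simp [sdist, siteDist_self]

theorem self_mem_hood (i : Site d) : i ∈ hood i := Finset.mem_insert_self _ _

theorem mem_hood_of_mem_neighbors {i j : Site d} (h : j ∈ neighbors i) : j ∈ hood i :=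
  Finset.mem_insert_of_mem h

theorem siteDist_le_one_of_mem_hood {i j : Site d} (h : j ∈ hood i) : siteDist j i ≤ 1 := by
  rcases Finset.mem_insert.mp h with rfl | h
  · simp [siteDist_self]
  · exact ((mem_neighbors _ _).mp h).le

theorem sdist_le_one_of_mem_hood {i j : Site d} (h : j ∈ hood i) : sdist j i ≤ 1 := by
  unfold sdist; exact_mod_cast siteDist_le_one_of_mem_hood h

theorem sdist_le_of_mem_hood {i j : Site d} (h : j ∈ hood i) (c : Site d) :
    sdist j c ≤ sdist i c + 1 := by
  have := sdist_triangle j i c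
  have := sdist_le_one_of_mem_hood h
  linarith

theorem le_sdist_of_mem_hood {i j : Site d} (h : j ∈ hood i) (c : Site d) :
    sdist i c - 1 ≤ sdist j c := by
  have := sdist_triangle i j c
  have := sdist_le_one_of_mem_hood h
  rw [sdist_comm] at this
  linarith

theorem abs_sub_le_siteDist (i j : Site d) (l : Fin d) : |i l - j l| ≤ siteDist i j :=
  Finset.single_le_sum (f := fun l => |i l - j l|) (fun _ _ => abs_nonneg _) (Finset.mem_univ l)

theorem mem_cube {ν i : Site d} {k : ℕ} : i ∈ cube ν k ↔ ∀ l, |i l - ν l| ≤ k := by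
  simp only [cube, Finset.mem_Icc, Pi.le_def, ← forall_and]
  refine forall_congr' fun l => ?_
  rw [abs_le]
  constructor <;> rintro ⟨h₁, h₂⟩ <;> constructor <;> linarith

theorem self_mem_cube (ν : Site d) (k : ℕ) : ν ∈ cube ν k := by
  rw [mem_cube]; intro l; simp

theorem mem_cube_of_siteDist_le {ν i : Site d} {k : ℕ} (h : siteDist i ν ≤ k) : i ∈ cube ν k :=
  mem_cube.mpr fun l => (abs_sub_le_siteDist i ν l).trans h

theorem lt_sdist_of_notMem_cube {ν i : Site d} {k : ℕ} (h : i ∉ cube ν k) :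
    (k : ℝ) < sdist i ν := by
  by_contra hlt
  apply h
  apply mem_cube_of_siteDist_le
  rw [not_lt] at hlt
  unfold sdist at hlt
  exact_mod_cast hlt

theorem card_cube (ν : Site d) (k : ℕ) : (cube ν k).card = (2 * k + 1) ^ d := by
  unfold cube
  rw [Pi.card_Icc]
  simp only [Int.card_Icc]
  rw [Finset.prod_congr rfl (g := fun _ => 2 * k + 1) (fun l _ => by omega)]
  simp

theorem hood_subset_cube (i : Site d) : hood i ⊆ cube i 1 := fun _ hj =>
  mem_cube_of_siteDist_le (by simpa using siteDist_le_one_of_mem_hood hj)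

theorem card_hood_le (i : Site d) : (hood i).card ≤ 3 ^ d := by
  simpa [card_cube] using Finset.card_le_card (hood_subset_cube i)

theorem neighbors_subset_cube_succ {ν i : Site d} {k : ℕ} (hi : i ∈ cube ν k) :
    neighbors i ⊆ cube ν (k + 1) := by
  intro j hj
  rw [mem_cube] at hi ⊢
  intro l
  have h₁ := abs_sub_le_siteDist j i l
  have h₂ := (mem_neighbors i j).mp hj
  have h₃ := abs_sub_le (j l) (i l) (ν l)
  have := hi l
  push_cast
  linarith

theorem cube_mono (ν : Site d) {k l : ℕ} (h : k ≤ l) : cube ν k ⊆ cube ν l := by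
  intro i hi
  rw [mem_cube] at hi ⊢
  intro m
  exact (hi m).trans (by exact_mod_cast h)

theorem sum_hood_le {i : Site d} {f : Site d → ℝ} {a : ℝ} (h : ∀ j ∈ hood i, f j ≤ a)
    (ha : 0 ≤ a) : ∑ j ∈ hood i, f j ≤ 3 ^ d * a := by
  calc ∑ j ∈ hood i, f j ≤ ∑ _j ∈ hood i, a := Finset.sum_le_sum h
    _ = (hood i).card * a := by simp
    _ ≤ 3 ^ d * a := by
      gcongr
      exact_mod_cast card_hood_le i

end Geometry

/-! ### Comparison with supersolutions -/

section Comparison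

/-- If finitely many continuous functions are negative at each time before which they have been
nonpositive, they stay negative. -/
theorem forall_neg_of_step {ι : Type*} (B : Finset ι) {T : ℝ} (g : ι → ℝ → ℝ)
    (hc : ∀ i ∈ B, ContinuousOn (g i) (Icc 0 T))
    (hstep : ∀ s ∈ Icc 0 T, (∀ r ∈ Ico 0 s, ∀ i ∈ B, g i r ≤ 0) → ∀ i ∈ B, g i s < 0) :
    ∀ s ∈ Icc 0 T, ∀ i ∈ B, g i s < 0 := by
  by_contra! hbad
  obtain ⟨s₀, hs₀, i₀, hi₀, hg₀⟩ := hbad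
  -- Finiteness of `B` makes the set of bad times compact, so there is a first one, which the step
  -- hypothesis excludes.
  set V : Set ℝ := ⋃ i ∈ B, (Icc 0 T ∩ g i ⁻¹' Ici 0)
  have hV : IsCompact V := by
    refine B.finite_toSet.isCompact_biUnion fun i hi => ?_
    exact isCompact_Icc.of_isClosed_subset
      ((hc i hi).preimage_isClosed_of_isClosed isClosed_Icc isClosed_Ici) inter_subset_left
  have hne : V.Nonempty := ⟨s₀, by simp only [V, mem_iUnion]; exact ⟨i₀, hi₀, hs₀, hg₀⟩⟩
  obtain ⟨τ, hτ, hmin⟩ := hV.exists_isLeast hne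
  simp only [V, mem_iUnion] at hτ
  obtain ⟨i, hi, hτ, hgi⟩ := hτ
  refine absurd (hstep τ hτ ?_ i hi) (not_lt.mpr hgi)
  intro r hr j hj
  by_contra! hpos
  refine absurd (hmin (a := r) ?_) (not_le.mpr hr.2)
  simp only [V, mem_iUnion]
  exact ⟨j, hj, ⟨hr.1, hr.2.le.trans hτ.2⟩, hpos.le⟩

variable {E : Type*} [NormedAddCommGroup E] [NormedSpace ℝ E]

/-- A finite system of differential inequalities is dominated by a strict supersolution. -/
theorem norm_lt_of_supersolution {ι : Type*} (B : Finset ι) (nb : ι → Finset ι) {T : ℝ}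
    {A : ι → ℝ} (hA : ∀ k, 0 ≤ A k) {u u' : ι → ℝ → E} {z z' b : ι → ℝ → ℝ}
    (hu : ∀ k ∈ B, ∀ s ∈ Icc 0 T, HasDerivAt (u k) (u' k s) s)
    (hz : ∀ k ∈ B, ∀ s ∈ Icc 0 T, HasDerivAt (z k) (z' k s) s)
    (hu' : ∀ k ∈ B, ∀ s ∈ Icc 0 T, ‖u' k s‖ ≤ A k * ∑ j ∈ nb k, ‖u j s‖ + b k s)
    (hz' : ∀ k ∈ B, ∀ s ∈ Icc 0 T, A k * ∑ j ∈ nb k, z j s + b k s ≤ z' k s)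
    (h0 : ∀ k ∈ B, ‖u k 0‖ < z k 0)
    (hout : ∀ k ∉ B, ∀ s ∈ Icc 0 T, ‖u k s‖ ≤ z k s) :
    ∀ s ∈ Icc 0 T, ∀ k ∈ B, ‖u k s‖ < z k s := by
  have huc : ∀ k ∈ B, ContinuousOn (u k) (Icc 0 T) := fun k hk s hs =>
    (hu k hk s hs).continuousAt.continuousWithinAt
  have hzc : ∀ k ∈ B, ContinuousOn (z k) (Icc 0 T) := fun k hk s hs =>
    (hz k hk s hs).continuousAt.continuousWithinAt
  have key := forall_neg_of_step B (T := T) (fun k s => ‖u k s‖ - z k s)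
    (fun k hk => (huc k hk).norm.sub (hzc k hk)) ?_
  · intro s hs k hk
    exact sub_neg.mp (key s hs k hk)
  intro s hs hprev k hk
  have hsub : Icc 0 s ⊆ Icc 0 T := Icc_subset_Icc_right hs.2
  have hall : ∀ r ∈ Ico 0 s, ∀ j, ‖u j r‖ ≤ z j r := by
    intro r hr j
    by_cases hj : j ∈ B
    · exact sub_nonpos.mp (hprev r hr j hj)
    · exact hout j hj r (hsub ⟨hr.1, hr.2.le⟩)
  -- The gap at time 0 never shrinks: before `s` all sites are dominated, so the norm grows no
  -- faster than `z k`. This is what makes the inequality strict at `s`.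
  set ε := z k 0 - ‖u k 0‖ with hε
  have hεpos : 0 < ε := sub_pos.mpr (h0 k hk)
  have hle := image_norm_le_of_norm_deriv_right_le_deriv_boundary' (f := u k) (f' := u' k)
    (a := 0) (b := s) (B := fun r => z k r - ε) (B' := z' k)
    ((huc k hk).mono hsub)
    (fun r hr => (hu k hk r (hsub ⟨hr.1, hr.2.le⟩)).hasDerivWithinAt)
    (by simp [hε]) (((hzc k hk).mono hsub).sub continuousOn_const)
    (fun r hr => ((hz k hk r (hsub ⟨hr.1, hr.2.le⟩)).sub_const ε).hasDerivWithinAt)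
    (fun r hr => ?_) (x := s) ⟨hs.1, le_rfl⟩
  · linarith
  · have hr' := hsub ⟨hr.1, hr.2.le⟩
    refine (hu' k hk r hr').trans (le_trans ?_ (hz' k hk r hr'))
    gcongr
    · exact hA k
    · exact hall r hr _

variable {d : ℕ}

theorem exp_weight_hood_le {c k : Site d} {a ρ s m : ℝ} (ham : |a| ≤ m) {j : Site d}
    (hj : j ∈ hood k) :
    Real.exp (a * sdist j c + ρ * s) ≤
      Real.exp m * Real.exp (a * sdist k c + ρ * s) := by
  rw [← Real.exp_add]
  apply Real.exp_le_exp.mpr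
  have h₁ := sdist_le_of_mem_hood hj c
  have h₂ := le_sdist_of_mem_hood hj c
  have h₃ : |a * (sdist j c - sdist k c)| ≤ m * 1 := by
    rw [abs_mul]
    exact mul_le_mul ham (abs_le.mpr ⟨by linarith, by linarith⟩) (abs_nonneg _)
      ((abs_nonneg _).trans ham)
  have h₄ := (abs_le.mp h₃).2
  nlinarith

/-- The exponent moves with time in order to produce the term `D / T`: it pays for coefficients that
grow with the distance `D`, which a fixed exponent could not absorb. -/
theorem hasDerivAt_exp_weight (D T ρ σ s : ℝ) :
    HasDerivAt (fun s : ℝ => Real.exp ((σ + s / T) * D + ρ * s))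
      ((D / T + ρ) * Real.exp ((σ + s / T) * D + ρ * s)) s := by
  have h : HasDerivAt (fun s : ℝ => (σ + s / T) * D + ρ * s) (D / T + ρ) s := by
    have := ((((hasDerivAt_id s).div_const T).const_add σ).mul_const D).add
      ((hasDerivAt_id s).const_mul ρ)
    refine this.congr_deriv ?_
    ring
  convert h.exp using 1
  ring

/-- The exponential weights are supersolutions. -/
theorem sum_hood_exp_weight_le {c k : Site d} {T ρ A σ s : ℝ} (hT : 0 < T) (hσ : |σ| ≤ 1)
    (hA : 0 ≤ A) (hs : s ∈ Icc 0 T) {κ : ℝ}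
    (hAρ : A * (3 ^ d * Real.exp 2) + κ ≤ ρ + sdist k c / T) :
    A * ∑ j ∈ hood k, Real.exp ((σ + s / T) * sdist j c + ρ * s) +
        κ * Real.exp ((σ + s / T) * sdist k c + ρ * s) ≤
      (sdist k c / T + ρ) * Real.exp ((σ + s / T) * sdist k c + ρ * s) := by
  have hsT : 0 ≤ s / T ∧ s / T ≤ 1 := ⟨div_nonneg hs.1 hT.le, (div_le_one hT).mpr hs.2⟩
  have ham : |σ + s / T| ≤ 2 := by
    rw [abs_le] at hσ ⊢
    constructor <;> linarith [hσ.1, hσ.2, hsT.1, hsT.2]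
  have h₁ : ∑ j ∈ hood k, Real.exp ((σ + s / T) * sdist j c + ρ * s) ≤
      3 ^ d * (Real.exp 2 * Real.exp ((σ + s / T) * sdist k c + ρ * s)) :=
    sum_hood_le (fun j hj => exp_weight_hood_le ham hj) (by positivity)
  have h₂ := mul_le_mul_of_nonneg_left h₁ hA
  have h₃ := mul_le_mul_of_nonneg_right hAρ
    (Real.exp_pos ((σ + s / T) * sdist k c + ρ * s)).le
  linarith

/-- Reduction to finitely many sites. Adding η times the weight with σ = 1, which is at least exp(|k
- c|), to the supersolution makes domination automatic outside a large cube, because the unknown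
grows at most like exp(|k - c|/2). Inside the cube the finite comparison applies; finally η tends to
0. -/
theorem norm_le_of_supersolution_right (c : Site d) {T ρ G : ℝ} (hT : 0 < T) (hρ : 0 ≤ ρ)
    {A : Site d → ℝ}
    (hA : ∀ k, 0 ≤ A k) (hAρ : ∀ k, A k * (3 ^ d * Real.exp 2) ≤ ρ + sdist k c / T)
    {u u' : Site d → ℝ → E} {z z' b : Site d → ℝ → ℝ}
    (hu : ∀ k, ∀ s ∈ Icc 0 T, HasDerivAt (u k) (u' k s) s)
    (hz : ∀ k, ∀ s ∈ Icc 0 T, HasDerivAt (z k) (z' k s) s)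
    (hz_nonneg : ∀ k, ∀ s ∈ Icc 0 T, 0 ≤ z k s)
    (hu' : ∀ k, ∀ s ∈ Icc 0 T, ‖u' k s‖ ≤ A k * ∑ j ∈ hood k, ‖u j s‖ + b k s)
    (hz' : ∀ k, ∀ s ∈ Icc 0 T, A k * ∑ j ∈ hood k, z j s + b k s ≤ z' k s)
    (h0 : ∀ k, ‖u k 0‖ ≤ z k 0)
    (hG : ∀ k, ∀ s ∈ Icc 0 T, ‖u k s‖ ≤ G * Real.exp (sdist k c / 2)) :
    ∀ s ∈ Icc 0 T, ∀ k, ‖u k s‖ ≤ z k s := by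
  intro s hs k
  set y : Site d → ℝ → ℝ := fun j r => Real.exp ((1 + r / T) * sdist j c + ρ * r) with hy
  have hypos : ∀ j r, 0 < y j r := fun _ _ => Real.exp_pos _
  suffices H : ∀ η > 0, ‖u k s‖ ≤ z k s + η * y k s by
    apply le_of_forall_pos_le_add
    intro ε hε
    have := H (ε / y k s) (div_pos hε (hypos k s))
    rwa [div_mul_cancel₀ _ (hypos k s).ne'] at this
  intro η hη
  obtain ⟨N, hN⟩ : ∃ N : ℕ, ∀ m : ℝ, (N : ℝ) ≤ m → G ≤ η * Real.exp (m / 2) := by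
    have : Tendsto (fun m : ℝ => η * Real.exp (m / 2)) atTop atTop :=
      Tendsto.const_mul_atTop hη (Real.tendsto_exp_atTop.comp
        (tendsto_id.atTop_div_const (by norm_num)))
    obtain ⟨m₀, hm₀⟩ := (eventually_atTop.mp (this.eventually_ge_atTop G))
    obtain ⟨N, hN⟩ := exists_nat_ge m₀
    exact ⟨N, fun m hm => hm₀ m (hN.trans hm)⟩
  have hout : ∀ j ∉ cube c N, ∀ r ∈ Icc 0 T, ‖u j r‖ ≤ z j r + η * y j r := by
    intro j hj r hr
    have h₁ := hG j r hr
    have h₂ := hN _ (lt_sdist_of_notMem_cube hj).le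
    have h₃ : Real.exp (sdist j c / 2) * Real.exp (sdist j c / 2) ≤ y j r := by
      rw [← Real.exp_add]
      apply Real.exp_le_exp.mpr
      have := mul_nonneg (div_nonneg hr.1 hT.le) (sdist_nonneg j c)
      have := mul_nonneg hρ hr.1
      linarith
    have h₄ : G * Real.exp (sdist j c / 2) ≤ η * y j r := by
      calc G * Real.exp (sdist j c / 2)
          ≤ η * Real.exp (sdist j c / 2) * Real.exp (sdist j c / 2) := by gcongr
        _ ≤ η * y j r := by rw [mul_assoc]; gcongr
    linarith [hz_nonneg j r hr]
  by_cases hk : k ∈ cube c N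
  swap
  · exact hout k hk s hs
  refine (norm_lt_of_supersolution (cube c N) hood hA (u := u) (u' := u')
    (z := fun j r => z j r + η * y j r)
    (z' := fun j r => z' j r + η * ((sdist j c / T + ρ) * y j r)) (b := b)
    (fun j _ => hu j)
    (fun j _ r hr => (hz j r hr).add ((hasDerivAt_exp_weight _ T ρ 1 r).const_mul η))
    (fun j _ => hu' j) ?_ ?_ hout s hs k hk).le
  · intro j _ r hr
    have h₁ := hz' j r hr
    have h₂ := sum_hood_exp_weight_le (c := c) (k := j) (κ := 0) (σ := 1) hT (by simp) (hA j) hr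
      (by simpa using hAρ j)
    rw [Finset.sum_add_distrib, ← Finset.mul_sum]
    have h₃ := mul_le_mul_of_nonneg_left h₂ hη.le
    simp only [hy]
    linarith
  · intro j _
    have := h0 j
    have := mul_pos hη (hypos j 0)
    linarith

/-- A system of differential inequalities on the lattice, with coefficients growing at most
linearly in space, is dominated by any supersolution, for unknowns of moderate growth. -/
theorem norm_le_of_supersolution (c : Site d) {T ρ G : ℝ} (hT : 0 < T) (hρ : 0 ≤ ρ)
    {A : Site d → ℝ}
    (hA : ∀ k, 0 ≤ A k) (hAρ : ∀ k, A k * (3 ^ d * Real.exp 2) ≤ ρ + sdist k c / T)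
    {u u' : Site d → ℝ → E} {z z' b : Site d → ℝ → ℝ}
    (hu : ∀ k, ∀ s, |s| ≤ T → HasDerivAt (u k) (u' k s) s)
    (hz : ∀ k, ∀ s ∈ Icc 0 T, HasDerivAt (z k) (z' k s) s)
    (hz_nonneg : ∀ k, ∀ s ∈ Icc 0 T, 0 ≤ z k s)
    (hu' : ∀ k, ∀ s, |s| ≤ T → ‖u' k s‖ ≤ A k * ∑ j ∈ hood k, ‖u j s‖ + b k |s|)
    (hz' : ∀ k, ∀ s ∈ Icc 0 T, A k * ∑ j ∈ hood k, z j s + b k s ≤ z' k s)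
    (h0 : ∀ k, ‖u k 0‖ ≤ z k 0)
    (hG : ∀ k, ∀ s, |s| ≤ T → ‖u k s‖ ≤ G * Real.exp (sdist k c / 2)) :
    ∀ s, |s| ≤ T → ∀ k, ‖u k s‖ ≤ z k |s| := by
  intro s hs k
  have hmem : ∀ r ∈ Icc 0 T, |r| ≤ T := fun r hr => by rw [abs_of_nonneg hr.1]; exact hr.2
  rcases le_total 0 s with h | h
  · rw [abs_of_nonneg h] at hs ⊢
    refine norm_le_of_supersolution_right c hT hρ hA hAρ (fun j r hr => hu j r (hmem r hr)) hz
      hz_nonneg (fun j r hr => ?_) hz' h0 (fun j r hr => hG j r (hmem r hr)) s ⟨h, hs⟩ k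
    have := hu' j r (hmem r hr)
    rwa [abs_of_nonneg hr.1] at this
  · rw [abs_of_nonpos h] at hs ⊢
    have hmem' : ∀ r ∈ Icc 0 T, |-r| ≤ T := fun r hr => by rw [abs_neg]; exact hmem r hr
    -- Negative times follow by time reversal, since the hypotheses only involve norms of
    -- derivatives and |s|.
    have := norm_le_of_supersolution_right (u := fun j r => u j (-r))
      (u' := fun j r => -(u' j (-r))) c hT hρ hA hAρ
      (fun j r hr => by
        have := (hu j (-r) (hmem' r hr)).scomp r (hasDerivAt_neg r)
        simpa [Function.comp_def] using this)
      hz hz_nonneg (fun j r hr => ?_) hz' (by simpa using h0)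
      (fun j r hr => hG j (-r) (hmem' r hr)) (-s) ⟨by linarith, hs⟩ k
    · simpa using this
    · have := hu' j (-r) (hmem' r hr)
      rw [norm_neg]
      rwa [abs_neg, abs_of_nonneg hr.1] at this

/-- Solutions of forced differential inequalities on the lattice with exponentially weighted data
stay exponentially weighted, with an exponent that changes slowly. -/
theorem norm_le_exp_weight (c : Site d) {T ρ G H σ : ℝ} (hT : 0 < T) (hρ : 0 ≤ ρ) (hH : 0 ≤ H)
    (hσ : |σ| ≤ 1) {A : Site d → ℝ} (hA : ∀ k, 0 ≤ A k)
    (hAρ : ∀ k, A k * (3 ^ d * Real.exp 2) + 1 ≤ ρ + sdist k c / T)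
    {u u' : Site d → ℝ → E}
    (hu : ∀ k, ∀ s, |s| ≤ T → HasDerivAt (u k) (u' k s) s)
    (hu' : ∀ k, ∀ s, |s| ≤ T →
      ‖u' k s‖ ≤ A k * ∑ j ∈ hood k, ‖u j s‖ + H * Real.exp (σ * sdist k c))
    (h0 : ∀ k, ‖u k 0‖ ≤ H * Real.exp (σ * sdist k c))
    (hG : ∀ k, ∀ s, |s| ≤ T → ‖u k s‖ ≤ G * Real.exp (sdist k c / 2)) :
    ∀ s, |s| ≤ T → ∀ k, ‖u k s‖ ≤ H * Real.exp ((σ + |s| / T) * sdist k c + ρ * |s|) := by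
  refine norm_le_of_supersolution c hT hρ hA (fun k => by linarith [hAρ k]) hu
    (z := fun k s => H * Real.exp ((σ + s / T) * sdist k c + ρ * s))
    (z' := fun k s => H * ((sdist k c / T + ρ) * Real.exp ((σ + s / T) * sdist k c + ρ * s)))
    (b := fun k _ => H * Real.exp (σ * sdist k c))
    (fun k s _ => (hasDerivAt_exp_weight _ T ρ σ s).const_mul H) (fun k s _ => by positivity)
    hu' (fun k s hs => ?_) (fun k => by simpa using h0 k) hG
  -- The `+ 1` in `hAρ` is spent on the forcing, whose weight is the one at time 0 and is below the
  -- current weight.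
  have h₁ := sum_hood_exp_weight_le (c := c) (k := k) (κ := 1) hT hσ (hA k) hs (hAρ k)
  have h₂ : Real.exp (σ * sdist k c) ≤ Real.exp ((σ + s / T) * sdist k c + ρ * s) := by
    apply Real.exp_le_exp.mpr
    have := mul_nonneg (div_nonneg hs.1 hT.le) (sdist_nonneg k c)
    have := mul_nonneg hρ hs.1
    linarith
  have h₃ := mul_le_mul_of_nonneg_left h₁ hH
  have h₄ := mul_le_mul_of_nonneg_left h₂ hH
  rw [← Finset.mul_sum]
  linarith

end Comparison

/-! ### Bounds for quartic polynomials -/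

section Quartic

theorem exists_quartic_coeffs {U : Polynomial ℝ} (h : U.natDegree = 4) :
    ∃ a₀ a₁ a₂ a₃ : ℝ,
      (∀ s, U.eval s = U.leadingCoeff * s ^ 4 + a₃ * s ^ 3 + a₂ * s ^ 2 + a₁ * s + a₀) ∧
      (∀ s, U.derivative.eval s =
        4 * U.leadingCoeff * s ^ 3 + 3 * a₃ * s ^ 2 + 2 * a₂ * s + a₁) ∧
      (∀ s, U.derivative.derivative.eval s =
        12 * U.leadingCoeff * s ^ 2 + 6 * a₃ * s + 2 * a₂) := by
  refine ⟨U.coeff 0, U.coeff 1, U.coeff 2, U.coeff 3, ?_⟩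
  have h4 : U.leadingCoeff = U.coeff 4 := by simp [Polynomial.leadingCoeff, h]
  rw [h4]
  have hU : U = Polynomial.C (U.coeff 4) * Polynomial.X ^ 4 +
      Polynomial.C (U.coeff 3) * Polynomial.X ^ 3 + Polynomial.C (U.coeff 2) * Polynomial.X ^ 2 +
      Polynomial.C (U.coeff 1) * Polynomial.X + Polynomial.C (U.coeff 0) := by
    conv_lhs => rw [U.as_sum_range_C_mul_X_pow, h]
    simp only [Finset.sum_range_succ, Finset.sum_range_zero, pow_zero, pow_one, mul_one]
    ring
  generalize U.coeff 0 = a₀ at *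
  generalize U.coeff 1 = a₁ at *
  generalize U.coeff 2 = a₂ at *
  generalize U.coeff 3 = a₃ at *
  generalize U.coeff 4 = a₄ at *
  subst hU
  refine ⟨fun s => ?_, fun s => ?_, fun s => ?_⟩
  · simp
  · simp; ring
  · simp; ring

theorem abs_le_one_add_sq_div_two (a : ℝ) : |a| ≤ (1 + a ^ 2) / 2 := by
  have h := sq_nonneg (|a| - 1)
  have := sq_abs a
  nlinarith

/-- The bounds for a quartic polynomial `U` that enter the proofs. -/
structure QuarticBounds (U : Polynomial ℝ) (C : ℝ) : Prop where
  one_le : 1 ≤ C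
  nonneg : ∀ q, 0 ≤ U.eval q
  pow_four_le : ∀ q, q ^ 4 ≤ C * (U.eval q + 1)
  deriv_le : ∀ a, |U.derivative.eval a| ≤ C * (1 + a ^ 4)
  deriv_sub_le : ∀ a b, |U.derivative.eval a - U.derivative.eval b| ≤
    C * (1 + a ^ 2 + b ^ 2) * |a - b|
  deriv2_le : ∀ a, |U.derivative.derivative.eval a| ≤ C * (1 + a ^ 2)
  taylor_le : ∀ a b, |U.derivative.eval b - U.derivative.eval a -
    U.derivative.derivative.eval a * (b - a)| ≤ C * (1 + |a| + |b|) * (b - a) ^ 2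

theorem exists_quarticBounds {U : Polynomial ℝ} (hdeg : U.natDegree = 4)
    (hlead : 0 < U.leadingCoeff) (hnonneg : ∀ s : ℝ, 0 ≤ U.eval s) :
    ∃ C, QuarticBounds U C := by
  obtain ⟨a₀, a₁, a₂, a₃, h0, h1, h2⟩ := exists_quartic_coeffs hdeg
  generalize U.leadingCoeff = a₄ at *
  set B := |a₀| + |a₁| + |a₂| + |a₃| with hB
  -- Beyond `R` the lower-order terms use up at most half of the leading term.
  set R := 1 + 2 * B / a₄ with hR
  have hB0 : 0 ≤ B := by positivity
  have hR1 : 1 ≤ R := by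
    have : 0 ≤ 2 * B / a₄ := by positivity
    linarith
  have hRpos : 0 ≤ R ^ 4 := by positivity
  have h2a : 0 < 2 / a₄ := by positivity
  -- The final constant is a sum dominating the constants of the individual bounds, so each of them
  -- can be proved with its own.
  have hbig : ∀ {c X Y : ℝ}, c ≤ 1 + 20 * (B + a₄) + 2 / a₄ + R ^ 4 → 0 ≤ Y → X ≤ c * Y →
      X ≤ (1 + 20 * (B + a₄) + 2 / a₄ + R ^ 4) * Y := fun hc hY hX =>
    hX.trans (mul_le_mul_of_nonneg_right hc hY)
  have e0 := abs_nonneg a₀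
  have e1 := abs_nonneg a₁
  have e2 := abs_nonneg a₂
  have e3 := abs_nonneg a₃
  refine ⟨1 + 20 * (B + a₄) + 2 / a₄ + R ^ 4, ?_, hnonneg, ?_, ?_, ?_, ?_, ?_⟩
  · have : 0 ≤ 20 * (B + a₄) := by positivity
    linarith
  · intro q
    have hU1 : 0 ≤ U.eval q + 1 := by linarith [hnonneg q]
    rcases le_total |q| R with hq | hq
    · refine hbig (c := R ^ 4) (by linarith) hU1 ?_
      have : q ^ 4 ≤ R ^ 4 := by
        rw [← Even.pow_abs (show Even 4 by decide) q]
        gcongr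
      nlinarith [hnonneg q]
    · refine hbig (c := 2 / a₄) (by linarith) hU1 ?_
      have hq1 : 1 ≤ |q| := hR1.trans hq
      have hBq : B * |q| ^ 3 ≤ a₄ / 2 * q ^ 4 := by
        have : 2 * B / a₄ ≤ |q| := by linarith
        rw [div_le_iff₀ hlead] at this
        have h4 : q ^ 4 = |q| ^ 3 * |q| := by
          rw [← Even.pow_abs (show Even 4 by decide) q]; ring
        have : (0 : ℝ) ≤ |q| ^ 3 := by positivity
        rw [h4]
        nlinarith
      have b3 : |a₃ * q ^ 3| ≤ |a₃| * |q| ^ 3 := by rw [abs_mul, abs_pow]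
      have b2 : |a₂ * q ^ 2| ≤ |a₂| * |q| ^ 3 := by
        rw [abs_mul, abs_pow]
        gcongr
        norm_num
      have b1 : |a₁ * q| ≤ |a₁| * |q| ^ 3 := by
        rw [abs_mul]
        gcongr
        exact le_self_pow₀ hq1 (by norm_num)
      have b0 : |a₀| ≤ |a₀| * |q| ^ 3 := le_mul_of_one_le_right e0 (one_le_pow₀ hq1)
      have : a₄ / 2 * q ^ 4 ≤ U.eval q := by
        rw [h0 q]
        have c3 := neg_abs_le (a₃ * q ^ 3)
        have c2 := neg_abs_le (a₂ * q ^ 2)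
        have c1 := neg_abs_le (a₁ * q)
        have c0 := neg_abs_le a₀
        have : B * |q| ^ 3 = |a₀| * |q| ^ 3 + |a₁| * |q| ^ 3 + |a₂| * |q| ^ 3 + |a₃| * |q| ^ 3 := by
          rw [hB]; ring
        linarith
      rw [div_mul_eq_mul_div, le_div_iff₀ hlead]
      linarith
  · intro a
    refine hbig (c := 10 * (B + a₄)) (by nlinarith) (by positivity) ?_
    rw [h1 a, abs_le]
    have q2 : a ^ 2 ≤ 1 + a ^ 4 := by nlinarith [sq_nonneg (a ^ 2 - 1)]
    have q1 : |a| ≤ 1 + a ^ 4 := by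
      have : 0 ≤ a ^ 4 := by positivity
      linarith [abs_le_one_add_sq_div_two a]
    have q3 : |a ^ 3| ≤ 1 + a ^ 4 := by
      rw [abs_pow]
      have := abs_nonneg a
      have h4 : a ^ 4 = |a| ^ 4 := (Even.pow_abs (show Even 4 by decide) a).symm
      rw [h4]
      rcases le_total |a| 1 with h | h
      · have := pow_le_one₀ (n := 3) this h
        have : (0 : ℝ) ≤ |a| ^ 4 := by positivity
        linarith
      · have := pow_le_pow_right₀ h (show 3 ≤ 4 by norm_num)
        linarith
    have t3 : |4 * a₄ * a ^ 3| ≤ 4 * a₄ * (1 + a ^ 4) := by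
      rw [abs_mul, abs_of_pos (by positivity : (0 : ℝ) < 4 * a₄)]; gcongr
    have t2 : |3 * a₃ * a ^ 2| ≤ 3 * |a₃| * (1 + a ^ 4) := by
      rw [abs_mul, abs_mul, abs_of_pos (by norm_num : (0 : ℝ) < 3), abs_of_nonneg (sq_nonneg a)]
      gcongr
    have t1 : |2 * a₂ * a| ≤ 2 * |a₂| * (1 + a ^ 4) := by
      rw [abs_mul, abs_mul, abs_of_pos (by norm_num : (0 : ℝ) < 2)]
      gcongr
    have t0 : |a₁| ≤ |a₁| * (1 + a ^ 4) := le_mul_of_one_le_right e1 (by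
      have : 0 ≤ a ^ 4 := by positivity
      linarith)
    have p : 0 ≤ 1 + a ^ 4 := by positivity
    have r0 := mul_nonneg e0 p
    have r1 := mul_nonneg e1 p
    have r2 := mul_nonneg e2 p
    have r3 := mul_nonneg e3 p
    have r4 := mul_nonneg hlead.le p
    have s3 := abs_le.mp t3
    have s2 := abs_le.mp t2
    have s1 := abs_le.mp t1
    have s0 := abs_le.mp t0
    rw [hB]
    constructor <;> linarith [s3.1, s3.2, s2.1, s2.2, s1.1, s1.2, s0.1, s0.2]
  · intro a b
    rw [mul_assoc]
    refine hbig (c := 10 * (B + a₄)) (by nlinarith) (by positivity) ?_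
    have : U.derivative.eval a - U.derivative.eval b =
        (4 * a₄ * (a ^ 2 + a * b + b ^ 2) + 3 * a₃ * (a + b) + 2 * a₂) * (a - b) := by
      rw [h1, h1]; ring
    rw [this, abs_mul, ← mul_assoc]
    refine mul_le_mul_of_nonneg_right ?_ (abs_nonneg _)
    have p : 0 ≤ 1 + a ^ 2 + b ^ 2 := by positivity
    have t3 : |4 * a₄ * (a ^ 2 + a * b + b ^ 2)| ≤ 4 * a₄ * (2 * (1 + a ^ 2 + b ^ 2)) := by
      rw [abs_mul, abs_of_pos (by positivity : (0 : ℝ) < 4 * a₄)]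
      gcongr
      rw [abs_le]
      constructor <;> nlinarith [sq_nonneg (a + b), sq_nonneg (a - b)]
    have t2 : |3 * a₃ * (a + b)| ≤ 3 * |a₃| * (1 + a ^ 2 + b ^ 2) := by
      rw [abs_mul, abs_mul, abs_of_pos (by norm_num : (0 : ℝ) < 3)]
      gcongr
      have := abs_add_le a b
      have := abs_le_one_add_sq_div_two a
      have := abs_le_one_add_sq_div_two b
      nlinarith
    have t1 : |2 * a₂| ≤ 2 * |a₂| * (1 + a ^ 2 + b ^ 2) := by
      rw [abs_mul, abs_of_pos (by norm_num : (0 : ℝ) < 2)]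
      refine le_mul_of_one_le_right (by positivity) (by nlinarith)
    have r0 := mul_nonneg e0 p
    have r1 := mul_nonneg e1 p
    have r2 := mul_nonneg e2 p
    have r3 := mul_nonneg e3 p
    have r4 := mul_nonneg hlead.le p
    refine (abs_add_three _ _ _).trans ?_
    rw [hB]
    linarith
  · intro a
    refine hbig (c := 20 * (B + a₄)) (by nlinarith) (by positivity) ?_
    rw [h2 a]
    have p : 0 ≤ 1 + a ^ 2 := by positivity
    have t3 : |12 * a₄ * a ^ 2| ≤ 12 * a₄ * (1 + a ^ 2) := by
      rw [abs_of_nonneg (by positivity)]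
      gcongr
      linarith
    have t2 : |6 * a₃ * a| ≤ 6 * |a₃| * (1 + a ^ 2) := by
      rw [abs_mul, abs_mul, abs_of_pos (by norm_num : (0 : ℝ) < 6)]
      gcongr
      linarith [abs_le_one_add_sq_div_two a]
    have t1 : |2 * a₂| ≤ 2 * |a₂| * (1 + a ^ 2) := by
      rw [abs_mul, abs_of_pos (by norm_num : (0 : ℝ) < 2)]
      refine le_mul_of_one_le_right (by positivity) (by nlinarith)
    have r0 := mul_nonneg e0 p
    have r1 := mul_nonneg e1 p
    have r2 := mul_nonneg e2 p
    have r3 := mul_nonneg e3 p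
    have r4 := mul_nonneg hlead.le p
    refine (abs_add_three _ _ _).trans ?_
    rw [hB]
    linarith
  · intro a b
    rw [mul_assoc]
    refine hbig (c := 10 * (B + a₄)) (by nlinarith) (by positivity) ?_
    -- The derivative is cubic, so its second-order Taylor remainder is exactly (b - a)^2 times an
    -- affine function of a and b.
    have : U.derivative.eval b - U.derivative.eval a -
        U.derivative.derivative.eval a * (b - a) =
        (4 * a₄ * (2 * a + b) + 3 * a₃) * (b - a) ^ 2 := by
      rw [h1, h1, h2]; ring
    rw [this, abs_mul, abs_of_nonneg (sq_nonneg (b - a)), ← mul_assoc]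
    refine mul_le_mul_of_nonneg_right ?_ (sq_nonneg _)
    have p : 0 ≤ 1 + |a| + |b| := by positivity
    have t3 : |4 * a₄ * (2 * a + b)| ≤ 4 * a₄ * (2 * (1 + |a| + |b|)) := by
      rw [abs_mul, abs_of_pos (by positivity : (0 : ℝ) < 4 * a₄)]
      gcongr
      have h := abs_add_le (2 * a) b
      rw [abs_mul, abs_two] at h
      linarith [abs_nonneg b]
    have t2 : |3 * a₃| ≤ 3 * |a₃| * (1 + |a| + |b|) := by
      rw [abs_mul, abs_of_pos (by norm_num : (0 : ℝ) < 3)]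
      refine le_mul_of_one_le_right (by positivity) ?_
      linarith [abs_nonneg a, abs_nonneg b]
    have r0 := mul_nonneg e0 p
    have r1 := mul_nonneg e1 p
    have r2 := mul_nonneg e2 p
    have r3 := mul_nonneg e3 p
    have r4 := mul_nonneg hlead.le p
    refine (abs_add_le _ _).trans ?_
    rw [hB]
    linarith

end Quartic

/-! ### Exponential sums over the lattice -/

section Sums

variable {d : ℕ}

theorem summable_exp_neg_abs_int {a : ℝ} (ha : 0 < a) :
    Summable fun n : ℤ => Real.exp (-a * |(n : ℝ)|) := by
  have h : Summable fun n : ℕ => Real.exp (-a * |((n : ℤ) : ℝ)|) := by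
    have := Real.summable_exp_nat_mul_iff.mpr (neg_neg_of_pos ha)
    refine this.congr fun n => ?_
    simp [mul_comm]
  refine Summable.of_nat_of_neg h ?_
  simpa using h

/-- Products of summable functions on `ℤ` are summable on `ℤ^d`. -/
theorem summable_prod_site {f : ℤ → ℝ} (hf : Summable f) (h0 : ∀ n, 0 ≤ f n) :
    Summable fun l : Site d => ∏ m, f (l m) := by
  classical
  refine summable_of_sum_le (c := (∑' n, f n) ^ d)
    (fun l => Finset.prod_nonneg fun m _ => h0 _) fun u => ?_
  set t : Fin d → Finset ℤ := fun m => u.image fun l => l m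
  calc ∑ l ∈ u, ∏ m, f (l m) ≤ ∑ l ∈ Fintype.piFinset t, ∏ m, f (l m) := by
        refine Finset.sum_le_sum_of_subset_of_nonneg ?_
          fun l _ _ => Finset.prod_nonneg fun m _ => h0 _
        intro l hl
        rw [Fintype.mem_piFinset]
        exact fun m => Finset.mem_image_of_mem _ hl
    _ = ∏ m, ∑ n ∈ t m, f n := (Finset.prod_univ_sum t fun _ n => f n).symm
    _ ≤ ∏ _m : Fin d, ∑' n, f n :=
        Finset.prod_le_prod (fun m _ => Finset.sum_nonneg fun n _ => h0 n)
          fun m _ => hf.sum_le_tsum _ fun n _ => h0 n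
    _ = (∑' n, f n) ^ d := by simp

theorem sdist_add_left (i j l : Site d) : sdist (i + j) (i + l) = sdist j l := by
  simp [sdist, siteDist]

theorem sdist_self_add (i l : Site d) : sdist i (i + l) = sdist l 0 := by
  have := sdist_add_left i 0 l
  rw [add_zero] at this
  rw [this, sdist_comm]

/-- With the ℓ¹ distance the exponential is a product over the coordinates, which reduces the claim
to geometric series on ℤ. -/
theorem summable_exp_neg_sdist (c : Site d) {a : ℝ} (ha : 0 < a) :
    Summable fun j : Site d => Real.exp (-a * sdist c j) := by
  rw [← (Equiv.addLeft c).summable_iff]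
  refine (summable_prod_site (d := d) (summable_exp_neg_abs_int ha)
    fun _ => (Real.exp_pos _).le).congr fun l => ?_
  simp only [Function.comp, Equiv.coe_addLeft]
  rw [sdist_self_add, ← Real.exp_sum]
  simp [sdist, siteDist, Finset.mul_sum]

/-- This is `y ^ d / d! ≤ exp y` at y = (2m + 1)/4. The scaling spends only exp(m/2), so that half
of a weight exp(-m) is left for summation. -/
theorem pow_le_exp_half (d : ℕ) {m : ℝ} (hm : 0 ≤ m) :
    (2 * m + 1) ^ d ≤ 4 ^ d * d.factorial * Real.exp (1 / 4) * Real.exp (m / 2) := by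
  have h := Real.pow_div_factorial_le_exp ((2 * m + 1) / 4) (by positivity) d
  rw [div_le_iff₀ (by positivity), div_pow, div_le_iff₀ (by positivity)] at h
  refine h.trans (le_of_eq ?_)
  rw [show (2 * m + 1) / 4 = 1 / 4 + m / 2 by ring, Real.exp_add]
  ring

/-- The weights that compare the energy of a cube with the energies of larger cubes. -/
def spreadWeight (d : ℕ) (l : Site d) : ℝ := Real.exp (-sdist l 0) * (2 * sdist l 0 + 1) ^ d

theorem spreadWeight_nonneg (l : Site d) : 0 ≤ spreadWeight d l := by
  have := sdist_nonneg l 0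
  unfold spreadWeight
  positivity

theorem summable_spreadWeight : Summable (spreadWeight d) := by
  refine Summable.of_nonneg_of_le spreadWeight_nonneg (fun l => ?_)
    ((summable_exp_neg_sdist (0 : Site d) (a := 1 / 2) (by norm_num)).mul_left
      (4 ^ d * d.factorial * Real.exp (1 / 4)))
  have h := pow_le_exp_half d (sdist_nonneg l 0)
  unfold spreadWeight
  calc _ ≤ Real.exp (-sdist l 0) *
        (4 ^ d * d.factorial * Real.exp (1 / 4) * Real.exp (sdist l 0 / 2)) := by gcongr
    _ = 4 ^ d * d.factorial * Real.exp (1 / 4) *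
        (Real.exp (-sdist l 0) * Real.exp (sdist l 0 / 2)) := by ring
    _ = _ := by
      rw [← Real.exp_add, sdist_comm 0 l]
      congr 2
      ring

/-- The sum of the weights `spreadWeight`. -/
def spreadConst (d : ℕ) : ℝ := ∑' l : Site d, spreadWeight d l

theorem one_le_spreadConst : 1 ≤ spreadConst d := by
  have h := summable_spreadWeight.le_tsum (0 : Site d) fun l _ => spreadWeight_nonneg l
  have h₀ : spreadWeight d 0 = 1 := by simp [spreadWeight, sdist_self]
  rwa [h₀] at h

end Sums

/-! ### Site energies -/

section Energy

variable {d : ℕ} (U : Polynomial ℝ) (K : ℝ)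

/-- The energy of the site `i`, with half of the energy of each bond at `i`. -/
def siteEnergy (i : Site d) (x : Config d) : ℝ :=
  (x i).2 ^ 2 / 2 + U.eval (x i).1 + 1 + ∑ j ∈ neighbors i, K / 4 * ((x i).1 - (x j).1) ^ 2

/-- The sum of the site energies over a cube. -/
def cubeEnergy (ν : Site d) (k : ℕ) (x : Config d) : ℝ := ∑ i ∈ cube ν k, siteEnergy U K i x

/-- The velocity `(p_i, F_i(x))` of the site `i`. -/
def velocity (i : Site d) (x : Config d) : ℝ × ℝ := ((x i).2, force U K i x)

/-- A solution for the times `|t| ≤ T` of the system in which only the sites in `S` move. -/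
def IsPartialSolution (S : Set (Site d)) (T : ℝ) (γ : ℝ → Config d) : Prop :=
  ∀ i t, |t| ≤ T → HasDerivAt (fun s => γ s i) (S.indicator (fun j => velocity U K j (γ t)) i) t

variable {U K}

theorem siteEnergy_nonneg_aux (hK : 0 < K) (i : Site d) (x : Config d) :
    0 ≤ ∑ j ∈ neighbors i, K / 4 * ((x i).1 - (x j).1) ^ 2 :=
  Finset.sum_nonneg fun _ _ => by positivity

theorem one_le_siteEnergy (hK : 0 < K) (hU : ∀ q, 0 ≤ U.eval q)
    (i : Site d) (x : Config d) : 1 ≤ siteEnergy U K i x := by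
  have h := siteEnergy_nonneg_aux hK i x
  have := hU (x i).1
  have := sq_nonneg (x i).2
  unfold siteEnergy
  linarith

theorem siteEnergy_nonneg (hK : 0 < K) (hU : ∀ q, 0 ≤ U.eval q)
    (i : Site d) (x : Config d) : 0 ≤ siteEnergy U K i x :=
  zero_le_one.trans (one_le_siteEnergy hK hU i x)

theorem sq_momentum_le (hK : 0 < K) (hU : ∀ q, 0 ≤ U.eval q)
    (i : Site d) (x : Config d) : (x i).2 ^ 2 ≤ 2 * siteEnergy U K i x := by
  have h := siteEnergy_nonneg_aux hK i x
  have := hU (x i).1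
  unfold siteEnergy
  linarith

theorem eval_add_one_le (hK : 0 < K) (i : Site d) (x : Config d) :
    U.eval (x i).1 + 1 ≤ siteEnergy U K i x := by
  have h := siteEnergy_nonneg_aux hK i x
  have := sq_nonneg (x i).2
  unfold siteEnergy
  linarith

theorem bond_le (hK : 0 < K) (hU : ∀ q, 0 ≤ U.eval q)
    {i j : Site d} (hj : j ∈ neighbors i) (x : Config d) :
    K * ((x i).1 - (x j).1) ^ 2 ≤ 4 * siteEnergy U K i x := by
  have h := Finset.single_le_sum (f := fun j => K / 4 * ((x i).1 - (x j).1) ^ 2)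
    (fun _ _ => by positivity) hj
  have := hU (x i).1
  have := sq_nonneg (x i).2
  unfold siteEnergy
  linarith

/-- The two energies differ by the bonds that leave the cube, which only `cubeEnergy` counts. These
bonds lie in the next larger cube, so the two families interlace. -/
theorem localEnergy_le_cubeEnergy (hK : 0 < K) (ν : Site d) (k : ℕ) (x : Config d) :
    localEnergy U K ν k x ≤ cubeEnergy U K ν k x := by
  unfold localEnergy cubeEnergy siteEnergy
  refine le_of_le_of_eq ?_ Finset.sum_add_distrib.symm
  refine add_le_add le_rfl (Finset.sum_le_sum fun i hi => ?_)
  refine Finset.sum_le_sum_of_subset_of_nonneg ?_ fun _ _ _ => by positivity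
  intro j hj
  exact (mem_neighbors i j).mpr (Finset.mem_filter.mp hj).2

theorem cubeEnergy_le_localEnergy (hK : 0 < K) (hU : ∀ q, 0 ≤ U.eval q)
    (ν : Site d) (k : ℕ) (x : Config d) :
    cubeEnergy U K ν k x ≤ localEnergy U K ν (k + 1) x := by
  have hsub := cube_mono ν (Nat.le_succ k)
  unfold localEnergy cubeEnergy siteEnergy
  rw [Finset.sum_add_distrib]
  refine add_le_add ?_ ?_
  · refine Finset.sum_le_sum_of_subset_of_nonneg hsub fun i _ _ => ?_
    have := hU (x i).1
    positivity
  · refine le_trans ?_ (Finset.sum_le_sum_of_subset_of_nonneg hsub fun i _ _ =>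
      Finset.sum_nonneg fun _ _ => by positivity)
    refine Finset.sum_le_sum fun i hi => ?_
    refine Finset.sum_le_sum_of_subset_of_nonneg ?_ fun _ _ _ => by positivity
    intro j hj
    exact Finset.mem_filter.mpr ⟨neighbors_subset_cube_succ hi hj, (mem_neighbors i j).mp hj⟩

theorem siteEnergy_le_cubeEnergy (hK : 0 < K) (hU : ∀ q, 0 ≤ U.eval q)
    {ν i : Site d} {k : ℕ} (hi : i ∈ cube ν k) (x : Config d) :
    siteEnergy U K i x ≤ cubeEnergy U K ν k x :=
  Finset.single_le_sum (f := fun i => siteEnergy U K i x)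
    (fun i _ => siteEnergy_nonneg hK hU i x) hi

/-- A discrete convolution estimate: exponentially spread energies in a cube are controlled by the
energies of the larger concentric cubes. -/
theorem sum_cube_tsum_le (hK : 0 < K) (hU : ∀ q, 0 ≤ U.eval q)
    {ν : Site d} {k : ℕ} {x : Config d} {M : ℝ}
    (hM : ∀ l, k ≤ l → cubeEnergy U K ν l x ≤ M * (2 * (l : ℝ) + 1) ^ d)
    (hsum : ∀ i, Summable fun j => Real.exp (-sdist i j) * siteEnergy U K j x) :
    ∑ i ∈ cube ν k, ∑' j, Real.exp (-sdist i j) * siteEnergy U K j x ≤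
      spreadConst d * (M * (2 * (k : ℝ) + 1) ^ d) := by
  have hM0 : 0 ≤ M := by
    have h := hM k le_rfl
    have h' : 0 ≤ cubeEnergy U K ν k x := Finset.sum_nonneg fun i _ => siteEnergy_nonneg hK hU i x
    by_contra! hneg
    have : M * (2 * (k : ℝ) + 1) ^ d < 0 := mul_neg_of_neg_of_pos hneg (by positivity)
    linarith
  -- Writing j = i + l and summing over `i` first, the cube shifted by `l` lies in the concentric
  -- cube enlarged by |l|, where the hypothesis applies.
  have hshift : ∀ i : Site d, (∑' j, Real.exp (-sdist i j) * siteEnergy U K j x) =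
      ∑' l, Real.exp (-sdist l 0) * siteEnergy U K (i + l) x := by
    intro i
    rw [← (Equiv.addLeft i).tsum_eq]
    simp [sdist_self_add]
  have hsum' : ∀ i : Site d,
      Summable fun l => Real.exp (-sdist l 0) * siteEnergy U K (i + l) x := by
    intro i
    have := (Equiv.addLeft i).summable_iff.mpr (hsum i)
    refine this.congr fun l => ?_
    simp [sdist_self_add]
  simp_rw [hshift]
  rw [← Summable.tsum_finsetSum fun i _ => hsum' i, spreadConst, ← tsum_mul_right]
  refine Summable.tsum_le_tsum (fun l => ?_) (summable_sum fun i _ => hsum' i)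
    (summable_spreadWeight.mul_right _)
  rw [← Finset.mul_sum, spreadWeight, mul_assoc]
  refine mul_le_mul_of_nonneg_left ?_ (Real.exp_pos _).le
  set m : ℕ := (siteDist l 0).toNat with hm
  have hmz : (m : ℤ) = siteDist l 0 := Int.toNat_of_nonneg (siteDist_nonneg _ _)
  have hmr : (m : ℝ) = sdist l 0 := by
    unfold sdist
    exact_mod_cast hmz
  have h₁ : ∑ i ∈ cube ν k, siteEnergy U K (i + l) x ≤ cubeEnergy U K ν (k + m) x := by
    unfold cubeEnergy
    rw [← Finset.sum_image (s := cube ν k) (g := fun i => i + l)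
      (f := fun i => siteEnergy U K i x) fun a _ b _ h => add_right_cancel h]
    refine Finset.sum_le_sum_of_subset_of_nonneg ?_ fun i _ _ => siteEnergy_nonneg hK hU i x
    intro j hj
    obtain ⟨i, hi, rfl⟩ := Finset.mem_image.mp hj
    rw [mem_cube] at hi ⊢
    intro n
    have h₁ := abs_sub_le_siteDist l 0 n
    have h₂ := abs_add_le (i n - ν n) (l n)
    have := hi n
    simp only [Pi.zero_apply, sub_zero] at h₁
    have h₃ : (i + l) n - ν n = i n - ν n + l n := by simp; ring
    rw [h₃]
    push_cast
    linarith
  refine h₁.trans ((hM (k + m) (Nat.le_add_right _ _)).trans ?_)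
  -- The volume factor splits because 2(k + m) + 1 ≤ (2m + 1)(2k + 1); the factor with m belongs to
  -- `spreadWeight`.
  rw [← hmr, mul_left_comm, ← mul_pow]
  gcongr
  push_cast
  nlinarith [mul_nonneg (Nat.cast_nonneg (α := ℝ) k) (Nat.cast_nonneg (α := ℝ) m)]

theorem hasDerivAt_siteEnergy {γ : ℝ → Config d} {v : Site d → ℝ × ℝ} {t : ℝ}
    (h : ∀ i, HasDerivAt (fun s => γ s i) (v i) t) (i : Site d) :
    HasDerivAt (fun s => siteEnergy U K i (γ s))
      ((γ t i).2 * (v i).2 + U.derivative.eval (γ t i).1 * (v i).1 +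
        ∑ j ∈ neighbors i, K / 2 * ((γ t i).1 - (γ t j).1) * ((v i).1 - (v j).1)) t := by
  have hq : ∀ j, HasDerivAt (fun s => (γ s j).1) (v j).1 t := fun j =>
    (ContinuousLinearMap.fst ℝ ℝ ℝ).hasFDerivAt.comp_hasDerivAt t (h j)
  have hp : ∀ j, HasDerivAt (fun s => (γ s j).2) (v j).2 t := fun j =>
    (ContinuousLinearMap.snd ℝ ℝ ℝ).hasFDerivAt.comp_hasDerivAt t (h j)
  have h₁ : HasDerivAt (fun s => (γ s i).2 ^ 2 / 2) ((γ t i).2 * (v i).2) t := by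
    refine (((hp i).pow 2).div_const 2).congr_deriv ?_
    simp
    ring
  have h₂ : HasDerivAt (fun s => U.eval (γ s i).1) (U.derivative.eval (γ t i).1 * (v i).1) t :=
    (U.hasDerivAt (γ t i).1).comp (h := fun s => (γ s i).1) t (hq i)
  have h₃ : ∀ j ∈ neighbors i, HasDerivAt (fun s => K / 4 * ((γ s i).1 - (γ s j).1) ^ 2)
      (K / 2 * ((γ t i).1 - (γ t j).1) * ((v i).1 - (v j).1)) t := by
    intro j _
    refine ((((hq i).sub (hq j)).pow 2).const_mul (K / 4)).congr_deriv ?_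
    simp
    ring
  exact ((h₁.add h₂).add_const 1).add (HasDerivAt.fun_sum h₃)

/-- The rate of change of the site energies is bounded by the energies nearby. -/
theorem abs_deriv_siteEnergy_le (hK : 0 < K) (hU : ∀ q, 0 ≤ U.eval q)
    {S : Set (Site d)} {x : Config d} (i : Site d) {v : Site d → ℝ × ℝ}
    (hv : ∀ j, v j = S.indicator (fun j => velocity U K j x) j) :
    |(x i).2 * (v i).2 + U.derivative.eval (x i).1 * (v i).1 +
        ∑ j ∈ neighbors i, K / 2 * ((x i).1 - (x j).1) * ((v i).1 - (v j).1)| ≤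
      (3 ^ d * (4 + 2 * K)) * ∑ j ∈ hood i, siteEnergy U K j x := by
  set Etot := ∑ j ∈ hood i, siteEnergy U K j x
  have hmem : ∀ j ∈ hood i, siteEnergy U K j x ≤ Etot := fun j hj =>
    Finset.single_le_sum (f := fun j => siteEnergy U K j x)
      (fun j _ => siteEnergy_nonneg hK hU j x) hj
  have hv1 : ∀ j, |(v j).1| ≤ |(x j).2| := by
    intro j
    rw [hv j]
    by_cases hj : j ∈ S
    · simp [hj, velocity]
    · simp [hj]
  -- The on-site force does work equal to the loss of potential energy and cancels, so `U'`
  -- disappears and only currents through the bonds remain. The formula also covers a frozen site,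
  -- for which `v i = 0`.
  have hrew : (x i).2 * (v i).2 + U.derivative.eval (x i).1 * (v i).1 +
        ∑ j ∈ neighbors i, K / 2 * ((x i).1 - (x j).1) * ((v i).1 - (v j).1) =
      ∑ j ∈ neighbors i, -(K / 2) * ((x i).1 - (x j).1) * ((v i).1 + (v j).1) := by
    have hi := hv i
    by_cases his : i ∈ S
    · rw [Set.indicator_of_mem his] at hi
      rw [hi]
      simp only [velocity, force]
      have hF : (x i).2 * (-(U.derivative.eval (x i).1) -
          K * ∑ j ∈ neighbors i, ((x i).1 - (x j).1)) + U.derivative.eval (x i).1 * (x i).2 =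
          ∑ j ∈ neighbors i, -(K * (x i).2) * ((x i).1 - (x j).1) := by
        rw [← Finset.mul_sum]
        ring
      rw [hF, ← Finset.sum_add_distrib]
      refine Finset.sum_congr rfl fun j _ => ?_
      ring
    · rw [Set.indicator_of_notMem his] at hi
      rw [hi]
      simp only [Prod.fst_zero, Prod.snd_zero, mul_zero, zero_add]
      refine Finset.sum_congr rfl fun j _ => ?_
      ring
  rw [hrew]
  refine (Finset.abs_sum_le_sum_abs _ _).trans ?_
  have hterm : ∀ j ∈ neighbors i,
      |-(K / 2) * ((x i).1 - (x j).1) * ((v i).1 + (v j).1)| ≤ (4 + 2 * K) * Etot := by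
    intro j hj
    have b₁ := bond_le hK hU hj x
    have b₂ := sq_momentum_le hK hU i x
    have b₃ := sq_momentum_le hK hU j x
    have b₄ := hmem i (self_mem_hood i)
    have b₅ := hmem j (mem_hood_of_mem_neighbors hj)
    have b₆ : ((v i).1 + (v j).1) ^ 2 ≤ 2 * ((x i).2 ^ 2 + (x j).2 ^ 2) := by
      have := sq_le_sq.mpr (hv1 i)
      have := sq_le_sq.mpr (hv1 j)
      nlinarith [sq_nonneg ((v i).1 - (v j).1)]
    have b₇ := mul_le_mul_of_nonneg_left b₆ hK.le
    have b₈ : 0 ≤ Etot := (siteEnergy_nonneg hK hU i x).trans b₄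
    have b₉ : K * ((x i).2 ^ 2 + (x j).2 ^ 2) ≤ K * (4 * Etot) := by
      gcongr
      linarith
    rw [abs_le]
    constructor
    · nlinarith [mul_nonneg hK.le (sq_nonneg (((x i).1 - (x j).1) - ((v i).1 + (v j).1)))]
    · nlinarith [mul_nonneg hK.le (sq_nonneg (((x i).1 - (x j).1) + ((v i).1 + (v j).1)))]
  have hEtot : 0 ≤ Etot := (siteEnergy_nonneg hK hU i x).trans (hmem i (self_mem_hood i))
  calc _ ≤ ∑ _j ∈ neighbors i, (4 + 2 * K) * Etot := Finset.sum_le_sum hterm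
    _ ≤ ∑ _j ∈ hood i, (4 + 2 * K) * Etot :=
        Finset.sum_le_sum_of_subset_of_nonneg (Finset.subset_insert _ _)
          fun _ _ _ => by positivity
    _ ≤ 3 ^ d * ((4 + 2 * K) * Etot) := sum_hood_le (fun _ _ => le_rfl) (by positivity)
    _ = _ := by ring

theorem summable_exp_mul_siteEnergy (hK : 0 < K) (hU : ∀ q, 0 ≤ U.eval q)
    {x : Config d} {G : ℝ} {c : Site d}
    (hG : ∀ i, siteEnergy U K i x ≤ G * Real.exp (sdist i c / 2)) (i : Site d) :
    Summable fun j => Real.exp (-sdist i j) * siteEnergy U K j x := by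
  have hG0 : 0 ≤ G := by
    have h := (siteEnergy_nonneg hK hU c x).trans (hG c)
    rw [sdist_self] at h
    simpa using h
  refine Summable.of_nonneg_of_le
    (fun j => mul_nonneg (Real.exp_pos _).le (siteEnergy_nonneg hK hU j x)) (fun j => ?_)
    ((summable_exp_neg_sdist i (a := 1 / 2) (by norm_num)).mul_left (G * Real.exp (sdist i c / 2)))
  calc _ ≤ Real.exp (-sdist i j) * (G * Real.exp (sdist j c / 2)) := by gcongr; exact hG j
    _ = G * Real.exp (-sdist i j + sdist j c / 2) := by rw [Real.exp_add]; ring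
    _ ≤ G * Real.exp (sdist i c / 2 + -(1 / 2) * sdist i j) := by
      refine mul_le_mul_of_nonneg_left (Real.exp_le_exp.mpr ?_) hG0
      have := sdist_triangle j i c
      rw [sdist_comm j i] at this
      linarith
    _ = _ := by rw [Real.exp_add]; ring

/-- The growth rate of the energy. -/
def energyRate (d : ℕ) (K : ℝ) : ℝ := 3 ^ d * (4 + 2 * K) * (3 ^ d * Real.exp 2)

theorem energyRate_nonneg (hK : 0 < K) : 0 ≤ energyRate d K := by unfold energyRate; positivity

/-- Energy spreads at most exponentially, with exponentially small tails in space. -/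
theorem siteEnergy_le_tsum (hK : 0 < K) (hU : ∀ q, 0 ≤ U.eval q)
    {S : Set (Site d)} {T : ℝ} {γ : ℝ → Config d}
    (hγ : IsPartialSolution U K S T γ) {c : Site d} {G : ℝ}
    (hG : ∀ i t, |t| ≤ T → siteEnergy U K i (γ t) ≤ G * Real.exp (sdist i c / 2))
    {t : ℝ} (ht : |t| ≤ T) (i : Site d) :
    siteEnergy U K i (γ t) ≤
      Real.exp (energyRate d K * |t|) * ∑' j, Real.exp (-sdist i j) * siteEnergy U K j (γ 0) := by
  -- The initial energy is smeared with the kernel exp(-|i - j|). The smeared energies of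
  -- neighboring sites are comparable, so `e` times an exponential in time is a supersolution.
  set e : Site d → ℝ := fun i => ∑' j, Real.exp (-sdist i j) * siteEnergy U K j (γ 0) with he
  have hT0 : 0 ≤ T := (abs_nonneg t).trans ht
  have hsum := summable_exp_mul_siteEnergy hK hU (fun i => hG i 0 (by simpa using hT0))
  have hpos : ∀ j k, 0 ≤ Real.exp (-sdist k j) * siteEnergy U K j (γ 0) := fun j k =>
    mul_nonneg (Real.exp_pos _).le (siteEnergy_nonneg hK hU j _)
  have he0 : ∀ k, siteEnergy U K k (γ 0) ≤ e k := by
    intro k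
    have := (hsum k).le_tsum k fun j _ => hpos j k
    simpa [sdist_self] using this
  -- The weights of the comparison contain 1/T, so T = 0 is treated apart.
  rcases hT0.eq_or_lt with rfl | hT
  · have : t = 0 := by simpa using ht
    subst this
    simpa using he0 i
  have henn : ∀ k, 0 ≤ e k := fun k => tsum_nonneg fun j => hpos j k
  -- The factor exp 1 would do; exp 2 is the constant of the comparison principle, so that
  -- `energyRate` serves for both.
  have hehood : ∀ k, ∀ l ∈ hood k, e l ≤ Real.exp 2 * e k := by
    intro k l hl
    rw [he, ← tsum_mul_left]
    refine (hsum l).tsum_le_tsum (fun j => ?_) ((hsum k).mul_left _)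
    rw [← mul_assoc, ← Real.exp_add]
    refine mul_le_mul_of_nonneg_right (Real.exp_le_exp.mpr ?_) (siteEnergy_nonneg hK hU j _)
    have := le_sdist_of_mem_hood hl j
    linarith
  have key := norm_le_of_supersolution (E := ℝ) (d := d) c (T := T) (ρ := energyRate d K) (G := G)
    (A := fun _ => 3 ^ d * (4 + 2 * K)) (u := fun k s => siteEnergy U K k (γ s))
    (u' := fun k s => (γ s k).2 * (S.indicator (fun j => velocity U K j (γ s)) k).2 +
      U.derivative.eval (γ s k).1 * (S.indicator (fun j => velocity U K j (γ s)) k).1 +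
        ∑ j ∈ neighbors k, K / 2 * ((γ s k).1 - (γ s j).1) *
          ((S.indicator (fun j => velocity U K j (γ s)) k).1 -
            (S.indicator (fun j => velocity U K j (γ s)) j).1))
    (z := fun k s => Real.exp (energyRate d K * s) * e k)
    (z' := fun k s => Real.exp (energyRate d K * s) * energyRate d K * e k) (b := fun _ _ => 0)
    hT (energyRate_nonneg hK) (fun _ => by positivity) (fun k => ?_)
    (fun k s hs => hasDerivAt_siteEnergy (fun j => hγ j s hs) k) (fun k s _ => ?_)
    (fun k s _ => mul_nonneg (Real.exp_pos _).le (henn k)) (fun k s _ => ?_) (fun k s _ => ?_)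
    (fun k => ?_) (fun k s hs => ?_) t ht i
  · rwa [Real.norm_of_nonneg (siteEnergy_nonneg hK hU i _)] at key
  · have := div_nonneg (sdist_nonneg k c) hT.le
    unfold energyRate
    linarith
  · have : HasDerivAt (fun s => energyRate d K * s) (energyRate d K) s := by
      simpa using (hasDerivAt_id s).const_mul (energyRate d K)
    exact this.exp.mul_const _
  · have := abs_deriv_siteEnergy_le hK hU (S := S) (x := γ s) k (fun _ => rfl)
    rw [Real.norm_eq_abs, add_zero]
    refine this.trans (le_of_eq ?_)
    congr 1
    exact Finset.sum_congr rfl fun j _ =>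
      (Real.norm_of_nonneg (siteEnergy_nonneg hK hU j _)).symm
  · rw [add_zero, ← Finset.mul_sum]
    have := sum_hood_le (hehood k) (mul_nonneg (Real.exp_pos _).le (henn k))
    calc _ ≤ 3 ^ d * (4 + 2 * K) *
          (Real.exp (energyRate d K * s) * (3 ^ d * (Real.exp 2 * e k))) := by gcongr
      _ = _ := by unfold energyRate; ring
  · simpa [Real.norm_of_nonneg (siteEnergy_nonneg hK hU k _)] using he0 k
  · rw [Real.norm_of_nonneg (siteEnergy_nonneg hK hU k _)]
    exact hG k s hs

end Energy

/-! ### Logarithmic energy bounds -/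

section EnergyBound

variable {d : ℕ} {U : Polynomial ℝ} {K : ℝ}

variable (U K) in
/-- The site energies of the state `x` have averages bounded by `M` over all cubes that enter the
definition of `Q`. -/
def QBound (M : ℝ) (x : Config d) : Prop :=
  ∀ (ν : Site d) (k : ℕ), Real.log (Real.exp 1 + sdist ν 0) < (k : ℝ) ^ d →
    cubeEnergy U K ν k x ≤ M * (2 * (k : ℝ) + 1) ^ d

theorem one_le_log_add {m : ℝ} (hm : 0 ≤ m) : 1 ≤ Real.log (Real.exp 1 + m) := by
  rw [Real.le_log_iff_exp_le (by positivity)]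
  linarith

theorem rpow_lt_iff_lt_pow (hd : 1 ≤ d) {L : ℝ} (hL : 0 ≤ L) (k : ℕ) :
    L ^ (1 / (d : ℝ)) < (k : ℝ) ↔ L < (k : ℝ) ^ d := by
  have hd' : (0 : ℝ) < d := by exact_mod_cast hd
  rw [one_div, Real.rpow_inv_lt_iff_of_pos hL (Nat.cast_nonneg k) hd', Real.rpow_natCast]

theorem localEnergy_nonneg (hK : 0 < K) (hU : ∀ q, 0 ≤ U.eval q) (ν : Site d) (k : ℕ)
    (x : Config d) : 0 ≤ localEnergy U K ν k x := by
  unfold localEnergy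
  refine add_nonneg (Finset.sum_nonneg fun i _ => ?_)
    (Finset.sum_nonneg fun i _ => Finset.sum_nonneg fun j _ => by positivity)
  have := hU (x i).1
  positivity

theorem Q_le_iff (hd : 1 ≤ d) {M : ℝ} (hM : 0 ≤ M) (x : Config d) :
    Q U K x ≤ ENNReal.ofReal M ↔ ∀ (ν : Site d) (k : ℕ),
      Real.log (Real.exp 1 + sdist ν 0) < (k : ℝ) ^ d →
        localEnergy U K ν k x ≤ M * (2 * (k : ℝ) + 1) ^ d := by
  simp only [Q, iSup_le_iff]
  refine forall_congr' fun ν => forall_congr' fun k => ?_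
  have hlog : 0 ≤ Real.log (Real.exp 1 + (siteDist ν 0 : ℝ)) :=
    zero_le_one.trans (one_le_log_add (sdist_nonneg ν 0))
  rw [rpow_lt_iff_lt_pow hd hlog]
  refine forall_congr' fun _ => ?_
  rw [ENNReal.ofReal_le_ofReal_iff hM, div_le_iff₀ (by positivity)]

theorem two_mul_succ_add_one_pow_le (d k : ℕ) :
    (2 * ((k + 1 : ℕ) : ℝ) + 1) ^ d ≤ 3 ^ d * (2 * (k : ℝ) + 1) ^ d := by
  rw [← mul_pow]
  gcongr
  push_cast
  linarith [Nat.cast_nonneg (α := ℝ) k]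

/-- The factor 3^d is the price of passing to the next cube, which contains the bonds at the
boundary. -/
theorem QBound.of_Q_le (hd : 1 ≤ d) (hK : 0 < K) (hU : ∀ q, 0 ≤ U.eval q) {M : ℝ} (hM : 0 ≤ M)
    {x : Config d} (h : Q U K x ≤ ENNReal.ofReal M) : QBound U K (3 ^ d * M) x := by
  rw [Q_le_iff hd hM] at h
  intro ν k hk
  have hk' : Real.log (Real.exp 1 + sdist ν 0) < ((k + 1 : ℕ) : ℝ) ^ d := by
    refine hk.trans_le ?_
    gcongr
    simp
  refine (cubeEnergy_le_localEnergy hK hU ν k x).trans ((h ν (k + 1) hk').trans ?_)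
  have := mul_le_mul_of_nonneg_left (two_mul_succ_add_one_pow_le d k) hM
  linarith

theorem QBound.nonneg (hd : 1 ≤ d) (hK : 0 < K) (hU : ∀ q, 0 ≤ U.eval q) {M : ℝ} {x : Config d}
    (h : QBound U K M x) : 0 ≤ M := by
  obtain ⟨k, hk⟩ := exists_nat_gt (Real.log (Real.exp 1 + sdist (0 : Site d) 0))
  have hL := one_le_log_add (sdist_nonneg (0 : Site d) 0)
  have h' := h 0 k (hk.trans_le (le_self_pow₀ (hL.trans hk.le) (by omega)))
  have h₀ : 0 ≤ cubeEnergy U K 0 k x := Finset.sum_nonneg fun i _ => siteEnergy_nonneg hK hU i x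
  by_contra! hneg
  have := mul_neg_of_neg_of_pos hneg (by positivity : 0 < (2 * (k : ℝ) + 1) ^ d)
  linarith

theorem QBound.Q_le (hd : 1 ≤ d) (hK : 0 < K) (hU : ∀ q, 0 ≤ U.eval q) {M : ℝ} {x : Config d}
    (h : QBound U K M x) : Q U K x ≤ ENNReal.ofReal M := by
  rw [Q_le_iff hd (h.nonneg hd hK hU)]
  exact fun ν k hk => (localEnergy_le_cubeEnergy hK ν k x).trans (h ν k hk)

theorem QBound.mono {M M' : ℝ} (hM : M ≤ M') {x : Config d} (h : QBound U K M x) :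
    QBound U K M' x := fun ν k hk => (h ν k hk).trans (by gcongr)

theorem mem_X0_iff (hd : 1 ≤ d) (hK : 0 < K) (hU : ∀ q, 0 ≤ U.eval q) {x : Config d} :
    x ∈ X0 U K ↔ ∃ M, QBound U K M x := by
  constructor
  · intro h
    refine ⟨3 ^ d * (Q U K x).toReal, QBound.of_Q_le hd hK hU ENNReal.toReal_nonneg ?_⟩
    rw [ENNReal.ofReal_toReal (ne_of_lt h)]
  · rintro ⟨M, h⟩
    exact lt_of_le_of_lt (h.Q_le hd hK hU) ENNReal.ofReal_lt_top

/-- The site is placed in the smallest admissible cube, k = ⌊L^{1/d}⌋ + 1. As L ≥ 1, its side 2k + 1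
is at most 5·L^{1/d} and its volume at most 5^d·L. -/
theorem siteEnergy_le_of_cubeEnergy_le (hd : 1 ≤ d) (hK : 0 < K) (hU : ∀ q, 0 ≤ U.eval q)
    {M L : ℝ} (hM : 0 ≤ M) (hL : 1 ≤ L) {ν : Site d} {x : Config d}
    (h : ∀ k : ℕ, L < (k : ℝ) ^ d → cubeEnergy U K ν k x ≤ M * (2 * (k : ℝ) + 1) ^ d) :
    siteEnergy U K ν x ≤ 5 ^ d * M * L := by
  set r := L ^ (1 / (d : ℝ)) with hr
  have hL0 : 0 ≤ L := zero_le_one.trans hL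
  have hr1 : 1 ≤ r := Real.one_le_rpow hL (by positivity)
  set k : ℕ := ⌊r⌋₊ + 1 with hk
  have hkr : r < k := by rw [hk]; push_cast; exact Nat.lt_floor_add_one r
  have hkr' : (k : ℝ) ≤ r + 1 := by
    rw [hk]; push_cast
    linarith [Nat.floor_le (zero_le_one.trans hr1)]
  have hrd : r ^ d = L := by
    rw [hr, one_div]
    exact Real.rpow_inv_natCast_pow hL0 (by omega)
  calc siteEnergy U K ν x ≤ cubeEnergy U K ν k x :=
        siteEnergy_le_cubeEnergy hK hU (self_mem_cube ν k) x
    _ ≤ M * (2 * (k : ℝ) + 1) ^ d := h k ((rpow_lt_iff_lt_pow hd hL0 k).mp hkr)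
    _ ≤ M * (5 * r) ^ d := by gcongr; linarith
    _ = 5 ^ d * M * L := by rw [mul_pow, hrd]; ring

theorem QBound.siteEnergy_le (hd : 1 ≤ d) (hK : 0 < K) (hU : ∀ q, 0 ≤ U.eval q) {M : ℝ}
    {x : Config d} (h : QBound U K M x) (ν : Site d) :
    siteEnergy U K ν x ≤ 5 ^ d * M * Real.log (Real.exp 1 + sdist ν 0) :=
  siteEnergy_le_of_cubeEnergy_le hd hK hU (h.nonneg hd hK hU)
    (one_le_log_add (sdist_nonneg ν 0)) fun k hk => h ν k hk

theorem log_exp_one_add_le {m : ℝ} (hm : 0 ≤ m) : Real.log (Real.exp 1 + m) ≤ 2 + m := by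
  have h := Real.log_le_sub_one_of_pos (show 0 < Real.exp 1 + m by positivity)
  have := Real.exp_one_lt_d9
  linarith

theorem QBound.siteEnergy_le_linear (hd : 1 ≤ d) (hK : 0 < K) (hU : ∀ q, 0 ≤ U.eval q) {M : ℝ}
    {x : Config d} (h : QBound U K M x) (c ν : Site d) :
    siteEnergy U K ν x ≤ 5 ^ d * M * (2 + sdist c 0 + sdist ν c) := by
  refine (h.siteEnergy_le hd hK hU ν).trans ?_
  have hM := h.nonneg hd hK hU
  gcongr
  have := log_exp_one_add_le (sdist_nonneg ν 0)
  have := sdist_triangle ν c 0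
  linarith

/-- A deliberately crude form: it is the moderate growth in space that the comparison principle
requires a priori. -/
theorem QBound.siteEnergy_le_exp (hd : 1 ≤ d) (hK : 0 < K) (hU : ∀ q, 0 ≤ U.eval q) {M : ℝ}
    {x : Config d} (h : QBound U K M x) (c ν : Site d) :
    siteEnergy U K ν x ≤ 5 ^ d * M * (4 + sdist c 0) * Real.exp (sdist ν c / 2) := by
  refine (h.siteEnergy_le_linear hd hK hU c ν).trans ?_
  have hM := h.nonneg hd hK hU
  rw [mul_assoc (5 ^ d * M)]
  refine mul_le_mul_of_nonneg_left ?_ (by positivity)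
  have h₁ := Real.add_one_le_exp (sdist ν c / 2)
  have h₂ := sdist_nonneg c 0
  have h₃ := sdist_nonneg ν c
  nlinarith

/-- Energy bounds on all large cubes around a site propagate in time. -/
theorem cubeEnergy_le_of_isPartialSolution (hK : 0 < K) (hU : ∀ q, 0 ≤ U.eval q)
    {S : Set (Site d)} {T : ℝ} {γ : ℝ → Config d} (hγ : IsPartialSolution U K S T γ) {c : Site d}
    {G : ℝ} (hG : ∀ i t, |t| ≤ T → siteEnergy U K i (γ t) ≤ G * Real.exp (sdist i c / 2))
    {ν : Site d} {k : ℕ} {M : ℝ}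
    (hM : ∀ l, k ≤ l → cubeEnergy U K ν l (γ 0) ≤ M * (2 * (l : ℝ) + 1) ^ d)
    {t : ℝ} (ht : |t| ≤ T) :
    cubeEnergy U K ν k (γ t) ≤
      Real.exp (energyRate d K * |t|) * (spreadConst d * (M * (2 * (k : ℝ) + 1) ^ d)) := by
  have hT0 : 0 ≤ T := (abs_nonneg t).trans ht
  have hsum := summable_exp_mul_siteEnergy hK hU (fun i => hG i 0 (by simpa using hT0))
  calc cubeEnergy U K ν k (γ t)
      ≤ ∑ i ∈ cube ν k, Real.exp (energyRate d K * |t|) *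
          ∑' j, Real.exp (-sdist i j) * siteEnergy U K j (γ 0) :=
        Finset.sum_le_sum fun i _ => siteEnergy_le_tsum hK hU hγ hG ht i
    _ = Real.exp (energyRate d K * |t|) *
          ∑ i ∈ cube ν k, ∑' j, Real.exp (-sdist i j) * siteEnergy U K j (γ 0) := by
        rw [Finset.mul_sum]
    _ ≤ _ := by
        gcongr
        exact sum_cube_tsum_le hK hU hM hsum

/-- If a cube is large enough to enter `QBound`, so are all larger concentric ones, and these are
exactly the cubes used by the convolution estimate. -/
theorem QBound.of_isPartialSolution (hK : 0 < K) (hU : ∀ q, 0 ≤ U.eval q)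
    {S : Set (Site d)} {T : ℝ} {γ : ℝ → Config d} (hγ : IsPartialSolution U K S T γ) {c : Site d}
    {G : ℝ} (hG : ∀ i t, |t| ≤ T → siteEnergy U K i (γ t) ≤ G * Real.exp (sdist i c / 2))
    {M : ℝ} (hM : QBound U K M (γ 0)) {t : ℝ} (ht : |t| ≤ T) :
    QBound U K (Real.exp (energyRate d K * |t|) * spreadConst d * M) (γ t) := by
  intro ν k hk
  refine (cubeEnergy_le_of_isPartialSolution hK hU hγ hG (ν := ν) (k := k) (M := M)
    (fun l hl => hM ν l (hk.trans_le ?_)) ht).trans (le_of_eq (by ring))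
  gcongr

theorem isPartialSolution_univ_iff {T : ℝ} {γ : ℝ → Config d} :
    IsPartialSolution U K univ T γ ↔
      ∀ i t, |t| ≤ T → HasDerivAt (fun s => γ s i) (velocity U K i (γ t)) t := by
  simp [IsPartialSolution]

theorem IsSolution.isPartialSolution {γ : ℝ → Config d} (h : IsSolution U K γ) (T : ℝ) :
    IsPartialSolution U K univ T γ := by
  rw [isPartialSolution_univ_iff]
  intro i t _
  exact (h.deriv_q i t).prodMk (h.deriv_p i t)

theorem IsSolution.exists_qBound (hd : 1 ≤ d) (hK : 0 < K) (hU : ∀ q, 0 ≤ U.eval q)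
    {γ : ℝ → Config d} (h : IsSolution U K γ) (T : ℝ) :
    ∃ M, ∀ t, |t| ≤ T → QBound U K M (γ t) := by
  obtain ⟨M, hM⟩ := h.locally_bounded T
  exact ⟨3 ^ d * M, fun t ht => QBound.of_Q_le hd hK hU M.2 (by simpa using hM t ht)⟩

theorem IsSolution.of_qBound (hd : 1 ≤ d) (hK : 0 < K) (hU : ∀ q, 0 ≤ U.eval q)
    {γ : ℝ → Config d} (h : ∀ T, IsPartialSolution U K univ T γ)
    (hM : ∀ T, ∃ M, ∀ t, |t| ≤ T → QBound U K M (γ t)) : IsSolution U K γ := by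
  have hγ : ∀ i t, HasDerivAt (fun s => γ s i) (velocity U K i (γ t)) t := fun i t =>
    isPartialSolution_univ_iff.mp (h |t|) i t le_rfl
  refine ⟨fun i t => ?_, fun i t => ?_, fun T => ?_⟩
  · exact (ContinuousLinearMap.fst ℝ ℝ ℝ).hasFDerivAt.comp_hasDerivAt t (hγ i t)
  · exact (ContinuousLinearMap.snd ℝ ℝ ℝ).hasFDerivAt.comp_hasDerivAt t (hγ i t)
  · obtain ⟨M, hM⟩ := hM T
    exact ⟨M.toNNReal, fun t ht => (hM t ht).Q_le hd hK hU⟩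

/-- Along a solution, bounds for the averages of the energy deteriorate at most exponentially. -/
theorem IsSolution.cubeEnergy_le (hd : 1 ≤ d) (hK : 0 < K) (hU : ∀ q, 0 ≤ U.eval q)
    {γ : ℝ → Config d} (h : IsSolution U K γ) {ν : Site d} {k : ℕ} {M : ℝ}
    (hM : ∀ l, k ≤ l → cubeEnergy U K ν l (γ 0) ≤ M * (2 * (l : ℝ) + 1) ^ d) (t : ℝ) :
    cubeEnergy U K ν k (γ t) ≤
      Real.exp (energyRate d K * |t|) * (spreadConst d * (M * (2 * (k : ℝ) + 1) ^ d)) := by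
  obtain ⟨M', hM'⟩ := h.exists_qBound hd hK hU |t|
  exact cubeEnergy_le_of_isPartialSolution hK hU (h.isPartialSolution |t|)
    (fun i s hs => (hM' s hs).siteEnergy_le_exp hd hK hU 0 i) hM le_rfl

theorem IsSolution.qBound (hd : 1 ≤ d) (hK : 0 < K) (hU : ∀ q, 0 ≤ U.eval q)
    {γ : ℝ → Config d} (h : IsSolution U K γ) {M : ℝ} (hM : QBound U K M (γ 0)) (t : ℝ) :
    QBound U K (Real.exp (energyRate d K * |t|) * spreadConst d * M) (γ t) := by
  obtain ⟨M', hM'⟩ := h.exists_qBound hd hK hU |t|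
  exact QBound.of_isPartialSolution hK hU (h.isPartialSolution |t|)
    (fun i s hs => (hM' s hs).siteEnergy_le_exp hd hK hU 0 i) hM le_rfl

end EnergyBound

/-! ### Stability of the dynamics -/

section Stability

variable {d : ℕ} {U : Polynomial ℝ} {K C : ℝ}

theorem abs_le_one_add_pow_four (a : ℝ) : |a| ≤ 1 + a ^ 4 := by
  have := abs_le_one_add_sq_div_two a
  nlinarith [sq_nonneg (a ^ 2 - 1)]

theorem norm_le_siteEnergy (hC : QuarticBounds U C) (hK : 0 < K) (i : Site d) (x : Config d) :
    ‖x i‖ ≤ (3 + C) * siteEnergy U K i x := by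
  have h₁ := one_le_siteEnergy hK hC.nonneg i x
  have h₂ := hC.pow_four_le (x i).1
  have h₃ := eval_add_one_le (U := U) hK i x
  have h₄ := sq_momentum_le hK hC.nonneg i x
  have hC1 := hC.one_le
  have h₅ := abs_le_one_add_pow_four (x i).1
  have h₆ := abs_le_one_add_sq_div_two (x i).2
  have h₇ : C * (U.eval (x i).1 + 1) ≤ C * siteEnergy U K i x := by gcongr
  rw [Prod.norm_def, max_le_iff, Real.norm_eq_abs, Real.norm_eq_abs]
  constructor <;> nlinarith

/-- Serves to bound the velocity of a site that moves in one system and is frozen in the other. -/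
theorem norm_velocity_le (hC : QuarticBounds U C) (hK : 0 < K) (i : Site d) (x : Config d) :
    ‖velocity U K i x‖ ≤ (3 + C * (1 + C) + 3 ^ d * (K + 4)) * siteEnergy U K i x := by
  set e := siteEnergy U K i x
  have h₁ : 1 ≤ e := one_le_siteEnergy hK hC.nonneg i x
  have h₂ := hC.pow_four_le (x i).1
  have h₃ : U.eval (x i).1 + 1 ≤ e := eval_add_one_le hK i x
  have h₄ : (x i).2 ^ 2 ≤ 2 * e := sq_momentum_le hK hC.nonneg i x
  have hC1 := hC.one_le
  have h₆ := abs_le_one_add_sq_div_two (x i).2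
  have h₇ : C * (U.eval (x i).1 + 1) ≤ C * e := by gcongr
  have hd3 : 0 ≤ 3 ^ d * (K + 4) * e := by positivity
  have hCC : 0 ≤ C * (1 + C) * e := by positivity
  rw [Prod.norm_def, max_le_iff, Real.norm_eq_abs, Real.norm_eq_abs]
  constructor
  · simp only [velocity]
    nlinarith
  · simp only [velocity, force]
    have h₈ : |U.derivative.eval (x i).1| ≤ C * (1 + C) * e := by
      refine (hC.deriv_le _).trans ?_
      rw [mul_assoc]
      gcongr
      nlinarith
    have h₉ : |K * ∑ j ∈ neighbors i, ((x i).1 - (x j).1)| ≤ 3 ^ d * ((K + 4) * e) := by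
      rw [Finset.mul_sum]
      refine (Finset.abs_sum_le_sum_abs _ _).trans ?_
      calc _ ≤ ∑ _j ∈ neighbors i, (K + 4) * e := by
            refine Finset.sum_le_sum fun j hj => ?_
            have b := bond_le hK hC.nonneg hj x
            have b' := abs_le_one_add_sq_div_two ((x i).1 - (x j).1)
            rw [abs_mul, abs_of_pos hK]
            have b'' := mul_le_mul_of_nonneg_left b' hK.le
            have : K * 1 ≤ K * e := by gcongr
            change _ ≤ 4 * e at b
            nlinarith
        _ ≤ ∑ _j ∈ hood i, (K + 4) * e :=
            Finset.sum_le_sum_of_subset_of_nonneg (Finset.subset_insert _ _)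
              fun _ _ _ => by positivity
        _ ≤ _ := sum_hood_le (fun _ _ => le_rfl) (by positivity)
    have h₁₀ := abs_sub (-(U.derivative.eval (x i).1)) (K * ∑ j ∈ neighbors i, ((x i).1 - (x j).1))
    rw [abs_neg] at h₁₀
    nlinarith

theorem norm_sum_neighbors_le (hK : 0 < K) (i : Site d) (a : Site d → ℝ) (w : Site d → ℝ)
    (h : ∀ j, |a j| ≤ w j) :
    |K * ∑ j ∈ neighbors i, (a i - a j)| ≤ K * (3 ^ d + 1) * ∑ j ∈ hood i, w j := by
  have hw : ∀ j, 0 ≤ w j := fun j => (abs_nonneg _).trans (h j)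
  have hi : w i ≤ ∑ j ∈ hood i, w j :=
    Finset.single_le_sum (f := w) (fun j _ => hw j) (self_mem_hood i)
  rw [abs_mul, abs_of_pos hK, mul_assoc]
  refine mul_le_mul_of_nonneg_left ?_ hK.le
  calc |∑ j ∈ neighbors i, (a i - a j)| ≤ ∑ j ∈ neighbors i, (w i + w j) :=
        (Finset.abs_sum_le_sum_abs _ _).trans (Finset.sum_le_sum fun j _ =>
          (abs_sub _ _).trans (add_le_add (h i) (h j)))
    _ ≤ ∑ j ∈ hood i, (w i + w j) :=
        Finset.sum_le_sum_of_subset_of_nonneg (Finset.subset_insert _ _)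
          fun j _ _ => add_nonneg (hw i) (hw j)
    _ = ∑ _j ∈ hood i, w i + ∑ j ∈ hood i, w j := Finset.sum_add_distrib
    _ ≤ 3 ^ d * w i + ∑ j ∈ hood i, w j := by
        gcongr
        exact sum_hood_le (fun _ _ => le_rfl) (hw i)
    _ ≤ _ := by
        have := mul_le_mul_of_nonneg_left hi (by positivity : (0 : ℝ) ≤ 3 ^ d)
        linarith

/-- The Lipschitz constant of the velocity of a site. -/
def lipCoeff (d : ℕ) (K C r : ℝ) : ℝ := 1 + C * (1 + r) + K * (3 ^ d + 1)

theorem norm_velocity_sub_le (hC : QuarticBounds U C) (hK : 0 < K) (i : Site d) (x y : Config d) :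
    ‖velocity U K i x - velocity U K i y‖ ≤
      lipCoeff d K C ((x i).1 ^ 2 + (y i).1 ^ 2) * ∑ j ∈ hood i, ‖x j - y j‖ := by
  set D := ∑ j ∈ hood i, ‖x j - y j‖
  have hi : ‖x i - y i‖ ≤ D :=
    Finset.single_le_sum (f := fun j => ‖x j - y j‖) (fun j _ => norm_nonneg _) (self_mem_hood i)
  have hD : 0 ≤ D := (norm_nonneg _).trans hi
  have hC1 := hC.one_le
  have h1 : ∀ j, |(x j).1 - (y j).1| ≤ ‖x j - y j‖ := fun j => norm_fst_le (x j - y j)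
  have h2 : |(x i).2 - (y i).2| ≤ ‖x i - y i‖ := norm_snd_le (x i - y i)
  have e₁ : 0 ≤ C * (1 + ((x i).1 ^ 2 + (y i).1 ^ 2)) * D := by positivity
  have e₂ : 0 ≤ K * (3 ^ d + 1) * D := by positivity
  unfold lipCoeff
  rw [Prod.norm_def, max_le_iff, Real.norm_eq_abs, Real.norm_eq_abs]
  constructor
  · simp only [velocity, Prod.fst_sub]
    linarith
  · simp only [velocity, force, Prod.snd_sub]
    have hrew : -(U.derivative.eval (x i).1) - K * ∑ j ∈ neighbors i, ((x i).1 - (x j).1) -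
        (-(U.derivative.eval (y i).1) - K * ∑ j ∈ neighbors i, ((y i).1 - (y j).1)) =
        -(U.derivative.eval (x i).1 - U.derivative.eval (y i).1) -
        K * ∑ j ∈ neighbors i, (((x i).1 - (y i).1) - ((x j).1 - (y j).1)) := by
      have : ∑ j ∈ neighbors i, (((x i).1 - (y i).1) - ((x j).1 - (y j).1)) =
          ∑ j ∈ neighbors i, ((x i).1 - (x j).1) - ∑ j ∈ neighbors i, ((y i).1 - (y j).1) := by
        rw [← Finset.sum_sub_distrib]
        exact Finset.sum_congr rfl fun j _ => by ring
      rw [this]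
      ring
    rw [hrew]
    refine (abs_sub _ _).trans ?_
    rw [abs_neg]
    have h₃ := norm_sum_neighbors_le hK i (fun j => (x j).1 - (y j).1) _ h1
    have h₄ := hC.deriv_sub_le (x i).1 (y i).1
    have h₅ : C * (1 + (x i).1 ^ 2 + (y i).1 ^ 2) * |(x i).1 - (y i).1| ≤
        C * (1 + ((x i).1 ^ 2 + (y i).1 ^ 2)) * D := by
      rw [add_assoc]
      gcongr
      exact (h1 i).trans hi
    change _ ≤ K * (3 ^ d + 1) * D at h₃
    linarith

/-- States with bounded energy averages have squared positions of arbitrarily small linear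
growth. -/
theorem exists_sq_position_le (hd : 1 ≤ d) (hC : QuarticBounds U C) (hK : 0 < K) (M : ℝ)
    (c : Site d) {ε : ℝ} (hε : 0 < ε) :
    ∃ ρ, 0 ≤ ρ ∧ ∀ x : Config d, QBound U K M x → ∀ k, (x k).1 ^ 2 ≤ ρ + ε * sdist k c := by
  have hC1 := hC.one_le
  set B := C * (5 ^ d * (|M| + 1)) with hB
  have hBpos : 0 < B := by positivity
  have hc0 := sdist_nonneg c 0
  refine ⟨B / ε + ε * (2 + sdist c 0), by positivity, fun x hx k => ?_⟩
  have hM := hx.nonneg hd hK hC.nonneg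
  have h₁ := hx.siteEnergy_le_linear hd hK hC.nonneg c k
  have h₂ : (x k).1 ^ 4 ≤ B * (2 + sdist c 0 + sdist k c) := by
    refine (hC.pow_four_le _).trans ?_
    have h₃ := (eval_add_one_le hK k x).trans h₁
    have hk0 := sdist_nonneg k c
    calc _ ≤ C * (5 ^ d * M * (2 + sdist c 0 + sdist k c)) := by gcongr
      _ ≤ C * (5 ^ d * (|M| + 1) * (2 + sdist c 0 + sdist k c)) := by
        gcongr
        linarith [le_abs_self M]
      _ = _ := by rw [hB]; ring
  set X := 2 + sdist c 0 + sdist k c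
  have hX : B / ε + ε * (2 + sdist c 0) + ε * sdist k c = B / ε + ε * X := by ring
  rw [hX]
  have h₄ : ε / B * (x k).1 ^ 4 ≤ ε * X := by
    calc _ ≤ ε / B * (B * X) := by gcongr
      _ = ε * X := by field_simp
  -- The inequality between arithmetic and geometric means trades the fourth power, which grows
  -- linearly, for a square with an arbitrarily small slope.
  have h₅ : (x k).1 ^ 2 ≤ ε / B * (x k).1 ^ 4 + B / ε := by
    have hBε : ε / B * (B / ε) = 1 := by field_simp
    have ha : 0 < ε / B := by positivity
    have hb : 0 < B / ε := by positivity
    generalize ε / B = a at *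
    generalize B / ε = b at *
    nlinarith [mul_nonneg ha.le (sq_nonneg ((x k).1 ^ 2 - b)), sq_nonneg ((x k).1)]
  linarith

/-- The difference of two partial solutions, under an explicit bound for the coefficients. -/
theorem norm_sub_le_of_lipCoeff_le (hC : QuarticBounds U C) (hK : 0 < K) (c : Site d)
    {T ρ G H σ : ℝ} (hT : 0 < T) (hρ : 0 ≤ ρ) (hH : 0 ≤ H) (hσ : |σ| ≤ 1) {S S' : Set (Site d)}
    {γ γ' : ℝ → Config d} (hγ : IsPartialSolution U K S T γ)
    (hγ' : IsPartialSolution U K S' T γ') {r : Site d → ℝ}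
    (hr : ∀ k t, |t| ≤ T → (γ t k).1 ^ 2 + (γ' t k).1 ^ 2 ≤ r k)
    (hrρ : ∀ k, lipCoeff d K C (r k) * (3 ^ d * Real.exp 2) + 1 ≤ ρ + sdist k c / T)
    (hforce : ∀ k t, |t| ≤ T →
      ‖S.indicator (fun j => velocity U K j (γ t)) k -
        S'.indicator (fun j => velocity U K j (γ' t)) k‖ ≤
      ‖velocity U K k (γ t) - velocity U K k (γ' t)‖ + H * Real.exp (σ * sdist k c))
    (h0 : ∀ k, ‖γ 0 k - γ' 0 k‖ ≤ H * Real.exp (σ * sdist k c))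
    (hG : ∀ k t, |t| ≤ T → ‖γ t k - γ' t k‖ ≤ G * Real.exp (sdist k c / 2)) :
    ∀ t, |t| ≤ T → ∀ k,
      ‖γ t k - γ' t k‖ ≤ H * Real.exp ((σ + |t| / T) * sdist k c + ρ * |t|) := by
  have hC1 := hC.one_le
  have hr0 : ∀ k, 0 ≤ r k := fun k =>
    (by positivity : (0 : ℝ) ≤ (γ 0 k).1 ^ 2 + (γ' 0 k).1 ^ 2).trans
      (hr k 0 (by simpa using hT.le))
  refine norm_le_exp_weight c hT hρ hH hσ (A := fun k => lipCoeff d K C (r k)) (fun k => ?_) hrρ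
    (u := fun k s => γ s k - γ' s k) (fun k s hs => (hγ k s hs).sub (hγ' k s hs))
    (fun k s hs => ?_) h0 hG
  · have := hr0 k
    unfold lipCoeff
    positivity
  · refine (hforce k s hs).trans ?_
    gcongr
    refine (norm_velocity_sub_le hC hK k _ _).trans ?_
    gcongr
    unfold lipCoeff
    gcongr
    exact hr k s hs

/-- Collects, with one constant that is uniform over the states with a given energy bound, the
growth bounds in space needed for comparison and for cutting off distant sites. -/
theorem exists_norm_sub_le_exp (hd : 1 ≤ d) (hC : QuarticBounds U C) (hK : 0 < K) (M : ℝ)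
    (c : Site d) :
    ∃ G, 0 ≤ G ∧ ∀ x y : Config d, QBound U K M x → QBound U K M y →
      ∀ k, ‖x k - y k‖ ≤ G * Real.exp (sdist k c / 2) ∧
        ‖velocity U K k x‖ ≤ G * Real.exp (sdist k c / 2) ∧
        siteEnergy U K k x ≤ G * Real.exp (sdist k c / 2) := by
  have hC1 := hC.one_le
  have hc := sdist_nonneg c 0
  set G₀ := 5 ^ d * |M| * (4 + sdist c 0)
  set v := 3 + C * (1 + C) + 3 ^ d * (K + 4)
  have hG₀ : 0 ≤ G₀ := by positivity
  have hv : 0 ≤ v := by positivity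
  have hE : ∀ z : Config d, QBound U K M z → ∀ k,
      siteEnergy U K k z ≤ G₀ * Real.exp (sdist k c / 2) := by
    intro z hz k
    refine (hz.siteEnergy_le_exp hd hK hC.nonneg c k).trans ?_
    refine mul_le_mul_of_nonneg_right ?_ (Real.exp_pos _).le
    simp only [G₀]
    gcongr
    exact le_abs_self M
  refine ⟨(2 * (3 + C) + v) * G₀, by positivity, fun x y hx hy k => ⟨?_, ?_, ?_⟩⟩
  · have h₁ := norm_le_siteEnergy hC hK k x
    have h₂ := norm_le_siteEnergy hC hK k y
    have h₃ := mul_le_mul_of_nonneg_left (hE x hx k) (by positivity : 0 ≤ 3 + C)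
    have h₄ := mul_le_mul_of_nonneg_left (hE y hy k) (by positivity : 0 ≤ 3 + C)
    have h₅ : 0 ≤ v * (G₀ * Real.exp (sdist k c / 2)) := by positivity
    linarith [norm_sub_le (x k) (y k)]
  · have h₁ := norm_velocity_le hC hK k x
    have h₃ := mul_le_mul_of_nonneg_left (hE x hx k) hv
    have h₅ : 0 ≤ 2 * (3 + C) * (G₀ * Real.exp (sdist k c / 2)) := by positivity
    linarith
  · have h₁ := hE x hx k
    have h₅ : 0 ≤ (2 * (2 + C) + 1 + v) * (G₀ * Real.exp (sdist k c / 2)) := by positivity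
    linarith

/-- Stability: partial solutions with bounded energy averages that are close, in an exponentially
weighted norm, initially and up to a small forcing, stay close. -/
theorem exists_stability (hd : 1 ≤ d) (hC : QuarticBounds U C) (hK : 0 < K) (M : ℝ) (c : Site d)
    {T : ℝ} (hT : 0 < T) :
    ∃ ρ, 0 ≤ ρ ∧ ∀ (S S' : Set (Site d)) (γ γ' : ℝ → Config d) (H σ : ℝ),
      IsPartialSolution U K S T γ → IsPartialSolution U K S' T γ' →
      (∀ t, |t| ≤ T → QBound U K M (γ t)) → (∀ t, |t| ≤ T → QBound U K M (γ' t)) →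
      0 ≤ H → |σ| ≤ 1 →
      (∀ k t, |t| ≤ T → ‖S.indicator (fun j => velocity U K j (γ t)) k -
        S'.indicator (fun j => velocity U K j (γ' t)) k‖ ≤
        ‖velocity U K k (γ t) - velocity U K k (γ' t)‖ + H * Real.exp (σ * sdist k c)) →
      (∀ k, ‖γ 0 k - γ' 0 k‖ ≤ H * Real.exp (σ * sdist k c)) →
      ∀ t, |t| ≤ T → ∀ k,
        ‖γ t k - γ' t k‖ ≤ H * Real.exp ((σ + |t| / T) * sdist k c + ρ * |t|) := by
  have hC1 := hC.one_le
  set κ := C * (3 ^ d * Real.exp 2) with hκ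
  have hκ0 : 0 < κ := by positivity
  -- The slope is chosen so that two squared positions, multiplied by the constant `κ` of the
  -- coefficients, use exactly the available |k - c|/T.
  obtain ⟨ρ₀, hρ₀, hpos⟩ := exists_sq_position_le hd hC hK M c
    (ε := 1 / (2 * κ * T)) (by positivity)
  obtain ⟨G, -, hG⟩ := exists_norm_sub_le_exp hd hC hK M c
  refine ⟨lipCoeff d K C (2 * ρ₀) * (3 ^ d * Real.exp 2) + 1, by unfold lipCoeff; positivity,
    fun S S' γ γ' H σ hγ hγ' hM hM' hH hσ hforce h0 => ?_⟩
  refine norm_sub_le_of_lipCoeff_le hC hK c hT (by unfold lipCoeff; positivity) hH hσ hγ hγ'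
    (r := fun k => 2 * (ρ₀ + 1 / (2 * κ * T) * sdist k c)) (fun k t ht => ?_) (fun k => ?_)
    hforce h0 (fun k t ht => (hG _ _ (hM t ht) (hM' t ht) k).1)
  · linarith [hpos _ (hM t ht) k, hpos _ (hM' t ht) k]
  · apply le_of_eq
    have : κ * (2 * (1 / (2 * κ * T) * sdist k c)) = sdist k c / T := by field_simp
    rw [← this, hκ]
    unfold lipCoeff
    ring

end Stability

/-! ### Existence and uniqueness of the dynamics -/

section Existence

variable {d : ℕ} {U : Polynomial ℝ} {K C : ℝ}

theorem continuous_siteEnergy (i : Site d) : Continuous (siteEnergy U K i) := by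
  unfold siteEnergy
  have h := U.continuous
  have hq : Continuous fun x : Config d => U.eval (x i).1 := h.comp (by fun_prop)
  fun_prop

theorem continuous_cubeEnergy (ν : Site d) (k : ℕ) : Continuous (cubeEnergy U K ν k) := by
  unfold cubeEnergy
  exact continuous_finsetSum _ fun i _ => continuous_siteEnergy i

/-- Uniqueness is stability with H = 0. -/
theorem IsSolution.eq_of_eq_zero (hd : 1 ≤ d) (hC : QuarticBounds U C) (hK : 0 < K)
    {γ γ' : ℝ → Config d} (h : IsSolution U K γ) (h' : IsSolution U K γ') (h0 : γ 0 = γ' 0) :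
    γ = γ' := by
  funext t k
  obtain ⟨M, hM⟩ := h.exists_qBound hd hK hC.nonneg (|t| + 1)
  obtain ⟨M', hM'⟩ := h'.exists_qBound hd hK hC.nonneg (|t| + 1)
  obtain ⟨ρ, -, hρ⟩ := exists_stability hd hC hK (max M M') (0 : Site d)
    (T := |t| + 1) (by positivity)
  have := hρ univ univ γ γ' 0 0 (h.isPartialSolution _) (h'.isPartialSolution _)
    (fun s hs => (hM s hs).mono (le_max_left _ _)) (fun s hs => (hM' s hs).mono (le_max_right _ _))
    le_rfl (by simp) (by simp) (by simp [h0]) t (by linarith) k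
  simpa [sub_eq_zero] using this

/-- The projection of a real number to `[-L, L]`. -/
def clip (L a : ℝ) : ℝ := max (-L) (min L a)

theorem abs_clip_le {L : ℝ} (hL : 0 ≤ L) (a : ℝ) : |clip L a| ≤ L := by
  unfold clip
  rw [abs_le]
  exact ⟨le_max_left _ _, max_le (by linarith) (min_le_left _ _)⟩

theorem clip_of_abs_le {L a : ℝ} (h : |a| ≤ L) : clip L a = a := by
  unfold clip
  rw [min_eq_right (abs_le.mp h).2, max_eq_right (abs_le.mp h).1]

theorem abs_clip_sub_le (L a b : ℝ) : |clip L a - clip L b| ≤ |a - b| := by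
  unfold clip
  rw [max_comm (-L), max_comm (-L), min_comm L, min_comm L]
  exact (abs_max_sub_max_le_abs _ _ _).trans (abs_inf_sub_inf_le_abs _ _ _)

/-- The componentwise projection to `[-L, L]²`. -/
def clipPair (L : ℝ) (z : ℝ × ℝ) : ℝ × ℝ := (clip L z.1, clip L z.2)

theorem clipPair_of_norm_le {L : ℝ} {z : ℝ × ℝ} (h : ‖z‖ ≤ L) : clipPair L z = z :=
  Prod.ext (clip_of_abs_le ((norm_fst_le z).trans h)) (clip_of_abs_le ((norm_snd_le z).trans h))

theorem norm_clipPair_sub_le (L : ℝ) (z w : ℝ × ℝ) :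
    ‖clipPair L z - clipPair L w‖ ≤ ‖z - w‖ := by
  rw [Prod.norm_def]
  exact max_le ((abs_clip_sub_le L z.1 w.1).trans (norm_fst_le (z - w)))
    ((abs_clip_sub_le L z.2 w.2).trans (norm_snd_le (z - w)))

theorem norm_clipPair_le {L : ℝ} (hL : 0 ≤ L) (z : ℝ × ℝ) : ‖clipPair L z‖ ≤ L := by
  rw [Prod.norm_def]
  exact max_le (abs_clip_le hL _) (abs_clip_le hL _)

/-- The state that agrees with `y` on `B` and with `x` elsewhere. -/
def glue (B : Finset (Site d)) (x : Config d) (y : B → ℝ × ℝ) : Config d :=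
  fun i => if h : i ∈ B then y ⟨i, h⟩ else x i

theorem glue_of_mem {B : Finset (Site d)} {x : Config d} {y : B → ℝ × ℝ} {i : Site d}
    (h : i ∈ B) : glue B x y i = y ⟨i, h⟩ := by simp [glue, h]

theorem glue_of_notMem {B : Finset (Site d)} {x : Config d} {y : B → ℝ × ℝ} {i : Site d}
    (h : i ∉ B) : glue B x y i = x i := by simp [glue, h]

/-- A solution, on any bounded time interval, of the system in which the sites in `B` move and the
velocities are those of the state projected to `[-L, L]²`. -/
theorem exists_clipped_solution (hC : QuarticBounds U C) (hK : 0 < K) (B : Finset (Site d))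
    (x : Config d) {L T : ℝ} (hL : 0 ≤ L) (hT : 0 ≤ T) :
    ∃ y : ℝ → B → ℝ × ℝ, (∀ i : B, y 0 i = x i) ∧ ∀ t, |t| ≤ T → ∀ i : B,
      HasDerivAt (fun s => y s i)
        (velocity U K i (glue B x fun j => clipPair L (y t j))) t := by
  set g : (B → ℝ × ℝ) → Config d := fun y => glue B x fun j => clipPair L (y j) with hg
  set f : (B → ℝ × ℝ) → (B → ℝ × ℝ) := fun y i => velocity U K i (g y) with hf
  have hC1 := hC.one_le
  set A := lipCoeff d K C (L ^ 2 + L ^ 2) * 3 ^ d with hA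
  have hA0 : 0 ≤ A := by rw [hA]; unfold lipCoeff; positivity
  have hgmem : ∀ y (i : B), g y i = clipPair L (y i) := fun y i => glue_of_mem i.2
  have hgq : ∀ y (i : B), (g y i).1 ^ 2 ≤ L ^ 2 := by
    intro y i
    rw [hgmem]
    exact sq_le_sq' (abs_le.mp (abs_clip_le hL _)).1 (abs_le.mp (abs_clip_le hL _)).2
  have hgsub : ∀ y y' j, ‖g y j - g y' j‖ ≤ min ‖y - y'‖ (2 * L) := by
    intro y y' j
    by_cases hj : j ∈ B
    · simp only [hg, glue_of_mem hj]
      refine le_min ((norm_clipPair_sub_le _ _ _).trans (norm_le_pi_norm (y - y') ⟨j, hj⟩)) ?_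
      refine (norm_sub_le _ _).trans ?_
      linarith [norm_clipPair_le hL (y ⟨j, hj⟩), norm_clipPair_le hL (y' ⟨j, hj⟩)]
    · simp only [hg, glue_of_notMem hj, sub_self, norm_zero]
      exact le_min (norm_nonneg _) (by positivity)
  have hfsub : ∀ y y' (i : B), ‖f y i - f y' i‖ ≤ A * min ‖y - y'‖ (2 * L) := by
    intro y y' i
    have hm : 0 ≤ min ‖y - y'‖ (2 * L) := le_min (norm_nonneg _) (by positivity)
    refine (norm_velocity_sub_le hC hK (i : Site d) _ _).trans ?_
    rw [hA, mul_assoc]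
    have h₁ : lipCoeff d K C ((g y i).1 ^ 2 + (g y' i).1 ^ 2) ≤
        lipCoeff d K C (L ^ 2 + L ^ 2) := by
      have := mul_le_mul_of_nonneg_left (add_le_add (hgq y i) (hgq y' i)) (by linarith : 0 ≤ C)
      unfold lipCoeff
      linarith
    have h₂ := sum_hood_le (i := (i : Site d)) (fun j _ => hgsub y y' j) hm
    have h₃ : 0 ≤ lipCoeff d K C (L ^ 2 + L ^ 2) := by unfold lipCoeff; positivity
    calc _ ≤ lipCoeff d K C (L ^ 2 + L ^ 2) * ∑ j ∈ hood (i : Site d), ‖g y j - g y' j‖ :=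
          mul_le_mul_of_nonneg_right h₁ (Finset.sum_nonneg fun _ _ => norm_nonneg _)
      _ ≤ _ := mul_le_mul_of_nonneg_left h₂ h₃
  have hflip : LipschitzWith ⟨A, hA0⟩ f := by
    refine LipschitzWith.of_dist_le_mul fun y y' => ?_
    rw [dist_eq_norm, dist_eq_norm]
    refine (pi_norm_le_iff_of_nonneg (mul_nonneg hA0 (norm_nonneg _))).mpr fun i => ?_
    exact (hfsub y y' i).trans (mul_le_mul_of_nonneg_left (min_le_left _ _) hA0)
  set V := ‖f 0‖ + A * (2 * L) with hV
  have hV0 : 0 ≤ V := by positivity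
  have hfbound : ∀ y, ‖f y‖ ≤ V := by
    intro y
    have : ‖f y - f 0‖ ≤ A * (2 * L) :=
      (pi_norm_le_iff_of_nonneg (by positivity)).mpr fun i =>
        (hfsub y 0 i).trans (mul_le_mul_of_nonneg_left (min_le_right _ _) hA0)
    have h := norm_add_le (f 0) (f y - f 0)
    rw [add_sub_cancel] at h
    linarith
  -- The longer interval gives two-sided derivatives at ±T. The clipped field is globally Lipschitz
  -- and bounded by `V`, so the ball of radius V(T + 1) suffices for the whole interval.
  have hmem0 : (0 : ℝ) ∈ Icc (-(T + 1)) (T + 1) := ⟨by linarith, by linarith⟩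
  have hPL : IsPicardLindelof (fun _ => f) (tmin := -(T + 1)) (tmax := T + 1) ⟨0, hmem0⟩
      (fun i : B => x i) ⟨V * (T + 1), by positivity⟩ 0 ⟨V, hV0⟩ ⟨A, hA0⟩ := by
    refine IsPicardLindelof.of_time_independent (fun y _ => hfbound y) hflip.lipschitzOnWith ?_
    simp only [sub_zero, zero_sub, neg_neg, max_self, NNReal.coe_zero]
    exact le_rfl
  obtain ⟨y, hy0, hy⟩ := hPL.exists_eq_forall_mem_Icc_hasDerivWithinAt₀
  refine ⟨y, fun i => by rw [hy0], fun t ht i => ?_⟩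
  have ht' := abs_le.mp ht
  have := (hy t ⟨by linarith [ht'.1], by linarith [ht'.2]⟩).hasDerivAt
    (Icc_mem_nhds (by linarith [ht'.1]) (by linarith [ht'.2]))
  exact hasDerivAt_pi.mp this i

/-- If only finitely many sites move, the energy growth in space stays moderate. -/
theorem exists_siteEnergy_growth (hd : 1 ≤ d) (hC : QuarticBounds U C) (hK : 0 < K) {N : ℕ}
    {x : Config d} {M : ℝ} (hx : QBound U K M x) {T : ℝ} {γ : ℝ → Config d}
    (hfix : ∀ i ∉ cube (0 : Site d) N, ∀ t, γ t i = x i)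
    (hc : ∀ i, ContinuousOn (fun t => γ t i) (Icc (-T) T)) :
    ∃ G, ∀ i t, |t| ≤ T → siteEnergy U K i (γ t) ≤ G * Real.exp (sdist i 0 / 2) := by
  obtain ⟨G₀, hG₀, hG⟩ := exists_norm_sub_le_exp hd hC hK M (0 : Site d)
  have hbdd : ∀ i, ∃ b, ∀ t ∈ Icc (-T) T, ‖siteEnergy U K i (γ t)‖ ≤ b := by
    intro i
    refine isCompact_Icc.exists_bound_of_continuousOn ?_
    exact (continuous_siteEnergy i).comp_continuousOn (continuousOn_pi.mpr hc)
  choose b hb using hbdd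
  -- The cube is enlarged by one because the energy of a fixed site still varies if one of its
  -- neighbors moves.
  refine ⟨G₀ + ∑ i ∈ cube 0 (N + 1), |b i|, fun i t ht => ?_⟩
  have hsum : 0 ≤ ∑ i ∈ cube (0 : Site d) (N + 1), |b i| :=
    Finset.sum_nonneg fun _ _ => abs_nonneg _
  have hexp : 1 ≤ Real.exp (sdist i 0 / 2) :=
    Real.one_le_exp (by linarith [sdist_nonneg i 0])
  by_cases hi : i ∈ cube (0 : Site d) (N + 1)
  · have h₁ := (le_abs_self _).trans (hb i t (abs_le.mp ht))
    have h₂ := Finset.single_le_sum (f := fun i => |b i|) (fun _ _ => abs_nonneg _) hi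
    have h₃ := le_abs_self (b i)
    nlinarith
  · have hout : ∀ j ∈ hood i, j ∉ cube (0 : Site d) N := by
      intro j hj hjN
      apply hi
      rw [mem_cube] at hjN ⊢
      intro l
      have h₁ := hjN l
      have h₂ := (abs_sub_le_siteDist j i l).trans (siteDist_le_one_of_mem_hood hj)
      have h₃ := abs_sub_le (i l) (j l) ((0 : Site d) l)
      rw [abs_sub_comm (i l) (j l)] at h₃
      push_cast
      linarith
    have heq : siteEnergy U K i (γ t) = siteEnergy U K i x := by
      unfold siteEnergy
      rw [hfix i (hout i (self_mem_hood i))]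
      congr 1
      exact Finset.sum_congr rfl fun j hj => by
        rw [hfix j (hout j (mem_hood_of_mem_neighbors hj))]
    rw [heq]
    have := (hG x x hx hx i).2.2
    nlinarith

/-- Global solutions of the system in which only the sites of a cube move. -/
theorem exists_finite_volume_solution (hd : 1 ≤ d) (hC : QuarticBounds U C) (hK : 0 < K) {M : ℝ}
    {x : Config d} (hx : QBound U K M x) (N : ℕ) {T : ℝ} (hT : 0 ≤ T) :
    ∃ γ : ℝ → Config d, γ 0 = x ∧ IsPartialSolution U K (cube 0 N : Finset (Site d)) T γ ∧
      ∀ t, |t| ≤ T → QBound U K (Real.exp (energyRate d K * |t|) * spreadConst d * M) (γ t) := by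
  set B : Finset (Site d) := cube 0 N with hB
  have hC1 := hC.one_le
  set E : Site d → ℝ := fun i => Real.exp (energyRate d K * T) *
    ∑' j, Real.exp (-sdist i j) * siteEnergy U K j x with hE
  have hE0 : ∀ i, 0 ≤ E i := fun i => mul_nonneg (Real.exp_pos _).le
    (tsum_nonneg fun j => mul_nonneg (Real.exp_pos _).le (siteEnergy_nonneg hK hC.nonneg j x))
  set L₀ := ∑ i ∈ B, (3 + C) * E i with hL₀
  have hL₀' : ∀ i ∈ B, (3 + C) * E i ≤ L₀ := fun i hi =>
    Finset.single_le_sum (f := fun i => (3 + C) * E i)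
      (fun i _ => mul_nonneg (by positivity) (hE0 i)) hi
  have hL₀0 : 0 ≤ L₀ := Finset.sum_nonneg fun i _ => mul_nonneg (by positivity) (hE0 i)
  -- `L₀` is the a priori bound that energy spreading gives for unclipped motion up to time `T`.
  -- Clipping one unit higher opens a bootstrap: while the norms are at most L₀ + 1 the clipping is
  -- inactive, and then they are at most L₀.
  obtain ⟨y, hy0, hy⟩ := exists_clipped_solution hC hK B x (L := L₀ + 1) (by positivity) hT
  set γ : ℝ → Config d := fun t => glue B x (y t) with hγ
  have hγ0 : γ 0 = x := by
    funext i
    by_cases hi : i ∈ B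
    · simp only [hγ, glue_of_mem hi, hy0]
    · simp only [hγ, glue_of_notMem hi]
  have hfix : ∀ i ∉ B, ∀ t, γ t i = x i := fun i hi t => glue_of_notMem hi
  have hderiv : ∀ i ∈ B, ∀ t, |t| ≤ T → HasDerivAt (fun s => γ s i)
      (velocity U K i (glue B x fun j => clipPair (L₀ + 1) (y t j))) t := by
    intro i hi t ht
    have h := hy t ht ⟨i, hi⟩
    have heq : (fun s => γ s i) = fun s => y s ⟨i, hi⟩ := by
      funext s
      exact glue_of_mem hi
    rw [heq]
    exact h
  have hc : ∀ i, ContinuousOn (fun t => γ t i) (Icc (-T) T) := by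
    intro i
    by_cases hi : i ∈ B
    · exact fun t ht => (hderiv i hi t (abs_le.mpr ht)).continuousAt.continuousWithinAt
    · simp only [hfix i hi]
      exact continuousOn_const
  obtain ⟨G, hG⟩ := exists_siteEnergy_growth hd hC hK hx hfix hc
  have hpartial : ∀ s, s ≤ T → (∀ t, |t| ≤ s → ∀ i ∈ B, ‖γ t i‖ ≤ L₀ + 1) →
      IsPartialSolution U K B s γ := by
    intro s hs hbd i t ht
    by_cases hi : i ∈ B
    · rw [Set.indicator_of_mem (by exact_mod_cast hi)]
      have h := hderiv i hi t (ht.trans hs)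
      have heq : (glue B x fun j => clipPair (L₀ + 1) (y t j)) = γ t := by
        funext j
        by_cases hj : j ∈ B
        · have h₁ : γ t j = y t ⟨j, hj⟩ := glue_of_mem hj
          rw [glue_of_mem hj, h₁]
          apply clipPair_of_norm_le
          rw [← h₁]
          exact hbd t ht j hj
        · rw [glue_of_notMem hj, hfix j hj]
      rwa [heq] at h
    · rw [Set.indicator_of_notMem (by exact_mod_cast hi)]
      simp only [hfix i hi]
      exact hasDerivAt_const t (x i)
  have hapriori : ∀ s, 0 ≤ s → s ≤ T → IsPartialSolution U K B s γ →
      ∀ t, |t| ≤ s → ∀ i ∈ B, ‖γ t i‖ ≤ L₀ := by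
    intro s hs hsT hsol t ht i hi
    refine (norm_le_siteEnergy hC hK i (γ t)).trans (le_trans ?_ (hL₀' i hi))
    refine mul_le_mul_of_nonneg_left ?_ (by positivity)
    refine (siteEnergy_le_tsum hK hC.nonneg hsol (fun i t ht => hG i t (ht.trans hsT))
      ht i).trans ?_
    rw [hγ0]
    refine mul_le_mul_of_nonneg_right (Real.exp_le_exp.mpr ?_)
      (tsum_nonneg fun j => mul_nonneg (Real.exp_pos _).le (siteEnergy_nonneg hK hC.nonneg j x))
    exact mul_le_mul_of_nonneg_left (ht.trans hsT) (energyRate_nonneg hK)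
  have hbound₀ : ∀ i ∈ B, ‖x i‖ ≤ L₀ := by
    intro i hi
    refine (norm_le_siteEnergy hC hK i x).trans (le_trans ?_ (hL₀' i hi))
    refine mul_le_mul_of_nonneg_left ?_ (by positivity)
    have hsum := summable_exp_mul_siteEnergy hK hC.nonneg
      (fun i => hx.siteEnergy_le_exp hd hK hC.nonneg 0 i) i
    have h₁ := hsum.le_tsum i fun j _ =>
      mul_nonneg (Real.exp_pos _).le (siteEnergy_nonneg hK hC.nonneg j x)
    rw [sdist_self, neg_zero, Real.exp_zero, one_mul] at h₁
    refine h₁.trans (le_mul_of_one_le_left ((siteEnergy_nonneg hK hC.nonneg i x).trans h₁) ?_)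
    exact Real.one_le_exp (mul_nonneg (energyRate_nonneg hK) hT)
  have hcneg : ∀ i, ContinuousOn (fun t => γ (-t) i) (Icc 0 T) := fun i =>
    (hc i).comp continuousOn_neg fun t ht => ⟨by linarith [ht.2], by linarith [ht.1]⟩
  have hcpos : ∀ i, ContinuousOn (fun t => γ t i) (Icc 0 T) := fun i =>
    (hc i).mono (Icc_subset_Icc_left (by linarith))
  -- The times s and -s are continued together, since the energy estimate is stated on symmetric
  -- intervals.
  have hmain := forall_neg_of_step B (T := T)
    (fun i s => max ‖γ s i‖ ‖γ (-s) i‖ - (L₀ + 1))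
    (fun i _ => ((hcpos i).norm.sup (hcneg i).norm).sub continuousOn_const) ?_
  · have hbd : ∀ t, |t| ≤ T → ∀ i ∈ B, ‖γ t i‖ ≤ L₀ + 1 := by
      intro t ht i hi
      have h := hmain |t| ⟨abs_nonneg t, ht⟩ i hi
      simp only [sub_neg, max_lt_iff] at h
      rcases abs_cases t with ⟨h', _⟩ | ⟨h', _⟩
      · rw [h'] at h
        exact h.1.le
      · rw [h', neg_neg] at h
        exact h.2.le
    have hsol := hpartial T le_rfl hbd
    refine ⟨γ, hγ0, hsol, fun t ht => ?_⟩
    exact QBound.of_isPartialSolution hK hC.nonneg hsol hG (by rwa [hγ0]) ht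
  · intro s hs hprev i hi
    suffices h : max ‖γ s i‖ ‖γ (-s) i‖ ≤ L₀ by linarith
    rcases hs.1.eq_or_lt with rfl | hspos
    · rw [neg_zero, hγ0, max_self]
      exact hbound₀ i hi
    -- The bootstrap is available at the times r < s; its bound `L₀` reaches `s` by continuity.
    have hcont : ContinuousWithinAt (fun r => max ‖γ r i‖ ‖γ (-r) i‖) (Ico 0 s) s :=
      (((hcpos i).norm.sup (hcneg i).norm) s hs).mono
        (Ico_subset_Icc_self.trans (Icc_subset_Icc_right hs.2))
    refine hcont.closure_le (by rw [closure_Ico hspos.ne]; exact ⟨hspos.le, le_rfl⟩)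
      continuousWithinAt_const fun r hr => ?_
    have hbd : ∀ t, |t| ≤ r → ∀ i ∈ B, ‖γ t i‖ ≤ L₀ + 1 := by
      intro t ht j hj
      have h := hprev |t| ⟨abs_nonneg t, ht.trans_lt hr.2⟩ j hj
      simp only [sub_nonpos, max_le_iff] at h
      rcases abs_cases t with ⟨h', _⟩ | ⟨h', _⟩
      · rw [h'] at h
        exact h.1
      · rw [h', neg_neg] at h
        exact h.2
    have hrT : r ≤ T := hr.2.le.trans hs.2
    have hsol := hapriori r hr.1 hrT (hpartial r hrT hbd)
    exact max_le (hsol r (abs_of_nonneg hr.1).le i hi)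
      (hsol (-r) (by rw [abs_neg]; exact (abs_of_nonneg hr.1).le) i hi)

theorem QBound.of_tendsto {M : ℝ} {ι : Type*} {l : Filter ι} [l.NeBot] {f : ι → Config d}
    {x : Config d} (hf : Tendsto f l (𝓝 x)) (h : ∀ᶠ n in l, QBound U K M (f n)) :
    QBound U K M x := fun ν k hk =>
  le_of_tendsto (((continuous_cubeEnergy ν k).tendsto x).comp hf) (h.mono fun _ hn => hn ν k hk)

/-- Every state with bounded energy averages is the initial state of a solution. -/
theorem exists_isSolution (hd : 1 ≤ d) (hC : QuarticBounds U C) (hK : 0 < K) {M : ℝ}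
    {x : Config d} (hx : QBound U K M x) : ∃ γ : ℝ → Config d, IsSolution U K γ ∧ γ 0 = x := by
  have hM0 := hx.nonneg hd hK hC.nonneg
  have hfin := fun N : ℕ => exists_finite_volume_solution hd hC hK hx N (Nat.cast_nonneg (α := ℝ) N)
  choose g hg0 hgsol hgQ using hfin
  have hsp := one_le_spreadConst (d := d)
  have hgQ' : ∀ (T : ℝ) (N : ℕ), T ≤ N → ∀ t, |t| ≤ T →
      QBound U K (Real.exp (energyRate d K * T) * spreadConst d * M) (g N t) := by
    intro T N hTN t ht
    refine (hgQ N t (ht.trans hTN)).mono ?_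
    have := energyRate_nonneg (d := d) hK
    gcongr
  have hcauchy : ∀ T : ℝ, 0 < T → ∃ A : Site d → ℝ, (∀ k, 0 ≤ A k) ∧
      ∀ N N' : ℕ, T ≤ N → N ≤ N' → ∀ t, |t| ≤ T → ∀ k,
        ‖g N t k - g N' t k‖ ≤ A k * Real.exp (-(N : ℝ) / 2) := by
    intro T hT
    obtain ⟨ρ, hρ0, hρ⟩ := exists_stability hd hC hK
      (Real.exp (energyRate d K * T) * spreadConst d * M) (0 : Site d) hT
    obtain ⟨G, hG0, hG⟩ := exists_norm_sub_le_exp hd hC hK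
      (Real.exp (energyRate d K * T) * spreadConst d * M) (0 : Site d)
    refine ⟨fun k => G * Real.exp (2 * sdist k 0 + ρ * T), fun k => by positivity,
      fun N N' hN hNN' t ht k => ?_⟩
    have hN' : T ≤ N' := hN.trans (by exact_mod_cast hNN')
    -- The two systems differ only at sites with |j| > N, whose velocity is at most G·exp(|j|/2) ≤
    -- G·exp(-N/2)·exp(|j|). This is a forcing with σ = 1 and H exponentially small in N.
    have h := hρ (cube 0 N : Finset (Site d)) (cube 0 N' : Finset (Site d)) (g N) (g N')
      (G * Real.exp (-(N : ℝ) / 2)) 1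
      (fun i s hs => hgsol N i s (hs.trans hN)) (fun i s hs => hgsol N' i s (hs.trans hN'))
      (hgQ' T N hN) (hgQ' T N' hN') (by positivity) (by simp) (fun j s hs => ?_)
      (fun j => by rw [hg0, hg0, sub_self, norm_zero]; positivity) t ht k
    · refine h.trans ?_
      rw [mul_right_comm]
      refine mul_le_mul_of_nonneg_right ?_ (Real.exp_pos _).le
      refine mul_le_mul_of_nonneg_left (Real.exp_le_exp.mpr ?_) hG0
      have h₁ : |t| / T ≤ 1 := (div_le_one hT).mpr ht
      have h₂ := mul_le_mul_of_nonneg_right h₁ (sdist_nonneg k 0)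
      have h₃ := mul_le_mul_of_nonneg_left ht hρ0
      linarith
    · have hsub : cube (0 : Site d) N ⊆ cube 0 N' := cube_mono 0 hNN'
      by_cases hj : j ∈ cube (0 : Site d) N
      · rw [Set.indicator_of_mem (by exact_mod_cast hj),
          Set.indicator_of_mem (by exact_mod_cast hsub hj)]
        exact le_add_of_nonneg_right (by positivity)
      · rw [Set.indicator_of_notMem (by exact_mod_cast hj), zero_sub, norm_neg]
        refine le_add_of_nonneg_of_le (norm_nonneg _) ?_
        refine (norm_indicator_le_norm_self _ _).trans ?_
        refine (hG _ _ (hgQ' T N' hN' s hs) (hgQ' T N' hN' s hs) j).2.1.trans ?_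
        rw [mul_assoc, ← Real.exp_add]
        refine mul_le_mul_of_nonneg_left (Real.exp_le_exp.mpr ?_) hG0
        have := lt_sdist_of_notMem_cube hj
        linarith
  have hdecay : Tendsto (fun N : ℕ => Real.exp (-(N : ℝ) / 2)) atTop (𝓝 0) := by
    refine Real.tendsto_exp_atBot.comp ?_
    have : Tendsto (fun N : ℕ => (N : ℝ) / 2) atTop atTop :=
      tendsto_natCast_atTop_atTop.atTop_div_const (by norm_num)
    refine (tendsto_neg_atTop_atBot.comp this).congr fun N => ?_
    simp [neg_div]
  have hlim : ∀ t k, ∃ z, Tendsto (fun N => g N t k) atTop (𝓝 z) := by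
    intro t k
    obtain ⟨A, hA0, hA⟩ := hcauchy (|t| + 1) (by positivity)
    apply cauchySeq_tendsto_of_complete
    obtain ⟨N₀, hN₀⟩ := exists_nat_ge (|t| + 1)
    rw [Metric.cauchySeq_iff']
    intro ε hε
    have h := (hdecay.const_mul (A k)).eventually_lt_const (by simpa using hε)
    obtain ⟨N, hN, hN'⟩ := (h.and (eventually_ge_atTop N₀)).exists
    refine ⟨N, fun n hn => ?_⟩
    rw [dist_comm, dist_eq_norm]
    exact (hA N n (hN₀.trans (by exact_mod_cast hN')) hn t (by linarith) k).trans_lt hN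
  choose γ hγ using hlim
  have hγpi : ∀ t, Tendsto (fun N => g N t) atTop (𝓝 (γ t)) := fun t =>
    tendsto_pi_nhds.mpr (hγ t)
  have hclose : ∀ T : ℝ, 0 < T → ∃ A : Site d → ℝ, (∀ k, 0 ≤ A k) ∧
      ∀ N : ℕ, T ≤ N → ∀ t, |t| ≤ T → ∀ k,
        ‖g N t k - γ t k‖ ≤ A k * Real.exp (-(N : ℝ) / 2) := by
    intro T hT
    obtain ⟨A, hA0, hA⟩ := hcauchy T hT
    refine ⟨A, hA0, fun N hN t ht k => ?_⟩
    refine le_of_tendsto ((hγ t k).const_sub (g N t k)).norm ?_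
    filter_upwards [eventually_ge_atTop N] with N' hN'
    exact hA N N' hN hN' t ht k
  have hγQ : ∀ T t : ℝ, |t| ≤ T →
      QBound U K (Real.exp (energyRate d K * T) * spreadConst d * M) (γ t) := by
    intro T t ht
    obtain ⟨N₀, hN₀⟩ := exists_nat_ge T
    refine QBound.of_tendsto (hγpi t) ?_
    filter_upwards [eventually_ge_atTop N₀] with N hN
    exact hgQ' T N (hN₀.trans (by exact_mod_cast hN)) t ht
  refine ⟨γ, IsSolution.of_qBound hd hK hC.nonneg (fun T => ?_) (fun T => ⟨_, hγQ T⟩), ?_⟩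
  swap
  · refine tendsto_nhds_unique (hγpi 0) ?_
    simp only [hg0]
    exact tendsto_const_nhds
  rw [isPartialSolution_univ_iff]
  intro k t _
  set T' := |t| + 1 with hT'
  have hT'0 : 0 < T' := by positivity
  obtain ⟨A, hA0, hA⟩ := hclose T' hT'0
  -- From `N₀` on, the site `k` moves in the approximating systems and these are solutions on the
  -- whole interval.
  obtain ⟨N₀, hN₀⟩ := exists_nat_ge (T' + sdist k 0)
  have hN₀T : T' ≤ N₀ := by linarith [sdist_nonneg k 0]
  obtain ⟨ρ, hρ0, hρ⟩ := exists_sq_position_le hd hC hK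
    (Real.exp (energyRate d K * T') * spreadConst d * M) (0 : Site d) one_pos
  set r := ρ + 1 * sdist k 0
  have hC1 := hC.one_le
  have hr0 : 0 ≤ r := add_nonneg hρ0 (by linarith [sdist_nonneg k 0])
  have hball : ∀ s ∈ Metric.ball (0 : ℝ) T', |s| ≤ T' := fun s hs => by
    rw [mem_ball_zero_iff, Real.norm_eq_abs] at hs
    exact hs.le
  -- The equation passes to the limit because velocities converge uniformly in time: the velocity of
  -- `k` involves finitely many sites, each converging like exp(-N/2).
  refine hasDerivAt_of_tendstoUniformlyOn (l := atTop) (s := Metric.ball (0 : ℝ) T')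
    (f := fun N s => g N s k) (f' := fun N s => velocity U K k (g N s))
    (g' := fun s => velocity U K k (γ s)) Metric.isOpen_ball ?_ ?_
    (fun s _ => hγ s k) (by rw [mem_ball_zero_iff, Real.norm_eq_abs]; linarith)
  · rw [Metric.tendstoUniformlyOn_iff]
    intro ε hε
    set Λ := lipCoeff d K C (r + r) * ∑ j ∈ hood k, A j with hΛ
    have h := (hdecay.const_mul Λ).eventually_lt_const (by simpa using hε)
    filter_upwards [h, eventually_ge_atTop N₀] with N hN hNN₀ s hs
    have hNT : T' ≤ N := hN₀T.trans (by exact_mod_cast hNN₀)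
    have hs' := hball s hs
    rw [dist_comm, dist_eq_norm]
    refine lt_of_le_of_lt ?_ hN
    refine (norm_velocity_sub_le hC hK k _ _).trans ?_
    rw [hΛ, mul_assoc, Finset.sum_mul]
    have h₁ : lipCoeff d K C ((g N s k).1 ^ 2 + (γ s k).1 ^ 2) ≤ lipCoeff d K C (r + r) := by
      unfold lipCoeff
      gcongr
      · exact hρ _ (hgQ' T' N hNT s hs') k
      · exact hρ _ (hγQ T' s hs') k
    exact mul_le_mul h₁ (Finset.sum_le_sum fun j _ => hA N hNT s hs' j)
      (Finset.sum_nonneg fun _ _ => norm_nonneg _) (by unfold lipCoeff; positivity)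
  · filter_upwards [eventually_ge_atTop N₀] with N hN s hs
    have hN₀N : (N₀ : ℝ) ≤ N := by exact_mod_cast hN
    have h := hgsol N k s ((hball s hs).trans (hN₀T.trans hN₀N))
    have hk : k ∈ cube (0 : Site d) N := by
      by_contra hk
      have := lt_sdist_of_notMem_cube hk
      linarith
    rwa [Set.indicator_of_mem (by exact_mod_cast hk)] at h

theorem existsUnique_isSolution (hd : 1 ≤ d) (hC : QuarticBounds U C) (hK : 0 < K)
    {x : Config d} (hx : x ∈ X0 U K) :
    ∃! γ : ℝ → Config d, IsSolution U K γ ∧ γ 0 = x := by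
  obtain ⟨M, hM⟩ := (mem_X0_iff hd hK hC.nonneg).mp hx
  obtain ⟨γ, hγ, h0⟩ := exists_isSolution hd hC hK hM
  exact ⟨γ, ⟨hγ, h0⟩, fun γ' h' => h'.1.eq_of_eq_zero hd hC hK hγ (h'.2.trans h0.symm)⟩

end Existence

/-! ### The flow -/

section Flow

variable {d : ℕ} {U : Polynomial ℝ} {K C : ℝ}

theorem flow_eq (hd : 1 ≤ d) (hC : QuarticBounds U C) (hK : 0 < K) {γ : ℝ → Config d}
    (hγ : IsSolution U K γ) (t : ℝ) : flow U K t (γ 0) = γ t := by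
  have h : ∃ γ' : ℝ → Config d, IsSolution U K γ' ∧ γ' 0 = γ 0 := ⟨γ, hγ, rfl⟩
  rw [flow, dif_pos h]
  rw [h.choose_spec.1.eq_of_eq_zero hd hC hK hγ h.choose_spec.2]

theorem QBound.isSolution_flow (hd : 1 ≤ d) (hC : QuarticBounds U C) (hK : 0 < K) {M : ℝ}
    {x : Config d} (hx : QBound U K M x) :
    IsSolution U K (fun t => flow U K t x) ∧ flow U K 0 x = x := by
  obtain ⟨γ, hγ, h0⟩ := exists_isSolution hd hC hK hx
  have heq : (fun t => flow U K t x) = γ := by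
    funext t
    rw [← h0]
    exact flow_eq hd hC hK hγ t
  refine ⟨heq ▸ hγ, ?_⟩
  rw [← h0, flow_eq hd hC hK hγ]

theorem QBound.flow (hd : 1 ≤ d) (hC : QuarticBounds U C) (hK : 0 < K) {M : ℝ}
    {x : Config d} (hx : QBound U K M x) {T t : ℝ} (ht : |t| ≤ T) :
    QBound U K (Real.exp (energyRate d K * T) * spreadConst d * M) (flow U K t x) := by
  obtain ⟨h, h0⟩ := hx.isSolution_flow hd hC hK
  refine (h.qBound hd hK hC.nonneg (M := M) (by rwa [h0]) t).mono ?_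
  have := energyRate_nonneg (d := d) hK
  have := hx.nonneg hd hK hC.nonneg
  have := one_le_spreadConst (d := d)
  gcongr

theorem IsSolution.shift {γ : ℝ → Config d} (h : IsSolution U K γ) (t₀ : ℝ) :
    IsSolution U K (fun s => γ (s + t₀)) := by
  refine ⟨fun i t => ?_, fun i t => ?_, fun T => ?_⟩
  · exact (h.deriv_q i (t + t₀)).comp_add_const t t₀
  · exact (h.deriv_p i (t + t₀)).comp_add_const t t₀
  · obtain ⟨M, hM⟩ := h.locally_bounded (T + |t₀|)
    exact ⟨M, fun t ht => hM _ ((abs_add_le t t₀).trans (by linarith))⟩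

theorem mem_hood_comm {i j : Site d} : i ∈ hood j ↔ j ∈ hood i := by
  unfold hood
  rw [Finset.mem_insert, Finset.mem_insert, mem_neighbors, mem_neighbors, siteDist_comm, eq_comm]

/-- Changing one site keeps the energy averages bounded. -/
theorem QBound.exists_update (hK : 0 < K) (hU : ∀ q, 0 ≤ U.eval q) {M : ℝ} {x : Config d}
    (hx : QBound U K M x) (i : Site d) :
    ∃ M', ∀ z, ‖z - x i‖ ≤ 1 → QBound U K M' (Function.update x i z) := by
  have hbdd : ∀ l, ∃ b, ∀ z ∈ Metric.closedBall (x i) 1,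
      ‖siteEnergy U K l (Function.update x i z)‖ ≤ b := by
    intro l
    refine (isCompact_closedBall (x i) 1).exists_bound_of_continuousOn ?_
    refine ((continuous_siteEnergy l).comp ?_).continuousOn
    exact continuous_const.update i continuous_id
  choose b hb using hbdd
  set D := ∑ l ∈ hood i, |b l| with hD
  have hD0 : 0 ≤ D := Finset.sum_nonneg fun _ _ => abs_nonneg _
  refine ⟨(1 + D) * M, fun z hz ν k hk => ?_⟩
  -- Since site energies are at least 1, the bounded change near `i` can be written as a factor, and
  -- a factor passes to the energy of every cube.
  have hsite : ∀ l, siteEnergy U K l (Function.update x i z) ≤ (1 + D) * siteEnergy U K l x := by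
    intro l
    have h1 := one_le_siteEnergy hK hU l x
    by_cases hl : l ∈ hood i
    · have h₁ := hb l z (by rwa [mem_closedBall_iff_norm])
      have h₂ := Finset.single_le_sum (f := fun l => |b l|) (fun _ _ => abs_nonneg _) hl
      have h₃ := (le_abs_self _).trans (h₁.trans ((le_abs_self _).trans h₂))
      change _ ≤ D at h₃
      nlinarith
    · have hne : ∀ j ∈ hood l, j ≠ i := by
        rintro j hj rfl
        exact hl (mem_hood_comm.mp hj)
      have heq : siteEnergy U K l (Function.update x i z) = siteEnergy U K l x := by
        unfold siteEnergy
        rw [Function.update_of_ne (hne l (self_mem_hood l))]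
        congr 1
        exact Finset.sum_congr rfl fun j hj => by
          rw [Function.update_of_ne (hne j (mem_hood_of_mem_neighbors hj))]
      rw [heq]
      nlinarith
  calc cubeEnergy U K ν k (Function.update x i z) ≤ (1 + D) * cubeEnergy U K ν k x := by
        unfold cubeEnergy
        rw [Finset.mul_sum]
        exact Finset.sum_le_sum fun l _ => hsite l
    _ ≤ (1 + D) * (M * (2 * (k : ℝ) + 1) ^ d) := by
        gcongr
        exact hx ν k hk
    _ = _ := by ring

/-- The data of a perturbation argument around `x` at the site `i`: uniform energy bounds and
Lipschitz dependence for times `|t| ≤ T`. -/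
theorem QBound.exists_lipschitz (hd : 1 ≤ d) (hC : QuarticBounds U C) (hK : 0 < K) {M : ℝ}
    {x : Config d} (hx : QBound U K M x) (i : Site d) {T : ℝ} (hT : 0 < T) :
    ∃ M' Λ : ℝ, 0 ≤ Λ ∧ ∀ z, ‖z - x i‖ ≤ 1 →
      IsSolution U K (fun t => AnharmonicLattice.flow U K t (Function.update x i z)) ∧
      AnharmonicLattice.flow U K 0 (Function.update x i z) = Function.update x i z ∧
      (∀ t, |t| ≤ T → QBound U K M' (AnharmonicLattice.flow U K t (Function.update x i z))) ∧
      ∀ t, |t| ≤ T → ∀ k,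
        ‖AnharmonicLattice.flow U K t (Function.update x i z) k -
          AnharmonicLattice.flow U K t x k‖ ≤ Λ * ‖z - x i‖ * Real.exp (-(sdist k i / 2)) := by
  obtain ⟨M₁, hM₁⟩ := hx.exists_update hK hC.nonneg i
  set M' := Real.exp (energyRate d K * (2 * T)) * spreadConst d * M₁
  have hself : Function.update x i (x i) = x := Function.update_eq_self i x
  -- On the doubled horizon the exponent, -1 at time 0, has only risen to -1/2 at |t| = T, so
  -- exponential decay away from `i` survives.
  obtain ⟨ρ, hρ0, hρ⟩ := exists_stability hd hC hK M' i (T := 2 * T) (by positivity)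
  have hQ : ∀ z, ‖z - x i‖ ≤ 1 → ∀ t, |t| ≤ 2 * T →
      QBound U K M' (AnharmonicLattice.flow U K t (Function.update x i z)) := fun z hz t ht =>
    (hM₁ z hz).flow hd hC hK ht
  refine ⟨M', Real.exp (ρ * T), (Real.exp_pos _).le, fun z hz => ?_⟩
  obtain ⟨hsol, h0⟩ := (hM₁ z hz).isSolution_flow hd hC hK
  obtain ⟨hsol', h0'⟩ := hx.isSolution_flow hd hC hK
  refine ⟨hsol, h0, fun t ht => hQ z hz t (by linarith), fun t ht k => ?_⟩
  have h := hρ univ univ _ _ ‖z - x i‖ (-1) (hsol.isPartialSolution _) (hsol'.isPartialSolution _)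
    (hQ z hz) (by simpa only [hself] using hQ (x i) (by simp)) (norm_nonneg _) (by simp)
    (fun k t _ => by
      simp only [Set.indicator_univ]
      exact le_add_of_nonneg_right (by positivity))
    (fun k => ?_) t (by linarith) k
  · refine h.trans ?_
    rw [mul_comm (Real.exp (ρ * T)), mul_assoc, ← Real.exp_add]
    refine mul_le_mul_of_nonneg_left (Real.exp_le_exp.mpr ?_) (norm_nonneg _)
    have h₁ : |t| / (2 * T) ≤ 1 / 2 := by
      rw [div_le_div_iff₀ (by positivity) (by norm_num)]
      linarith
    have h₂ := mul_le_mul_of_nonneg_right h₁ (sdist_nonneg k i)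
    have h₃ := mul_le_mul_of_nonneg_left ht hρ0
    linarith
  · rw [h0, h0']
    by_cases hk : k = i
    · subst hk
      simp [sdist_self]
    · rw [Function.update_of_ne hk, sub_self, norm_zero]
      positivity

end Flow

/-! ### Differentiability with respect to the initial state -/

section Differentiability

/-- A function on the plane whose increments are linear up to quadratic errors is differentiable. -/
theorem differentiableAt_of_approx_linear {E : Type*} [NormedAddCommGroup E] [NormedSpace ℝ E]
    [CompleteSpace E] {g : ℝ × ℝ → E} {z₀ : ℝ × ℝ} {B : ℝ} (hB : 0 ≤ B)
    (h : ∀ (v v' v'' : ℝ × ℝ) (a b : ℝ), ‖v‖ ≤ 1 → ‖v'‖ ≤ 1 → ‖v''‖ ≤ 1 → v = a • v' + b • v'' →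
      ‖(g (z₀ + v) - g z₀) - a • (g (z₀ + v') - g z₀) - b • (g (z₀ + v'') - g z₀)‖ ≤
        B * (‖v‖ ^ 2 + |a| * ‖v'‖ ^ 2 + |b| * ‖v''‖ ^ 2)) :
    DifferentiableAt ℝ g z₀ := by
  set D : ℝ × ℝ → E := fun v => g (z₀ + v) - g z₀ with hD
  set δ : ℕ → ℝ := fun n => 1 / ((n : ℝ) + 1) with hδ
  have hδpos : ∀ n, 0 < δ n := fun n => by simp only [hδ]; positivity
  have hδ1 : ∀ n, δ n ≤ 1 := fun n => by
    simp only [hδ]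
    rw [div_le_one (by positivity)]
    linarith [Nat.cast_nonneg (α := ℝ) n]
  have hδanti : ∀ {n m}, n ≤ m → δ m ≤ δ n := fun {n m} hnm => by
    simp only [hδ]
    gcongr
  have hδ0 : Tendsto δ atTop (𝓝 0) := tendsto_one_div_add_atTop_nhds_zero_nat
  have hnorm : ∀ (e : ℝ × ℝ), ‖e‖ = 1 → ∀ n, ‖δ n • e‖ = δ n := fun e he n => by
    rw [norm_smul, he, mul_one, Real.norm_of_nonneg (hδpos n).le]
  have hlim : ∀ e : ℝ × ℝ, ‖e‖ = 1 → ∃ w, Tendsto (fun n => (δ n)⁻¹ • D (δ n • e)) atTop (𝓝 w) := by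
    intro e he
    apply cauchySeq_tendsto_of_complete
    refine cauchySeq_of_le_tendsto_0 (fun N => B * (δ N + δ N)) (fun n m N hn hm => ?_) ?_
    · have hn1 := hδpos n
      have hm1 := hδpos m
      -- Applied to two multiples of one vector, approximate linearity says that the difference
      -- quotients form a Cauchy sequence.
      have key := h (δ n • e) (δ m • e) 0 (δ n / δ m) 0 (by rw [hnorm e he]; exact hδ1 n)
        (by rw [hnorm e he]; exact hδ1 m) (by simp)
        (by rw [smul_smul, div_mul_cancel₀ _ hm1.ne']; simp)
      rw [hnorm e he, hnorm e he] at key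
      have heq : (δ n)⁻¹ • D (δ n • e) - (δ m)⁻¹ • D (δ m • e) =
          (δ n)⁻¹ • (D (δ n • e) - (δ n / δ m) • D (δ m • e)) := by
        rw [smul_sub (δ n)⁻¹ (D (δ n • e)), smul_smul, div_eq_mul_inv, inv_mul_cancel_left₀ hn1.ne']
      rw [dist_eq_norm, heq, norm_smul, norm_inv, Real.norm_of_nonneg hn1.le,
        inv_mul_le_iff₀ hn1]
      refine le_trans (by simpa [hD] using key) ?_
      rw [abs_of_pos (div_pos hn1 hm1)]
      have h₁ : δ n ^ 2 + δ n / δ m * δ m ^ 2 = δ n * (δ n + δ m) := by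
        field_simp
      rw [h₁]
      have h₂ : δ n + δ m ≤ δ N + δ N := add_le_add (hδanti hn) (hδanti hm)
      calc B * (δ n * (δ n + δ m)) = δ n * (B * (δ n + δ m)) := by ring
        _ ≤ _ := by gcongr
    · simpa using (hδ0.add hδ0).const_mul B
  obtain ⟨w₁, hw₁⟩ := hlim (1, 0) (by simp [Prod.norm_def])
  obtain ⟨w₂, hw₂⟩ := hlim (0, 1) (by simp [Prod.norm_def])
  set L : ℝ × ℝ →L[ℝ] E := (ContinuousLinearMap.fst ℝ ℝ ℝ).smulRight w₁ +
    (ContinuousLinearMap.snd ℝ ℝ ℝ).smulRight w₂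
  have hquad : ∀ v : ℝ × ℝ, ‖v‖ ≤ 1 → ‖g (z₀ + v) - g z₀ - L v‖ ≤ B * ‖‖v‖ ^ 2‖ := by
    intro v hv
    rw [norm_pow, norm_norm]
    have h₁ : Tendsto (fun n => ‖D v - v.1 • ((δ n)⁻¹ • D (δ n • (1, 0))) -
        v.2 • ((δ n)⁻¹ • D (δ n • (0, 1)))‖) atTop (𝓝 ‖D v - v.1 • w₁ - v.2 • w₂‖) :=
      (((hw₁.const_smul v.1).const_sub (D v)).sub (hw₂.const_smul v.2)).norm
    have h₂ : Tendsto (fun n => B * (‖v‖ ^ 2 + |v.1| * δ n + |v.2| * δ n)) atTop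
        (𝓝 (B * ‖v‖ ^ 2)) := by
      simpa using ((hδ0.const_mul |v.1|).const_add (‖v‖ ^ 2)).add (hδ0.const_mul |v.2|)
        |>.const_mul B
    have h₃ := le_of_tendsto_of_tendsto' h₁ h₂ fun n => ?_
    · refine le_trans (le_of_eq ?_) h₃
      simp [L, hD, sub_sub, add_assoc]
    · have hn := hδpos n
      have he₁ : ‖((1, 0) : ℝ × ℝ)‖ = 1 := by simp [Prod.norm_def]
      have he₂ : ‖((0, 1) : ℝ × ℝ)‖ = 1 := by simp [Prod.norm_def]
      -- Expanding `v` in shrinking multiples of the basis vectors, the errors of the two basis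
      -- terms vanish as n → ∞ and only B‖v‖² remains.
      have key := h v (δ n • (1, 0)) (δ n • (0, 1)) (v.1 * (δ n)⁻¹) (v.2 * (δ n)⁻¹) hv
        (by rw [hnorm _ he₁]; exact hδ1 n) (by rw [hnorm _ he₂]; exact hδ1 n)
        (by
          rw [smul_smul, smul_smul, inv_mul_cancel_right₀ hn.ne', inv_mul_cancel_right₀ hn.ne']
          ext <;> simp)
      rw [hnorm _ he₁, hnorm _ he₂] at key
      rw [smul_smul, smul_smul]
      refine key.trans (le_of_eq ?_)
      rw [abs_mul, abs_mul, abs_inv, abs_of_pos hn]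
      field_simp
  have hderiv : HasFDerivAt g L z₀ := by
    rw [hasFDerivAt_iff_isLittleO_nhds_zero]
    refine Asymptotics.IsBigO.trans_isLittleO (g := fun v : ℝ × ℝ => ‖v‖ ^ 2) ?_
      (Asymptotics.isLittleO_norm_pow_id one_lt_two)
    refine Asymptotics.IsBigO.of_bound B ?_
    filter_upwards [Metric.closedBall_mem_nhds (0 : ℝ × ℝ) one_pos] with v hv
    exact hquad v (by simpa using hv)
  exact hderiv.differentiableAt

variable {d : ℕ} {U : Polynomial ℝ} {K C : ℝ}

variable (U K) in
/-- The linearization at `x` of the velocity of the site `k`. -/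
def linVelocity (x : Config d) (k : Site d) (v : Config d) : ℝ × ℝ :=
  ((v k).2, -(U.derivative.derivative.eval (x k).1 * (v k).1) -
    K * ∑ j ∈ neighbors k, ((v k).1 - (v j).1))

theorem norm_linVelocity_le (hC : QuarticBounds U C) (hK : 0 < K) (x : Config d) (k : Site d)
    (v : Config d) :
    ‖linVelocity U K x k v‖ ≤ lipCoeff d K C ((x k).1 ^ 2) * ∑ j ∈ hood k, ‖v j‖ := by
  set D := ∑ j ∈ hood k, ‖v j‖
  have hk : ‖v k‖ ≤ D :=
    Finset.single_le_sum (f := fun j => ‖v j‖) (fun j _ => norm_nonneg _) (self_mem_hood k)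
  have hD : 0 ≤ D := (norm_nonneg _).trans hk
  have hC1 := hC.one_le
  have e₁ : 0 ≤ C * (1 + (x k).1 ^ 2) * D := by positivity
  have e₂ : 0 ≤ K * (3 ^ d + 1) * D := by positivity
  unfold lipCoeff
  rw [Prod.norm_def, max_le_iff, Real.norm_eq_abs, Real.norm_eq_abs]
  constructor
  · have : |(v k).2| ≤ ‖v k‖ := norm_snd_le (v k)
    simp only [linVelocity]
    linarith
  · simp only [linVelocity]
    refine (abs_sub _ _).trans ?_
    rw [abs_neg, abs_mul]
    have h₁ := norm_sum_neighbors_le hK k (fun j => (v j).1) (fun j => ‖v j‖)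
      fun j => norm_fst_le (v j)
    change _ ≤ K * (3 ^ d + 1) * D at h₁
    have h₂ : |U.derivative.derivative.eval (x k).1| * |(v k).1| ≤ C * (1 + (x k).1 ^ 2) * D :=
      mul_le_mul (hC.deriv2_le _) ((norm_fst_le (v k)).trans hk) (abs_nonneg _) (by positivity)
    linarith

/-- The remainder of the linearization of the velocity. -/
theorem norm_velocity_remainder_le (hC : QuarticBounds U C) (x y : Config d) (k : Site d) :
    ‖velocity U K k y - velocity U K k x - linVelocity U K x k (fun j => y j - x j)‖ ≤
      C * (1 + ‖x k‖ + ‖y k‖) * ‖y k - x k‖ ^ 2 := by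
  have hC1 := hC.one_le
  have hrew : velocity U K k y - velocity U K k x - linVelocity U K x k (fun j => y j - x j) =
      (0, -(U.derivative.eval (y k).1 - U.derivative.eval (x k).1 -
        U.derivative.derivative.eval (x k).1 * ((y k).1 - (x k).1))) := by
    have hsum : ∑ j ∈ neighbors k, ((y k).1 - (x k).1 - ((y j).1 - (x j).1)) =
        ∑ j ∈ neighbors k, ((y k).1 - (y j).1) - ∑ j ∈ neighbors k, ((x k).1 - (x j).1) := by
      rw [← Finset.sum_sub_distrib]
      exact Finset.sum_congr rfl fun j _ => by ring
    ext
    · simp [velocity, linVelocity]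
    · simp only [velocity, linVelocity, force, Prod.snd_sub, Prod.fst_sub]
      rw [hsum]
      ring
  rw [hrew, Prod.norm_def]
  refine max_le (by simp; positivity) ?_
  rw [Real.norm_eq_abs, abs_neg]
  refine (hC.taylor_le _ _).trans ?_
  have h₁ : |(x k).1| ≤ ‖x k‖ := norm_fst_le (x k)
  have h₂ : |(y k).1| ≤ ‖y k‖ := norm_fst_le (y k)
  have h₃ : ((y k).1 - (x k).1) ^ 2 ≤ ‖y k - x k‖ ^ 2 := by
    rw [← sq_abs]
    have : |(y k).1 - (x k).1| ≤ ‖y k - x k‖ := norm_fst_le (y k - x k)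
    gcongr
  have h₄ := sq_nonneg ((y k).1 - (x k).1)
  gcongr

theorem linVelocity_sub_smul (x : Config d) (k : Site d) (v v' v'' : Config d) (a b : ℝ) :
    linVelocity U K x k (fun j => v j - a • v' j - b • v'' j) =
      linVelocity U K x k v - a • linVelocity U K x k v' - b • linVelocity U K x k v'' := by
  have hsum : ∑ j ∈ neighbors k, ((v k).1 - a * (v' k).1 - b * (v'' k).1 -
      ((v j).1 - a * (v' j).1 - b * (v'' j).1)) =
      ∑ j ∈ neighbors k, ((v k).1 - (v j).1) - a * ∑ j ∈ neighbors k, ((v' k).1 - (v' j).1) -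
        b * ∑ j ∈ neighbors k, ((v'' k).1 - (v'' j).1) := by
    rw [Finset.mul_sum, Finset.mul_sum, ← Finset.sum_sub_distrib, ← Finset.sum_sub_distrib]
    exact Finset.sum_congr rfl fun j _ => by ring
  ext
  · simp [linVelocity]
  · simp only [linVelocity, Prod.fst_sub, Prod.snd_sub, Prod.smul_fst, Prod.smul_snd, smul_eq_mul]
    rw [hsum]
    ring

/-- The variational equation is never solved. For v = a v' + b v'' the same combination of
increments of the flow vanishes at time 0 and satisfies the linearized system up to a quadratic
forcing. Comparison bounds it as `differentiableAt_of_approx_linear` requires. -/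
theorem differentiableAt_flow (hd : 1 ≤ d) (hC : QuarticBounds U C) (hK : 0 < K)
    {x : Config d} (hx : x ∈ X0 U K) (t : ℝ) (i j : Site d) :
    DifferentiableAt ℝ (fun z : ℝ × ℝ => flow U K t (Function.update x i z) j) (x i) := by
  obtain ⟨M, hM⟩ := (mem_X0_iff hd hK hC.nonneg).mp hx
  set T := |t| + 1 with hTdef
  have hT : 0 < T := by positivity
  obtain ⟨M', Λ, hΛ0, hΛ⟩ := hM.exists_lipschitz hd hC hK i hT
  have hC1 := hC.one_le
  have hself : Function.update x i (x i) = x := Function.update_eq_self i x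
  have hbase := hΛ (x i) (by simp)
  rw [hself] at hbase
  obtain ⟨hsol, -, hQ, -⟩ := hbase
  obtain ⟨G, hG0, hG⟩ := exists_norm_sub_le_exp hd hC hK M' i
  have hGn : ∀ y, QBound U K M' y → ∀ k, ‖y k‖ ≤ (3 + C) * (G * Real.exp (sdist k i / 2)) :=
    fun y hy k => (norm_le_siteEnergy hC hK k y).trans (by
      gcongr
      exact (hG y y hy hy k).2.2)
  set κ := C * (3 ^ d * Real.exp 2) with hκ
  have hκ0 : 0 < κ := by positivity
  obtain ⟨ρ₀, hρ₀, hpos⟩ := exists_sq_position_le hd hC hK M' i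
    (ε := 1 / (κ * T)) (by positivity)
  set ρ := lipCoeff d K C ρ₀ * (3 ^ d * Real.exp 2) + 1 with hρ
  have hρ0 : 0 ≤ ρ := by rw [hρ]; unfold lipCoeff; positivity
  set R := C * (1 + 2 * ((3 + C) * G)) * Λ ^ 2 with hR
  have hR0 : 0 ≤ R := by positivity
  set D : ℝ × ℝ → Site d → ℝ → ℝ × ℝ := fun v k s =>
    flow U K s (Function.update x i (x i + v)) k - flow U K s x k with hD
  -- The remainder is uniform in space: states grow like exp(|k - i|/2), but the squared increments
  -- decay like exp(-|k - i|).
  have hrem : ∀ v : ℝ × ℝ, ‖v‖ ≤ 1 → ∀ s, |s| ≤ T → ∀ k,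
      ‖velocity U K k (flow U K s (Function.update x i (x i + v))) -
        velocity U K k (flow U K s x) -
        linVelocity U K (flow U K s x) k (fun l => D v l s)‖ ≤ R * ‖v‖ ^ 2 := by
    intro v hv s hs k
    obtain ⟨-, -, hQv, hLv⟩ := hΛ (x i + v) (by simpa using hv)
    refine (norm_velocity_remainder_le hC _ _ k).trans ?_
    have h₁ := hGn _ (hQ s hs) k
    have h₂ := hGn _ (hQv s hs) k
    have h₃ := hLv s hs k
    rw [add_sub_cancel_left] at h₃
    have hE : Real.exp (sdist k i / 2) * Real.exp (-(sdist k i / 2)) = 1 := by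
      rw [← Real.exp_add]; simp
    have hE1 : 1 ≤ Real.exp (sdist k i / 2) :=
      Real.one_le_exp (by linarith [sdist_nonneg k i])
    have hE2 : Real.exp (-(sdist k i / 2)) ≤ 1 :=
      Real.exp_le_one_iff.mpr (by linarith [sdist_nonneg k i])
    have h₄ : 1 + ‖flow U K s x k‖ + ‖flow U K s (Function.update x i (x i + v)) k‖ ≤
        (1 + 2 * ((3 + C) * G)) * Real.exp (sdist k i / 2) := by linarith
    calc _ ≤ C * ((1 + 2 * ((3 + C) * G)) * Real.exp (sdist k i / 2)) *
          (Λ * ‖v‖ * Real.exp (-(sdist k i / 2))) ^ 2 := by gcongr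
      _ = R * ‖v‖ ^ 2 * (Real.exp (sdist k i / 2) * Real.exp (-(sdist k i / 2))) *
          Real.exp (-(sdist k i / 2)) := by rw [hR]; ring
      _ ≤ R * ‖v‖ ^ 2 * 1 * 1 := by
          rw [hE]
          gcongr
      _ = _ := by ring
  refine differentiableAt_of_approx_linear
    (B := R * Real.exp ((|t| / T) * sdist j i + ρ * |t|)) (by positivity)
    fun v v' v'' a b hv hv' hv'' hlin => ?_
  set H := R * (‖v‖ ^ 2 + |a| * ‖v'‖ ^ 2 + |b| * ‖v''‖ ^ 2) with hH
  have hH0 : 0 ≤ H := by positivity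
  have hsolv : ∀ w : ℝ × ℝ, ‖w‖ ≤ 1 → ∀ k s, HasDerivAt (D w k)
      (velocity U K k (flow U K s (Function.update x i (x i + w))) -
        velocity U K k (flow U K s x)) s := by
    intro w hw k s
    obtain ⟨hs₁, -, -, -⟩ := hΛ (x i + w) (by simpa using hw)
    exact (isPartialSolution_univ_iff.mp (hs₁.isPartialSolution |s|) k s le_rfl).sub
      (isPartialSolution_univ_iff.mp (hsol.isPartialSolution |s|) k s le_rfl)
  have hDle : ∀ w : ℝ × ℝ, ‖w‖ ≤ 1 → ∀ k s, |s| ≤ T → ‖D w k s‖ ≤ Λ := by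
    intro w hw k s hs
    obtain ⟨-, -, -, hLw⟩ := hΛ (x i + w) (by simpa using hw)
    refine (hLw s hs k).trans ?_
    rw [add_sub_cancel_left]
    calc _ ≤ Λ * 1 * 1 := by
          gcongr
          exact Real.exp_le_one_iff.mpr (by linarith [sdist_nonneg k i])
      _ = Λ := by ring
  have hD0 : ∀ w : ℝ × ℝ, ‖w‖ ≤ 1 → ∀ k, D w k 0 = Function.update (0 : Config d) i w k := by
    intro w hw k
    obtain ⟨-, h₁, -, -⟩ := hΛ (x i + w) (by simpa using hw)
    obtain ⟨-, h₂, -, -⟩ := hΛ (x i) (by simp)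
    rw [hself] at h₂
    simp only [hD, h₁, h₂]
    by_cases hk : k = i
    · subst hk; simp
    · simp [Function.update_of_ne hk]
  have key := norm_le_exp_weight i hT hρ0 hH0 (σ := 0) (by simp) (G := Λ + |a| * Λ + |b| * Λ)
    (A := fun k => lipCoeff d K C (ρ₀ + 1 / (κ * T) * sdist k i))
    (u := fun k s => D v k s - a • D v' k s - b • D v'' k s)
    (fun k => ?_) (fun k => ?_)
    (fun k s _ => ((hsolv v hv k s).sub ((hsolv v' hv' k s).const_smul a)).sub
      ((hsolv v'' hv'' k s).const_smul b))
    (fun k s hs => ?_) (fun k => ?_) (fun k s hs => ?_) t (by linarith) j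
  · simp only [hself]
    rw [zero_add] at key
    refine key.trans (le_of_eq ?_)
    rw [hH]
    ring
  · have := sdist_nonneg k i
    unfold lipCoeff
    positivity
  · apply le_of_eq
    have : κ * (1 / (κ * T) * sdist k i) = sdist k i / T := by field_simp
    rw [← this, hρ, hκ]
    unfold lipCoeff
    ring
  · have hlinrew : linVelocity U K (flow U K s x) k
        (fun l => D v l s - a • D v' l s - b • D v'' l s) =
        linVelocity U K (flow U K s x) k (fun l => D v l s) -
        a • linVelocity U K (flow U K s x) k (fun l => D v' l s) -
        b • linVelocity U K (flow U K s x) k (fun l => D v'' l s) :=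
      linVelocity_sub_smul _ _ _ _ _ _ _
    have h₁ := norm_linVelocity_le hC hK (flow U K s x) k
      (fun l => D v l s - a • D v' l s - b • D v'' l s)
    have h₂ : lipCoeff d K C ((flow U K s x k).1 ^ 2) ≤
        lipCoeff d K C (ρ₀ + 1 / (κ * T) * sdist k i) := by
      have := mul_le_mul_of_nonneg_left (hpos _ (hQ s hs) k) (by linarith : 0 ≤ C)
      unfold lipCoeff
      linarith
    have r₀ := hrem v hv s hs k
    have r₁ := hrem v' hv' s hs k
    have r₂ := hrem v'' hv'' s hs k
    rw [zero_mul, Real.exp_zero, mul_one]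
    generalize velocity U K k (flow U K s (Function.update x i (x i + v))) -
      velocity U K k (flow U K s x) = Y at *
    generalize velocity U K k (flow U K s (Function.update x i (x i + v'))) -
      velocity U K k (flow U K s x) = Y' at *
    generalize velocity U K k (flow U K s (Function.update x i (x i + v''))) -
      velocity U K k (flow U K s x) = Y'' at *
    generalize linVelocity U K (flow U K s x) k (fun l => D v l s) = Z at *
    generalize linVelocity U K (flow U K s x) k (fun l => D v' l s) = Z' at *
    generalize linVelocity U K (flow U K s x) k (fun l => D v'' l s) = Z'' at *
    have hdec : Y - a • Y' - b • Y'' = (Z - a • Z' - b • Z'') +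
        ((Y - Z) - a • (Y' - Z') - b • (Y'' - Z'')) := by
      simp only [smul_sub]
      abel
    rw [hdec]
    refine (norm_add_le _ _).trans (add_le_add ?_ ?_)
    · rw [← hlinrew]
      exact h₁.trans (mul_le_mul_of_nonneg_right h₂ (Finset.sum_nonneg fun _ _ => norm_nonneg _))
    · have n₁ := norm_sub_le ((Y - Z) - a • (Y' - Z')) (b • (Y'' - Z''))
      have n₂ := norm_sub_le (Y - Z) (a • (Y' - Z'))
      rw [norm_smul, Real.norm_eq_abs] at n₁ n₂
      have m₁ := mul_le_mul_of_nonneg_left r₁ (abs_nonneg a)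
      have m₂ := mul_le_mul_of_nonneg_left r₂ (abs_nonneg b)
      rw [hH]
      linarith
  · rw [hD0 v hv, hD0 v' hv', hD0 v'' hv'']
    have : Function.update (0 : Config d) i v k - a • Function.update (0 : Config d) i v' k -
        b • Function.update (0 : Config d) i v'' k = 0 := by
      by_cases hk : k = i
      · subst hk
        simp only [Function.update_self]
        rw [hlin]
        abel
      · simp [Function.update_of_ne hk]
    rw [this, norm_zero]
    positivity
  · have n₁ := norm_sub_le (D v k s - a • D v' k s) (b • D v'' k s)
    have n₂ := norm_sub_le (D v k s) (a • D v' k s)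
    rw [norm_smul, Real.norm_eq_abs] at n₁ n₂
    have m₀ := hDle v hv k s hs
    have m₁ := mul_le_mul_of_nonneg_left (hDle v' hv' k s hs) (abs_nonneg a)
    have m₂ := mul_le_mul_of_nonneg_left (hDle v'' hv'' k s hs) (abs_nonneg b)
    have hE1 : 1 ≤ Real.exp (sdist k i / 2) :=
      Real.one_le_exp (by linarith [sdist_nonneg k i])
    have h₁ : ‖D v k s - a • D v' k s - b • D v'' k s‖ ≤ Λ + |a| * Λ + |b| * Λ := by linarith
    exact h₁.trans (le_mul_of_one_le_right (by positivity) hE1)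

end Differentiability

/-! ### Measurability of the flow -/

section Measurability

variable {d : ℕ} {U : Polynomial ℝ} {K C : ℝ}

theorem continuous_localEnergy (ν : Site d) (k : ℕ) : Continuous (localEnergy U K ν k) := by
  unfold localEnergy
  have h := U.continuous
  have hq : ∀ i, Continuous fun x : Config d => U.eval (x i).1 := fun i => h.comp (by fun_prop)
  fun_prop

theorem isClosed_setOf_qBound (M : ℝ) : IsClosed {x : Config d | QBound U K M x} := by
  simp only [QBound, ofPred_forall]
  exact isClosed_iInter fun ν => isClosed_iInter fun k => isClosed_iInter fun _ =>
    isClosed_le (continuous_cubeEnergy ν k) continuous_const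

/-- The flow is continuous, for the product topology, on the sets of states with uniformly bounded
energy averages. -/
theorem continuousOn_flow (hd : 1 ≤ d) (hC : QuarticBounds U C) (hK : 0 < K) (M t : ℝ) :
    ContinuousOn (flow U K t) {x : Config d | QBound U K M x} := by
  intro x hx
  refine tendsto_pi_nhds.mpr fun j => ?_
  set T := |t| + 1 with hT
  have hT0 : 0 < T := by positivity
  have htT : |t| ≤ T := by linarith
  obtain ⟨ρ, hρ0, hρ⟩ := exists_stability hd hC hK
    (Real.exp (energyRate d K * T) * spreadConst d * M) (0 : Site d) hT0
  obtain ⟨G, hG0, hG⟩ := exists_norm_sub_le_exp hd hC hK M (0 : Site d)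
  set A := Real.exp ((1 + |t| / T) * sdist j 0 + ρ * |t|) with hA
  have hA0 : 0 < A := Real.exp_pos _
  rw [Metric.tendsto_nhds]
  intro ε hε
  set η := ε / (2 * A) with hη
  have hη0 : 0 < η := by positivity
  -- Outside the cube of radius `N` the energy bounds alone give closeness in the weight exp(|k|),
  -- so only finitely many coordinates have to be close, as the product topology allows.
  obtain ⟨N, hN⟩ : ∃ N : ℕ, G ≤ η * Real.exp ((N : ℝ) / 2) := by
    obtain ⟨N, hN⟩ := exists_nat_ge (2 * (G / η))
    refine ⟨N, ?_⟩
    have h₁ := Real.add_one_le_exp ((N : ℝ) / 2)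
    have h₂ : G / η ≤ Real.exp ((N : ℝ) / 2) := by linarith
    rw [div_le_iff₀ hη0] at h₂
    linarith
  have hnear : ∀ᶠ y in 𝓝[{x : Config d | QBound U K M x}] x,
      ∀ k ∈ cube (0 : Site d) N, ‖y k - x k‖ < η := by
    rw [Filter.eventually_all_finset]
    intro k _
    refine Filter.Eventually.filter_mono nhdsWithin_le_nhds ?_
    have := ((continuous_apply k).tendsto x).eventually (Metric.ball_mem_nhds (x k) hη0)
    filter_upwards [this] with y hy
    rwa [dist_eq_norm] at hy
  filter_upwards [hnear, self_mem_nhdsWithin] with y hy hyM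
  obtain ⟨hsx, hx0⟩ := QBound.isSolution_flow hd hC hK hx
  obtain ⟨hsy, hy0⟩ := QBound.isSolution_flow hd hC hK hyM
  have h := hρ univ univ _ _ η 1 (hsy.isPartialSolution T) (hsx.isPartialSolution T)
    (fun s hs => QBound.flow hd hC hK hyM hs) (fun s hs => QBound.flow hd hC hK hx hs)
    hη0.le (by simp)
    (fun k s _ => by
      simp only [Set.indicator_univ]
      exact le_add_of_nonneg_right (by positivity)) (fun k => ?_) t htT j
  · rw [dist_eq_norm]
    refine h.trans_lt ?_
    change η * A < ε
    have : η * A = ε / 2 := by rw [hη]; field_simp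
    linarith
  · rw [hx0, hy0, one_mul]
    by_cases hk : k ∈ cube (0 : Site d) N
    · exact (hy k hk).le.trans (le_mul_of_one_le_right hη0.le
        (Real.one_le_exp (sdist_nonneg k 0)))
    · refine (hG y x hyM hx k).1.trans ?_
      have h₁ := (lt_sdist_of_notMem_cube hk).le
      calc G * Real.exp (sdist k 0 / 2)
          ≤ η * Real.exp ((N : ℝ) / 2) * Real.exp (sdist k 0 / 2) := by gcongr
        _ ≤ η * Real.exp (sdist k 0 / 2) * Real.exp (sdist k 0 / 2) := by gcongr
        _ = η * Real.exp (sdist k 0) := by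
            rw [mul_assoc, ← Real.exp_add]
            congr 2
            ring

/-- Almost all states lie in a countable union of closed sets on each of which the flow is
continuous. -/
theorem aemeasurable_flow (hd : 1 ≤ d) (hC : QuarticBounds U C) (hK : 0 < K)
    {ω : Measure (Config d)} (hX : ∀ᵐ x ∂ω, x ∈ X0 (d := d) U K) (t : ℝ) :
    AEMeasurable (flow (d := d) U K t) ω := by
  have hcover : ∀ᵐ x ∂ω, x ∈ ⋃ n : ℕ, {x : Config d | QBound U K n x} := by
    filter_upwards [hX] with x hx
    obtain ⟨M, hM⟩ := (mem_X0_iff hd hK hC.nonneg).mp hx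
    obtain ⟨n, hn⟩ := exists_nat_ge M
    exact mem_iUnion.mpr ⟨n, hM.mono hn⟩
  rw [← Measure.restrict_eq_self_of_ae_mem hcover, aemeasurable_iUnion_iff]
  exact fun n => (continuousOn_flow hd hC hK n t).aemeasurable
    (isClosed_setOf_qBound _).measurableSet

end Measurability

/-! ### Energy estimates in invariant states -/

section Invariance

variable {d : ℕ} {U : Polynomial ℝ} {K C : ℝ}

/-- The smooth cutoffs of the local energies are local observables. -/
theorem isLocalObservable_energyCutoff (hC : QuarticBounds U C) (hK : 0 < K) (ν : Site d) (k : ℕ)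
    (A : ℝ) :
    IsLocalObservable fun x : Config d => Real.smoothTransition (localEnergy U K ν k x - A) := by
  have hC1 := hC.one_le
  set B := cube ν k
  set W : (B → ℝ × ℝ) → ℝ := fun y => localEnergy U K ν k (glue B 0 y) with hW
  set φ : (B → ℝ × ℝ) → ℝ := fun y => Real.smoothTransition (W y - A) with hφ
  have hcoord : ∀ i, ContDiff ℝ 1 fun y : B → ℝ × ℝ => glue B 0 y i := by
    intro i
    by_cases hi : i ∈ B
    · simp only [glue_of_mem hi]
      fun_prop
    · simp only [glue_of_notMem hi]
      exact contDiff_const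
  have hcU : ∀ i, ContDiff ℝ 1 fun y : B → ℝ × ℝ => U.eval (glue B 0 y i).1 := by
    intro i
    have hU : ContDiff ℝ 1 fun s : ℝ => U.eval s := by
      simpa using U.contDiff_aeval (𝕜 := ℝ) 1
    exact hU.comp (hcoord i).fst
  have hcW : ContDiff ℝ 1 W := by
    simp only [hW, localEnergy]
    refine ContDiff.add (ContDiff.sum fun i _ => ?_) (ContDiff.sum fun i _ =>
      ContDiff.sum fun j _ => ?_)
    · exact ((((hcoord i).snd.pow 2).div_const 2).add (hcU i)).add contDiff_const
    · exact contDiff_const.mul (((hcoord i).fst.sub (hcoord j).fst).pow 2)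
  have hcφ : ContDiff ℝ 1 φ :=
    (Real.smoothTransition.contDiff (n := 1)).comp (hcW.sub contDiff_const)
  have hterm : ∀ y (i : B), (y i).2 ^ 2 / 2 + U.eval (y i).1 + 1 ≤ W y := by
    intro y i
    have h₁ := Finset.single_le_sum (s := B)
      (f := fun i => (glue B 0 y i).2 ^ 2 / 2 + U.eval (glue B 0 y i).1 + 1)
      (fun j _ => by have := hC.nonneg (glue B 0 y j).1; positivity) i.2
    have h₂ : 0 ≤ ∑ i ∈ B, ∑ j ∈ B.filter (fun j => siteDist j i = 1),
        K / 4 * ((glue B 0 y i).1 - (glue B 0 y j).1) ^ 2 :=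
      Finset.sum_nonneg fun _ _ => Finset.sum_nonneg fun _ _ => by positivity
    rw [glue_of_mem i.2] at h₁
    exact h₁.trans (le_add_of_nonneg_right h₂)
  set R := 1 + (2 + C) * |A + 1| with hR
  have hR0 : 0 ≤ R := by positivity
  -- The local energy is coercive, so the cutoff equals 1 outside a compact set and its derivative
  -- is bounded.
  have hsupp : HasCompactSupport fun y => 1 - φ y := by
    refine HasCompactSupport.intro (isCompact_closedBall (0 : B → ℝ × ℝ) R) fun y hy => ?_
    have hWA : A + 1 ≤ W y := by
      by_contra! hlt
      apply hy
      rw [mem_closedBall_zero_iff, pi_norm_le_iff_of_nonneg hR0]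
      intro i
      have h₁ := hterm y i
      have h₂ := hC.nonneg (y i).1
      have h₃ := hC.pow_four_le (y i).1
      have h₄ : W y ≤ |A + 1| := hlt.le.trans (le_abs_self _)
      have h₅ := abs_le_one_add_pow_four (y i).1
      have h₆ := abs_le_one_add_sq_div_two (y i).2
      have h₇ : C * (U.eval (y i).1 + 1) ≤ C * |A + 1| := by
        gcongr
        linarith [sq_nonneg (y i).2]
      have h₈ : 0 ≤ C * |A + 1| := by positivity
      have h₉ := abs_nonneg (A + 1)
      rw [Prod.norm_def]
      refine max_le ?_ ?_
      · rw [Real.norm_eq_abs, hR]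
        linarith
      · rw [Real.norm_eq_abs, hR]
        linarith
    simp only [hφ]
    rw [Real.smoothTransition.one_of_one_le (by linarith), sub_self]
  have hc1 : ContDiff ℝ 1 fun y => 1 - φ y := contDiff_const.sub hcφ
  obtain ⟨D, hD⟩ := (hc1.continuous_fderiv one_ne_zero).bounded_above_of_compact_support
    (hsupp.fderiv ℝ)
  refine ⟨B, φ, ⟨hcφ.differentiable one_ne_zero, max 1 D, fun y => ⟨?_, ?_⟩⟩, fun x => ?_⟩
  · refine le_max_of_le_left ?_
    rw [abs_of_nonneg (Real.smoothTransition.nonneg _)]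
    exact Real.smoothTransition.le_one _
  · refine le_max_of_le_right ?_
    have h := hD y
    rwa [fderiv_const_sub, norm_neg] at h
  · have hx : ∀ i ∈ B, glue B 0 (fun i : B => x i) i = x i := fun i hi => glue_of_mem hi
    simp only [hφ, hW]
    congr 2
    unfold localEnergy
    refine congr_arg₂ _ (Finset.sum_congr rfl fun i hi => by rw [hx i hi])
      (Finset.sum_congr rfl fun i hi => Finset.sum_congr rfl fun j hj => ?_)
    rw [hx i hi, hx j (Finset.mem_filter.mp hj).1]

/-- In an invariant state, the tails of the distribution of the local energies at a later time are
controlled by those at time zero. -/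
theorem measure_energy_flow_le (hd : 1 ≤ d) (hC : QuarticBounds U C) (hK : 0 < K)
    {ω : Measure (Config d)} [IsProbabilityMeasure ω] (hinv : TimeInvariant U K ω)
    (hX : ∀ᵐ x ∂ω, x ∈ X0 (d := d) U K) (t : ℝ) (ν : Site d) (k : ℕ) (A : ℝ) :
    ω {x | A + 1 ≤ localEnergy U K ν k (flow U K t x)} ≤ ω {x | A ≤ localEnergy U K ν k x} := by
  -- Invariance is only known for differentiable observables; the cutoff lies between the indicators
  -- of W ≥ A + 1 and W ≥ A, which explains the loss of 1.
  set F : Config d → ℝ := fun x => Real.smoothTransition (localEnergy U K ν k x - A) with hF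
  have hFc : Continuous F :=
    Real.smoothTransition.continuous.comp ((continuous_localEnergy ν k).sub continuous_const)
  have hF0 : ∀ x, 0 ≤ F x := fun x => Real.smoothTransition.nonneg _
  have hF1 : ∀ x, F x ≤ 1 := fun x => Real.smoothTransition.le_one _
  have hmeas : AEMeasurable (fun x => F (flow U K t x)) ω :=
    hFc.measurable.comp_aemeasurable (aemeasurable_flow hd hC hK hX t)
  have hint : Integrable (fun x => F (flow U K t x)) ω :=
    Integrable.of_bound hmeas.aestronglyMeasurable 1 (Eventually.of_forall fun x => by
      rw [Real.norm_of_nonneg (hF0 _)]; exact hF1 _)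
  have hint' : Integrable F ω :=
    Integrable.of_bound hFc.measurable.aestronglyMeasurable 1 (Eventually.of_forall fun x => by
      rw [Real.norm_of_nonneg (hF0 _)]; exact hF1 _)
  calc ω {x | A + 1 ≤ localEnergy U K ν k (flow U K t x)}
      ≤ ω {x | 1 ≤ ENNReal.ofReal (F (flow U K t x))} := by
        refine measure_mono fun x hx => ?_
        have hx' : A + 1 ≤ localEnergy U K ν k (flow U K t x) := hx
        simp only [mem_ofPred_eq, hF]
        rw [Real.smoothTransition.one_of_one_le (by linarith), ENNReal.ofReal_one]
    _ ≤ (∫⁻ x, ENNReal.ofReal (F (flow U K t x)) ∂ω) / 1 :=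
        meas_ge_le_lintegral_div hmeas.ennreal_ofReal one_ne_zero ENNReal.one_ne_top
    _ = ENNReal.ofReal (∫ x, F (flow U K t x) ∂ω) := by
        rw [div_one, ofReal_integral_eq_lintegral_ofReal hint (Eventually.of_forall fun x => hF0 _)]
    _ = ENNReal.ofReal (∫ x, F x ∂ω) := by
        rw [hinv F (isLocalObservable_energyCutoff hC hK ν k A) t]
    _ = ∫⁻ x, ENNReal.ofReal (F x) ∂ω :=
        ofReal_integral_eq_lintegral_ofReal hint' (Eventually.of_forall hF0)
    _ ≤ ∫⁻ x, ({x | A ≤ localEnergy U K ν k x}.indicator 1) x ∂ω := by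
        refine lintegral_mono fun x => ?_
        by_cases hx : A ≤ localEnergy U K ν k x
        · rw [Set.indicator_of_mem (by exact hx)]
          simpa using hF1 x
        · rw [Set.indicator_of_notMem (by exact hx)]
          simp only [hF]
          rw [Real.smoothTransition.zero_of_nonpos (by linarith)]
          simp
    _ = ω {x | A ≤ localEnergy U K ν k x} :=
        lintegral_indicator_one (isClosed_le continuous_const
          (continuous_localEnergy ν k)).measurableSet

/-- Large deviations of the local energies are exponentially unlikely. -/
theorem Superstable.exists_measure_le {ω : Measure (Config d)} (h : Superstable U K ω) (β : ℝ) :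
    ∃ a, 0 ≤ a ∧ ∀ (ν : Site d) (k : ℕ),
      ω {x | a * (2 * (k : ℝ) + 1) ^ d ≤ localEnergy U K ν k x} ≤
        ENNReal.ofReal (Real.exp (-(β * (2 * (k : ℝ) + 1) ^ d))) := by
  obtain ⟨D, hD, lam₀, hlam₀, hω⟩ := h
  set lam := lam₀ / 2 with hlam
  have hlam0 : 0 < lam := by positivity
  -- Exponential Chebyshev inequality: `D` compensates the exponential moment, and |β| is left over.
  refine ⟨(D + |β|) / lam, by positivity, fun ν k => ?_⟩
  set n : ℝ := (2 * (k : ℝ) + 1) ^ d with hn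
  have hn0 : 0 < n := by positivity
  have hmeas : AEMeasurable
      (fun x => ENNReal.ofReal (Real.exp (lam * localEnergy U K ν k x))) ω :=
    (Real.continuous_exp.comp (continuous_const.mul
      (continuous_localEnergy ν k))).measurable.ennreal_ofReal.aemeasurable
  calc ω {x | (D + |β|) / lam * n ≤ localEnergy U K ν k x}
      ≤ ω {x | ENNReal.ofReal (Real.exp ((D + |β|) * n)) ≤
          ENNReal.ofReal (Real.exp (lam * localEnergy U K ν k x))} := by
        refine measure_mono fun x hx => ENNReal.ofReal_le_ofReal (Real.exp_le_exp.mpr ?_)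
        have hx' : (D + |β|) / lam * n ≤ localEnergy U K ν k x := hx
        have := mul_le_mul_of_nonneg_left hx' hlam0.le
        calc (D + |β|) * n = lam * ((D + |β|) / lam * n) := by field_simp
          _ ≤ _ := this
    _ ≤ (∫⁻ x, ENNReal.ofReal (Real.exp (lam * localEnergy U K ν k x)) ∂ω) /
          ENNReal.ofReal (Real.exp ((D + |β|) * n)) :=
        meas_ge_le_lintegral_div hmeas (by simpa using Real.exp_pos _) ENNReal.ofReal_ne_top
    _ ≤ ENNReal.ofReal (Real.exp (D * n)) / ENNReal.ofReal (Real.exp ((D + |β|) * n)) := by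
        gcongr
        exact hω lam hlam0 (by linarith) ν k
    _ = ENNReal.ofReal (Real.exp (D * n - (D + |β|) * n)) := by
        rw [← ENNReal.ofReal_div_of_pos (Real.exp_pos _), ← Real.exp_sub]
    _ ≤ _ := by
        refine ENNReal.ofReal_le_ofReal (Real.exp_le_exp.mpr ?_)
        have := mul_le_mul_of_nonneg_right (le_abs_self β) hn0.le
        linarith

/-- The summable weights of the Borel–Cantelli argument. -/
def tailWeight (d : ℕ) (s : ℕ × Site d × ℕ) : ℝ :=
  1 / ((s.1 : ℝ) + 1) ^ 2 * ((∏ l, 1 / (1 + |(s.2.1 l : ℝ)|) ^ 2) * Real.exp (-(s.2.2 : ℝ)))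

theorem summable_tailWeight : Summable (tailWeight d) := by
  have h₁ : Summable fun n : ℕ => 1 / ((n : ℝ) + 1) ^ 2 := by
    have := (summable_nat_add_iff 1).mpr (Real.summable_one_div_nat_pow.mpr one_lt_two)
    simpa using this
  have h₂ : Summable fun n : ℤ => 1 / (1 + |(n : ℝ)|) ^ 2 := by
    have h : Summable fun n : ℕ => 1 / (1 + |((n : ℤ) : ℝ)|) ^ 2 := by
      simpa [add_comm] using h₁
    exact Summable.of_nat_of_neg h (by simpa using h)
  have h₃ : Summable fun n : ℕ => Real.exp (-(n : ℝ)) := Real.summable_exp_neg_nat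
  have h₄ := summable_prod_site (d := d) h₂ fun n => by positivity
  exact h₁.mul_of_nonneg (h₄.mul_of_nonneg h₃ (fun l => Finset.prod_nonneg fun _ _ => by positivity)
    fun n => (Real.exp_pos _).le) (fun n => by positivity)
    fun s => mul_nonneg (Finset.prod_nonneg fun _ _ => by positivity) (Real.exp_pos _).le

/-- The constant 2d + 3 counts factors. Each size condition turns exp(-2k^d) into an inverse square,
once for `m` and once for each of the d coordinates of `ν`; one further factor exp(-(2k + 1)^d) sums
over `k`. -/
theorem exp_le_tailWeight (hd : 1 ≤ d) {m : ℕ} {ν : Site d} {k : ℕ}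
    (hν : Real.log (Real.exp 1 + sdist ν 0) < (k : ℝ) ^ d)
    (hm : Real.log (1 + m) ≤ (k : ℝ) ^ d) :
    Real.exp (-((2 * (d : ℝ) + 3) * (2 * (k : ℝ) + 1) ^ d)) ≤ tailWeight d (m, ν, k) := by
  set L : ℝ := (k : ℝ) ^ d with hL
  have hs0 := sdist_nonneg ν 0
  have hpow : L ≤ (2 * (k : ℝ) + 1) ^ d := by
    rw [hL]
    gcongr
    linarith [Nat.cast_nonneg (α := ℝ) k]
  have hk : (k : ℝ) ≤ (2 * (k : ℝ) + 1) ^ d := by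
    have hk0 := Nat.cast_nonneg (α := ℝ) k
    refine le_trans ?_ (le_self_pow₀ (by linarith) (by omega : d ≠ 0))
    linarith
  have hexpinv : ∀ b : ℝ, 0 < b → Real.log b ≤ L → Real.exp (-(2 * L)) ≤ 1 / b ^ 2 := by
    intro b hb hbL
    have h₁ : b ≤ Real.exp L := (Real.log_le_iff_le_exp hb).mp hbL
    rw [Real.exp_neg, ← one_div, two_mul, Real.exp_add, ← sq]
    gcongr
  have h₁ : Real.exp (-(2 * L)) ≤ 1 / ((m : ℝ) + 1) ^ 2 :=
    hexpinv _ (by positivity) (by rwa [add_comm])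
  have h₂ : ∀ l, Real.exp (-(2 * L)) ≤ 1 / (1 + |(ν l : ℝ)|) ^ 2 := by
    intro l
    refine hexpinv _ (by positivity) (le_trans (Real.log_le_log (by positivity) ?_) hν.le)
    have h₃ := abs_sub_le_siteDist ν 0 l
    have h₄ : |(ν l : ℝ)| ≤ sdist ν 0 := by
      unfold sdist
      simp only [Pi.zero_apply, sub_zero] at h₃
      exact_mod_cast h₃
    linarith [Real.add_one_le_exp 1]
  have h₃ : Real.exp (-(2 * L)) ^ d ≤ ∏ l, 1 / (1 + |(ν l : ℝ)|) ^ 2 := by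
    calc Real.exp (-(2 * L)) ^ d = ∏ _l : Fin d, Real.exp (-(2 * L)) := by simp
      _ ≤ _ := Finset.prod_le_prod (fun _ _ => (Real.exp_pos _).le) fun l _ => h₂ l
  have h₄ : Real.exp (-((2 * k + 1) ^ d)) ≤ Real.exp (-(k : ℝ)) :=
    Real.exp_le_exp.mpr (by linarith)
  calc _ ≤ Real.exp (-(2 * L) + (d * (-(2 * L)) + -((2 * (k : ℝ) + 1) ^ d))) := by
        refine Real.exp_le_exp.mpr ?_
        have : (2 * (d : ℝ) + 2) * L ≤ (2 * (d : ℝ) + 2) * (2 * (k : ℝ) + 1) ^ d := by gcongr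
        linarith
    _ = Real.exp (-(2 * L)) * (Real.exp (-(2 * L)) ^ d * Real.exp (-((2 * (k : ℝ) + 1) ^ d))) := by
        rw [Real.exp_add, Real.exp_add, Real.exp_nat_mul]
    _ ≤ tailWeight d (m, ν, k) := by
        unfold tailWeight
        gcongr

/-- A Borel–Cantelli argument: along a sequence of maps that do not increase the tails of the local
energies, these are almost surely bounded, on cubes of logarithmic size. -/
theorem ae_exists_energy_bound (hd : 1 ≤ d) (hK : 0 < K) (hU : ∀ q, 0 ≤ U.eval q)
    {ω : Measure (Config d)} (hω : Superstable U K ω)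
    (Ψ : ℕ → Config d → Config d)
    (hΨ : ∀ m ν k A, ω {x | A + 1 ≤ localEnergy U K ν k (Ψ m x)} ≤
      ω {x | A ≤ localEnergy U K ν k x}) :
    ∀ᵐ x ∂ω, ∃ M, 0 ≤ M ∧ ∀ (m : ℕ) (ν : Site d) (k : ℕ),
      Real.log (Real.exp 1 + sdist ν 0) < (k : ℝ) ^ d → Real.log (1 + m) ≤ (k : ℝ) ^ d →
        cubeEnergy U K ν k (Ψ m x) ≤ M * (2 * (k : ℝ) + 1) ^ d := by
  obtain ⟨a, ha0, ha⟩ := hω.exists_measure_le (2 * (d : ℝ) + 3)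
  -- The size conditions are part of the events, so that inadmissible triples contribute nothing to
  -- the sum.
  set s : ℕ × Site d × ℕ → Set (Config d) := fun p =>
    {x | (Real.log (Real.exp 1 + sdist p.2.1 0) < (p.2.2 : ℝ) ^ d ∧
      Real.log (1 + p.1) ≤ (p.2.2 : ℝ) ^ d) ∧
      a * (2 * (p.2.2 : ℝ) + 1) ^ d + 1 ≤ localEnergy U K p.2.1 p.2.2 (Ψ p.1 x)} with hs
  have hle : ∀ p, ω (s p) ≤ ENNReal.ofReal (tailWeight d p) := by
    rintro ⟨m, ν, k⟩
    by_cases hp : Real.log (Real.exp 1 + sdist ν 0) < (k : ℝ) ^ d ∧ Real.log (1 + m) ≤ (k : ℝ) ^ d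
    · calc ω (s (m, ν, k)) ≤ ω {x | a * (2 * (k : ℝ) + 1) ^ d + 1 ≤ localEnergy U K ν k (Ψ m x)} :=
            measure_mono fun x hx => hx.2
        _ ≤ ω {x | a * (2 * (k : ℝ) + 1) ^ d ≤ localEnergy U K ν k x} := hΨ m ν k _
        _ ≤ _ := ha ν k
        _ ≤ _ := ENNReal.ofReal_le_ofReal (exp_le_tailWeight hd hp.1 hp.2)
    · have : s (m, ν, k) = ∅ := by
        ext x
        simp only [hs, mem_ofPred_eq, mem_empty_iff_false, iff_false]
        exact fun h => hp h.1
      rw [this]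
      simp
  have hfin : ∑' p, ω (s p) ≠ ∞ :=
    ne_top_of_le_ne_top summable_tailWeight.tsum_ofReal_ne_top (ENNReal.tsum_le_tsum hle)
  filter_upwards [ae_finite_setOfPred_mem hfin] with x hx
  set B : Finset (ℕ × Site d × ℕ) := hx.toFinset with hB
  -- For almost every x only finitely many events occur, and their energies are simply added to the
  -- constant.
  set M := a + 1 + ∑ p ∈ B, localEnergy U K p.2.1 p.2.2 (Ψ p.1 x) with hM
  have hsum0 : 0 ≤ ∑ p ∈ B, localEnergy U K p.2.1 p.2.2 (Ψ p.1 x) :=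
    Finset.sum_nonneg fun p _ => localEnergy_nonneg hK hU _ _ _
  have hM0 : 0 ≤ M := by positivity
  have hbound : ∀ (m : ℕ) (ν : Site d) (k : ℕ),
      Real.log (Real.exp 1 + sdist ν 0) < (k : ℝ) ^ d → Real.log (1 + m) ≤ (k : ℝ) ^ d →
        localEnergy U K ν k (Ψ m x) ≤ M * (2 * (k : ℝ) + 1) ^ d := by
    intro m ν k hν hm
    have hn1 : 1 ≤ (2 * (k : ℝ) + 1) ^ d :=
      one_le_pow₀ (by linarith [Nat.cast_nonneg (α := ℝ) k])
    by_cases hp : (m, ν, k) ∈ B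
    · have h₁ := Finset.single_le_sum
        (f := fun p : ℕ × Site d × ℕ => localEnergy U K p.2.1 p.2.2 (Ψ p.1 x))
        (fun p _ => localEnergy_nonneg hK hU _ _ _) hp
      have h₂ : localEnergy U K ν k (Ψ m x) ≤ M := by
        refine h₁.trans ?_
        rw [hM]
        linarith
      exact h₂.trans (le_mul_of_one_le_right hM0 hn1)
    · have hnot : ¬ a * (2 * (k : ℝ) + 1) ^ d + 1 ≤ localEnergy U K ν k (Ψ m x) := by
        intro hge
        apply hp
        rw [hB, Set.Finite.mem_toFinset]
        exact ⟨⟨hν, hm⟩, hge⟩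
      rw [not_le] at hnot
      have h₁ : (a + 1) * (2 * (k : ℝ) + 1) ^ d ≤ M * (2 * (k : ℝ) + 1) ^ d := by
        gcongr
        rw [hM]
        linarith
      linarith
  refine ⟨3 ^ d * M, by positivity, fun m ν k hν hm => ?_⟩
  have hkk : (k : ℝ) ^ d ≤ ((k + 1 : ℕ) : ℝ) ^ d := by
    gcongr
    simp
  refine (cubeEnergy_le_localEnergy hK hU ν k _).trans
    ((hbound m ν (k + 1) (hν.trans_le hkk) (hm.trans hkk)).trans ?_)
  have := mul_le_mul_of_nonneg_left (two_mul_succ_add_one_pow_le d k) hM0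
  linarith

/-- The Borel–Cantelli argument with all maps equal to the identity; no invariance enters, so the
result is available before the flow is known to be measurable. -/
theorem ae_mem_X0 (hd : 1 ≤ d) (hK : 0 < K) (hU : ∀ q, 0 ≤ U.eval q)
    {ω : Measure (Config d)} (hω : Superstable U K ω) : ∀ᵐ x ∂ω, x ∈ X0 (d := d) U K := by
  have h := ae_exists_energy_bound hd hK hU hω (fun _ x => x) fun m ν k A =>
    measure_mono fun x hx => by
      have hx' : A + 1 ≤ localEnergy U K ν k x := hx
      change A ≤ localEnergy U K ν k x
      linarith
  filter_upwards [h] with x hx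
  obtain ⟨M, -, hM⟩ := hx
  exact (mem_X0_iff hd hK hU).mpr ⟨M, fun ν k hk => hM 0 ν k hk (by simp)⟩

end Invariance

/-! ### Propagation of perturbations -/

section Propagation

variable {d : ℕ} {U : Polynomial ℝ} {K C : ℝ}

variable (U K) in
/-- The energies along the trajectory of `x` grow at most logarithmically in space and time. -/
def LogGrowth (B : ℝ) (x : Config d) : Prop :=
  ∀ (s : ℝ) (ν : Site d),
    siteEnergy U K ν (flow U K s x) ≤ B * Real.log (Real.exp 1 + sdist ν 0 + |s|)

/-- Energy bounds at integer times extend to the time interval of length one that follows. -/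
theorem siteEnergy_flow_le (hd : 1 ≤ d) (hC : QuarticBounds U C) (hK : 0 < K) {x : Config d}
    (hx : x ∈ X0 U K) {M : ℝ} (hM0 : 0 ≤ M) {s τ : ℝ} (hτ : |s - τ| ≤ 1) {m : ℕ}
    (hm : (m : ℝ) ≤ |s|)
    (hM : ∀ (ν : Site d) (k : ℕ), Real.log (Real.exp 1 + sdist ν 0) < (k : ℝ) ^ d →
      Real.log (1 + m) ≤ (k : ℝ) ^ d →
        cubeEnergy U K ν k (flow U K τ x) ≤ M * (2 * (k : ℝ) + 1) ^ d) (ν : Site d) :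
    siteEnergy U K ν (flow U K s x) ≤
      5 ^ d * (Real.exp (energyRate d K) * spreadConst d * M) *
        Real.log (Real.exp 1 + sdist ν 0 + |s|) := by
  obtain ⟨M₀, hM₀⟩ := (mem_X0_iff hd hK hC.nonneg).mp hx
  obtain ⟨hsol, -⟩ := hM₀.isSolution_flow hd hC hK
  have hsp := one_le_spreadConst (d := d)
  have hν0 := sdist_nonneg ν 0
  have hs0 := abs_nonneg s
  have hrate := energyRate_nonneg (d := d) hK
  have hL : 1 ≤ Real.log (Real.exp 1 + sdist ν 0 + |s|) := by
    rw [add_assoc]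
    exact one_le_log_add (by positivity)
  -- Since m ≤ |s|, the single condition log(e + |ν| + |s|) < k^d implies both size conditions of
  -- `hM`, for `k` and all larger cubes.
  refine siteEnergy_le_of_cubeEnergy_le hd hK hC.nonneg (by positivity) hL fun k hk => ?_
  have h := (hsol.shift τ).cubeEnergy_le hd hK hC.nonneg (ν := ν) (k := k) (M := M)
    (fun l hl => ?_) (s - τ)
  · rw [sub_add_cancel] at h
    refine h.trans ?_
    have : Real.exp (energyRate d K * |s - τ|) ≤ Real.exp (energyRate d K) := by
      refine Real.exp_le_exp.mpr ?_
      nlinarith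
    calc _ ≤ Real.exp (energyRate d K) * (spreadConst d * (M * (2 * (k : ℝ) + 1) ^ d)) := by gcongr
      _ = _ := by ring
  · rw [zero_add]
    have hkl : (k : ℝ) ^ d ≤ (l : ℝ) ^ d := by gcongr
    refine hM ν l (lt_of_le_of_lt (Real.log_le_log (by positivity) (by linarith))
      (hk.trans_le hkl)) ?_
    refine le_trans (Real.log_le_log (by positivity) ?_) (hk.le.trans hkl)
    linarith [Real.add_one_le_exp 1]

/-- In an invariant superstable state almost every trajectory has logarithmic energy growth. -/
theorem ae_logGrowth (hd : 1 ≤ d) (hC : QuarticBounds U C) (hK : 0 < K) {ω : Measure (Config d)}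
    [IsProbabilityMeasure ω] (hω : Superstable U K ω) (hinv : TimeInvariant U K ω) :
    ∀ᵐ x ∂ω, x ∈ X0 (d := d) U K ∧ ∃ B, 0 ≤ B ∧ LogGrowth U K B x := by
  have hX := ae_mem_X0 hd hK hC.nonneg hω
  -- Integer times keep the union countable. A real time is compared with the integer next to it in
  -- the direction of 0, whose modulus does not exceed |s|.
  have h₁ := ae_exists_energy_bound hd hK hC.nonneg hω (fun m => flow U K m) fun m ν k A =>
    measure_energy_flow_le hd hC hK hinv hX m ν k A
  have h₂ := ae_exists_energy_bound hd hK hC.nonneg hω (fun m => flow U K (-m)) fun m ν k A =>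
    measure_energy_flow_le hd hC hK hinv hX (-m) ν k A
  filter_upwards [hX, h₁, h₂] with x hx ⟨M₁, hM₁0, hM₁⟩ ⟨M₂, hM₂0, hM₂⟩
  have hsp := one_le_spreadConst (d := d)
  refine ⟨hx, 5 ^ d * (Real.exp (energyRate d K) * spreadConst d * max M₁ M₂), ?_, fun s ν => ?_⟩
  · have : 0 ≤ max M₁ M₂ := le_max_of_le_left hM₁0
    positivity
  have hfl := Nat.floor_le (abs_nonneg s)
  have hfl' := Nat.lt_floor_add_one |s|
  have hL : 0 ≤ Real.log (Real.exp 1 + sdist ν 0 + |s|) := by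
    rw [add_assoc]
    exact zero_le_one.trans (one_le_log_add (add_nonneg (sdist_nonneg ν 0) (abs_nonneg s)))
  rcases le_total 0 s with hs | hs
  · rw [abs_of_nonneg hs] at hfl hfl'
    refine (siteEnergy_flow_le hd hC hK hx hM₁0 (s := s) (τ := (⌊s⌋₊ : ℝ)) (m := ⌊s⌋₊) ?_ ?_
      (hM₁ _) ν).trans ?_
    · rw [abs_le]
      constructor <;> linarith
    · rwa [abs_of_nonneg hs]
    · gcongr
      exact le_max_left _ _
  · rw [abs_of_nonpos hs] at hfl hfl'
    refine (siteEnergy_flow_le hd hC hK hx hM₂0 (s := s) (τ := -(⌊-s⌋₊ : ℝ)) (m := ⌊-s⌋₊) ?_ ?_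
      (hM₂ _) ν).trans ?_
    · rw [abs_le]
      constructor <;> linarith
    · rwa [abs_of_nonpos hs]
    · gcongr
      exact le_max_right _ _

theorem sqrt_add_le_sqrt_add_sqrt {a b : ℝ} (ha : 0 ≤ a) (hb : 0 ≤ b) :
    Real.sqrt (a + b) ≤ Real.sqrt a + Real.sqrt b := by
  rw [Real.sqrt_le_left (by positivity)]
  nlinarith [Real.sq_sqrt ha, Real.sq_sqrt hb, mul_nonneg (Real.sqrt_nonneg a) (Real.sqrt_nonneg b)]

theorem sqrt_le_quarter_add_div {y D : ℝ} (hy : 0 ≤ y) (hD : 0 < D) :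
    Real.sqrt y ≤ D / 4 + y / D := by
  have h := sq_nonneg (D / 2 - Real.sqrt y)
  have hsq := Real.sq_sqrt hy
  have h₁ : D / 4 + y / D = (D ^ 2 / 4 + y) / D := by field_simp
  rw [h₁, le_div_iff₀ hD]
  nlinarith

/-- The logarithmic growth rate of perturbations, as a bound for the coefficients of the system that
they satisfy. -/
theorem exists_lipCoeff_le (d : ℕ) {K C B : ℝ} (hK : 0 < K) (hC1 : 1 ≤ C) :
    ∃ c₁ c₂ : ℝ, 0 ≤ c₁ ∧ 0 ≤ c₂ ∧ ∀ (i k : Site d) (t : ℝ), 0 < t →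
      lipCoeff d K C (3 * Real.sqrt (C * (B * Real.log (Real.exp 1 + sdist k 0 + 2 * t))) + 2) *
        (3 ^ d * Real.exp 2) + 1 ≤
      c₁ + c₂ * Real.sqrt (Real.log (Real.exp 1 + sdist i 0 + 2 * t)) + sdist k i / (2 * t) := by
  set E := 3 ^ d * Real.exp 2 with hE
  have hE0 : 0 < E := by positivity
  set b := Real.sqrt (C * |B|) with hb
  have hb0 : 0 ≤ b := Real.sqrt_nonneg _
  -- `D` weights the splitting √y ≤ D/4 + y/D so that, after multiplication by 3CEb, the part linear
  -- in the distance costs at most y = |k - i|/(2t).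
  set D := 3 * C * E * b + 1 with hD
  have hD0 : 0 < D := by positivity
  refine ⟨E * (1 + 3 * C + K * (3 ^ d + 1)) + 1 + 3 * C * E * b * (D / 4), 3 * C * E * b,
    by positivity, by positivity, fun i k t ht => ?_⟩
  set ℓ := Real.log (Real.exp 1 + sdist i 0 + 2 * t) with hℓ
  set y := sdist k i / (2 * t) with hy
  have hi0 := sdist_nonneg i 0
  have hk0 := sdist_nonneg k 0
  have hki := sdist_nonneg k i
  have hy0 : 0 ≤ y := by positivity
  have hℓ0 : 0 ≤ ℓ := by
    rw [hℓ, add_assoc]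
    exact zero_le_one.trans (one_le_log_add (by positivity))
  have hlogk0 : 0 ≤ Real.log (Real.exp 1 + sdist k 0 + 2 * t) := by
    rw [add_assoc]
    exact zero_le_one.trans (one_le_log_add (by positivity))
  -- Changing the center from k to i multiplies the argument by at most 1 + |k - i|/(2t), and log(1
  -- + y) ≤ y.
  have hlog : Real.log (Real.exp 1 + sdist k 0 + 2 * t) ≤ ℓ + y := by
    have hpos : 0 < Real.exp 1 + sdist i 0 + 2 * t := by positivity
    have h₁ : Real.exp 1 + sdist k 0 + 2 * t ≤ (Real.exp 1 + sdist i 0 + 2 * t) * (1 + y) := by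
      have h₂ : 2 * t * y = sdist k i := by rw [hy]; field_simp
      have h₃ := sdist_triangle k i 0
      have h₄ : 0 ≤ (Real.exp 1 + sdist i 0) * y := by positivity
      nlinarith
    calc _ ≤ Real.log ((Real.exp 1 + sdist i 0 + 2 * t) * (1 + y)) :=
          Real.log_le_log (by positivity) h₁
      _ = ℓ + Real.log (1 + y) := Real.log_mul hpos.ne' (by positivity)
      _ ≤ ℓ + y := by
          have := Real.log_le_sub_one_of_pos (show 0 < 1 + y by positivity)
          linarith
  have hsqrt : Real.sqrt (C * (B * Real.log (Real.exp 1 + sdist k 0 + 2 * t))) ≤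
      b * (Real.sqrt ℓ + (D / 4 + y / D)) := by
    calc _ ≤ Real.sqrt (C * |B| * (ℓ + y)) := by
          apply Real.sqrt_le_sqrt
          rw [mul_assoc]
          gcongr
          exact le_abs_self B
      _ = b * Real.sqrt (ℓ + y) := Real.sqrt_mul (by positivity) _
      _ ≤ b * (Real.sqrt ℓ + (D / 4 + y / D)) := by
          gcongr
          exact (sqrt_add_le_sqrt_add_sqrt hℓ0 hy0).trans
            (add_le_add le_rfl (sqrt_le_quarter_add_div hy0 hD0))
  have hyD : 3 * C * E * b * (y / D) ≤ y := by
    rw [mul_div_assoc', div_le_iff₀ hD0, hD]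
    nlinarith
  have hmul : 3 * C * E * Real.sqrt (C * (B * Real.log (Real.exp 1 + sdist k 0 + 2 * t))) ≤
      3 * C * E * (b * (Real.sqrt ℓ + (D / 4 + y / D))) := by gcongr
  unfold lipCoeff
  linarith

/-- A small change of the state at the site `i` spreads, by the time `t`, with exponentially small
tails outside a region of radius of the order of `t` times the square root of `log t`. -/
theorem LogGrowth.exists_decay (hd : 1 ≤ d) (hC : QuarticBounds U C) (hK : 0 < K) {x : Config d}
    (hx : x ∈ X0 U K) {B : ℝ} (hB : LogGrowth U K B x) (i : Site d) :
    ∃ c₁ c₂ : ℝ, 0 ≤ c₁ ∧ 0 ≤ c₂ ∧ ∀ t : ℝ, 0 < t → ∀ᶠ z in 𝓝 (x i), ∀ j,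
      ‖flow U K t (Function.update x i z) j - flow U K t x j‖ ≤ ‖z - x i‖ *
        Real.exp (-(sdist j i / 2) +
          (c₁ + c₂ * Real.sqrt (Real.log (Real.exp 1 + sdist i 0 + 2 * t))) * t) := by
  have hC1 := hC.one_le
  obtain ⟨c₁, c₂, hc₁, hc₂, hcoef⟩ := exists_lipCoeff_le d (B := B) hK hC1
  refine ⟨c₁, c₂, hc₁, hc₂, fun t ht => ?_⟩
  obtain ⟨M, hM⟩ := (mem_X0_iff hd hK hC.nonneg).mp hx
  obtain ⟨M', Λ, hΛ0, hΛ⟩ := hM.exists_lipschitz hd hC hK i (T := 2 * t) (by positivity)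
  have hself : Function.update x i (x i) = x := Function.update_eq_self i x
  obtain ⟨hsolx, hx0, -, -⟩ := hΛ (x i) (by simp)
  rw [hself] at hsolx hx0
  -- Logarithmic growth is known only for `x`. The neighborhood, which may depend on `t`, keeps the
  -- perturbed trajectory within distance 1 of that of `x` up to time 2t, so it inherits the bound.
  have hsmall : 0 < 1 / (Λ + 1) := by positivity
  filter_upwards [Metric.closedBall_mem_nhds (x i) hsmall] with z hz j
  rw [mem_closedBall_iff_norm, le_div_iff₀ (by positivity)] at hz
  have hzn := norm_nonneg (z - x i)
  have hz1 : ‖z - x i‖ ≤ 1 := by nlinarith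
  have hzΛ : Λ * ‖z - x i‖ ≤ 1 := by nlinarith
  obtain ⟨hsolz, hz0, -, hLip⟩ := hΛ z hz1
  have hLip1 : ∀ k s, |s| ≤ 2 * t →
      ‖flow U K s (Function.update x i z) k - flow U K s x k‖ ≤ 1 := by
    intro k s hs
    refine (hLip s hs k).trans ?_
    have : Real.exp (-(sdist k i / 2)) ≤ 1 :=
      Real.exp_le_one_iff.mpr (by linarith [sdist_nonneg k i])
    calc _ ≤ Λ * ‖z - x i‖ * 1 := by gcongr
      _ ≤ 1 := by linarith
  set ρ := c₁ + c₂ * Real.sqrt (Real.log (Real.exp 1 + sdist i 0 + 2 * t)) with hρ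
  -- Again σ = -1 on the horizon 2t leaves the exponent -1/2 at time t. For positions q, q' with |q'
  -- - q| ≤ 1 one has q² + q'² ≤ 3q² + 2, and q² is at most the square root of a bound for q⁴.
  have h := norm_sub_le_of_lipCoeff_le hC hK i (T := 2 * t) (ρ := ρ) (G := 1) (H := ‖z - x i‖)
    (σ := -1) (by positivity) (by positivity) hzn (by simp) (hsolz.isPartialSolution (2 * t))
    (hsolx.isPartialSolution (2 * t))
    (r := fun k =>
      3 * Real.sqrt (C * (B * Real.log (Real.exp 1 + sdist k 0 + 2 * t))) + 2)
    (fun k s hs => ?_) (fun k => hcoef i k t ht)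
    (fun k s _ => by
      simp only [Set.indicator_univ]
      exact le_add_of_nonneg_right (by positivity))
    (fun k => ?_) (fun k s hs => ?_) t (by rw [abs_of_pos ht]; linarith) j
  · refine h.trans (le_of_eq ?_)
    rw [abs_of_pos ht]
    congr 2
    field_simp
    ring
  · have hq : (flow U K s x k).1 ^ 2 ≤
        Real.sqrt (C * (B * Real.log (Real.exp 1 + sdist k 0 + 2 * t))) := by
      apply Real.le_sqrt_of_sq_le
      have h₁ := hC.pow_four_le (flow U K s x k).1
      have h₂ := eval_add_one_le (U := U) hK k (flow U K s x)
      have h₃ := hB s k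
      have hk0 := sdist_nonneg k 0
      have hB0 : 0 ≤ B := by
        have h₄ := (one_le_siteEnergy hK hC.nonneg k (flow U K s x)).trans h₃
        by_contra! hneg
        have h₅ : 1 ≤ Real.log (Real.exp 1 + sdist k 0 + |s|) := by
          rw [add_assoc]
          exact one_le_log_add (by positivity)
        nlinarith
      calc ((flow U K s x k).1 ^ 2) ^ 2 = (flow U K s x k).1 ^ 4 := by ring
        _ ≤ C * (B * Real.log (Real.exp 1 + sdist k 0 + |s|)) :=
            h₁.trans (mul_le_mul_of_nonneg_left (h₂.trans h₃) (by linarith))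
        _ ≤ _ := by gcongr
    have hdiff : |(flow U K s (Function.update x i z) k).1 - (flow U K s x k).1| ≤ 1 :=
      (norm_fst_le (flow U K s (Function.update x i z) k - flow U K s x k)).trans (hLip1 k s hs)
    have hsq : ((flow U K s (Function.update x i z) k).1 - (flow U K s x k).1) ^ 2 ≤ 1 := by
      rw [← sq_abs]
      exact pow_le_one₀ (abs_nonneg _) hdiff
    nlinarith [sq_nonneg ((flow U K s (Function.update x i z) k).1 - 2 * (flow U K s x k).1)]
  · rw [hz0, hx0]
    by_cases hk : k = i
    · subst hk
      simp [sdist_self]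
    · rw [Function.update_of_ne hk, sub_self, norm_zero]
      positivity
  · rw [one_mul]
    exact (hLip1 k s hs).trans (Real.one_le_exp (by linarith [sdist_nonneg k i]))

theorem BoundedDifferentiable.exists_lipschitz {f : ℝ × ℝ → ℝ} (hf : BoundedDifferentiable f) :
    ∃ L, 0 ≤ L ∧ ∀ z w, |f z - f w| ≤ L * ‖z - w‖ := by
  obtain ⟨hdiff, L, hL⟩ := hf
  refine ⟨L, (abs_nonneg _).trans (hL 0).1, fun z w => ?_⟩
  exact convex_univ.norm_image_sub_le_of_norm_fderiv_le (𝕜 := ℝ) (fun y _ => hdiff y)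
    (fun y _ => (hL y).2) (mem_univ w) (mem_univ z)

/-- Differentiability is not required: where it fails, `deriv` is 0. -/
theorem abs_partialQ_le {F : Config d → ℝ} {x : Config d} {i : Site d} {L : ℝ} (hL : 0 ≤ L)
    (h : ∀ᶠ z in 𝓝 (x i), |F (Function.update x i z) - F x| ≤ L * ‖z - x i‖) :
    |partialQ i F x| ≤ L := by
  rw [partialQ, ← Real.norm_eq_abs]
  refine norm_deriv_le_of_lip' (𝕜 := ℝ) hL ?_
  have hc : Tendsto (fun s : ℝ => (s, (x i).2)) (𝓝 (x i).1) (𝓝 (x i)) :=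
    (Continuous.prodMk_left (x i).2).tendsto (x i).1
  filter_upwards [hc.eventually h] with s hs
  simpa [Prod.norm_def] using hs

theorem abs_partialP_le {F : Config d → ℝ} {x : Config d} {i : Site d} {L : ℝ} (hL : 0 ≤ L)
    (h : ∀ᶠ z in 𝓝 (x i), |F (Function.update x i z) - F x| ≤ L * ‖z - x i‖) :
    |partialP i F x| ≤ L := by
  rw [partialP, ← Real.norm_eq_abs]
  refine norm_deriv_le_of_lip' (𝕜 := ℝ) hL ?_
  have hc : Tendsto (fun s : ℝ => ((x i).1, s)) (𝓝 (x i).2) (𝓝 (x i)) :=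
    (Continuous.prodMk_right (x i).1).tendsto (x i).2
  filter_upwards [hc.eventually h] with s hs
  simpa [Prod.norm_def] using hs

theorem poissonBracket_siteObs (f : ℝ × ℝ → ℝ) (i : Site d) (G : Config d → ℝ) (x : Config d) :
    poissonBracket (siteObs f i) G x = partialQ i (siteObs f i) x * partialP i G x -
      partialP i (siteObs f i) x * partialQ i G x := by
  unfold poissonBracket
  refine tsum_eq_single i fun k hk => ?_
  have hne : i ≠ k := hk.symm
  simp [partialQ, partialP, siteObs, Function.update_of_ne hne]

theorem abs_poissonBracket_le {f : ℝ × ℝ → ℝ} {Lf L : ℝ} (hLf : 0 ≤ Lf) (hL : 0 ≤ L)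
    (hf : ∀ z w, |f z - f w| ≤ Lf * ‖z - w‖) {i : Site d} {G : Config d → ℝ} {x : Config d}
    (hG : ∀ᶠ z in 𝓝 (x i), |G (Function.update x i z) - G x| ≤ L * ‖z - x i‖) :
    |poissonBracket (siteObs f i) G x| ≤ 2 * Lf * L := by
  have hfi : ∀ᶠ z in 𝓝 (x i), |siteObs f i (Function.update x i z) - siteObs f i x| ≤
      Lf * ‖z - x i‖ := Eventually.of_forall fun z => by
    simpa [siteObs] using hf z (x i)
  have q₁ := abs_partialQ_le hLf hfi
  have q₂ := abs_partialP_le hLf hfi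
  have q₃ := abs_partialQ_le hL hG
  have q₄ := abs_partialP_le hL hG
  rw [poissonBracket_siteObs]
  refine (abs_sub _ _).trans ?_
  rw [abs_mul, abs_mul]
  have m₁ := mul_le_mul q₁ q₄ (abs_nonneg _) hLf
  have m₂ := mul_le_mul q₂ q₃ (abs_nonneg _) hLf
  linarith

/-- The light cone `t log^α t`, `α > 1/2`, outgrows the growth rates of the perturbations. -/
theorem eventually_rate_le {α : ℝ} (hα : 1 / 2 < α) (a c D : ℝ) (hc : 0 ≤ c) :
    ∀ᶠ t : ℝ in atTop,
      a + c * Real.sqrt (Real.log (D + 2 * t)) - Real.log t ^ α / 2 ≤ -1 := by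
  have hpow : Tendsto (fun t : ℝ => Real.log t ^ (α - 1 / 2)) atTop atTop :=
    (tendsto_rpow_atTop (by linarith)).comp Real.tendsto_log_atTop
  have hlog : ∀ᶠ t : ℝ in atTop, 1 ≤ Real.log t := Real.tendsto_log_atTop.eventually_ge_atTop 1
  filter_upwards [hpow.eventually_ge_atTop (2 * (2 * c + |a| + 1)), hlog,
    eventually_ge_atTop (2 + |D|), eventually_ge_atTop 1] with t h₁ h₂ h₃ h₄
  have hD := neg_abs_le D
  have hD' := le_abs_self D
  have hD0 := abs_nonneg D
  have hlt : 0 < Real.log t := by linarith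
  set u := Real.sqrt (Real.log t) with hu
  have hu1 : 1 ≤ u := by rw [hu]; exact Real.one_le_sqrt.mpr h₂
  -- For large t, D + 2t ≤ t^4, so the constants in the logarithm only cost a factor 2 in the square
  -- root.
  have hsq : Real.log (D + 2 * t) ≤ 4 * Real.log t := by
    have h₅ : D + 2 * t ≤ t ^ 4 := by
      have : D + 2 * t ≤ 3 * t := by linarith
      have h₆ : t ^ 2 ≤ t ^ 4 := pow_le_pow_right₀ h₄ (by norm_num)
      rcases le_total 3 t with h3 | h3
      · nlinarith
      · have h₇ : 2 ≤ t := by linarith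
        have : 8 * t ≤ t ^ 4 := by
          have : (2 : ℝ) ^ 3 ≤ t ^ 3 := by gcongr
          nlinarith
        linarith
    calc _ ≤ Real.log (t ^ 4) := Real.log_le_log (by linarith) h₅
      _ = 4 * Real.log t := by rw [Real.log_pow]; norm_num
  have hsqrt : Real.sqrt (Real.log (D + 2 * t)) ≤ 2 * u := by
    calc _ ≤ Real.sqrt (4 * Real.log t) := Real.sqrt_le_sqrt hsq
      _ = 2 * u := by
        rw [Real.sqrt_mul (by norm_num), show (4 : ℝ) = 2 ^ 2 by norm_num,
          Real.sqrt_sq (by norm_num)]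
  -- This is where α > 1/2 enters: the first factor tends to infinity and eventually beats every
  -- constant in front of u = √(log t).
  have hsplit : Real.log t ^ α = Real.log t ^ (α - 1 / 2) * u := by
    rw [hu, Real.sqrt_eq_rpow, ← Real.rpow_add hlt]
    congr 1
    ring
  have hmain : 2 * (2 * c + |a| + 1) * u ≤ Real.log t ^ α := by
    rw [hsplit]
    gcongr
  have h₅ : c * Real.sqrt (Real.log (D + 2 * t)) ≤ c * (2 * u) := by gcongr
  have h₆ : (|a| + 1) * 1 ≤ (|a| + 1) * u := by gcongr
  have h₇ := le_abs_self a
  linarith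

/-- Outside the region `|i - j| ≤ t log^α t`, the Poisson brackets along a trajectory with
logarithmic energy growth decay faster than any exponential in time. -/
theorem LogGrowth.tendsto_poissonBracket (hd : 1 ≤ d) (hC : QuarticBounds U C) (hK : 0 < K)
    {x : Config d} (hx : x ∈ X0 U K) {B : ℝ} (hB : LogGrowth U K B x) {f g : ℝ × ℝ → ℝ}
    (hf : BoundedDifferentiable f) (hg : BoundedDifferentiable g) {α : ℝ} (hα : 1 / 2 < α)
    (b : ℝ) (i : Site d) :
    Tendsto (fun t : ℝ => ⨆ (j : Site d) (_ : t * Real.log t ^ α < (siteDist i j : ℝ)),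
      ENNReal.ofReal (Real.exp (b * t) *
        |poissonBracket (siteObs f i) (evolve U K t (siteObs g j)) x|)) atTop (𝓝 0) := by
  obtain ⟨Lf, hLf, hfL⟩ := hf.exists_lipschitz
  obtain ⟨Lg, hLg, hgL⟩ := hg.exists_lipschitz
  obtain ⟨c₁, c₂, hc₁, hc₂, hdecay⟩ := hB.exists_decay hd hC hK hx i
  have hlim : Tendsto (fun t : ℝ => ENNReal.ofReal (2 * Lf * Lg * Real.exp (-t))) atTop (𝓝 0) := by
    have h : Tendsto (fun t : ℝ => 2 * Lf * Lg * Real.exp (-t)) atTop (𝓝 0) := by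
      simpa using (Real.tendsto_exp_atBot.comp tendsto_neg_atTop_atBot).const_mul (2 * Lf * Lg)
    simpa using ENNReal.tendsto_ofReal h
  refine tendsto_of_tendsto_of_tendsto_of_le_of_le' tendsto_const_nhds hlim
    (Eventually.of_forall fun _ => bot_le) ?_
  -- The rate `b` is added to that of the perturbation. On |i - j| > t·log^α t the whole exponent is
  -- then at most -t, uniformly in `j`, which controls the supremum.
  filter_upwards [eventually_rate_le hα (b + c₁) c₂ (Real.exp 1 + sdist i 0) hc₂,
    eventually_gt_atTop 0] with t hrate ht
  refine iSup₂_le fun j hj => ENNReal.ofReal_le_ofReal ?_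
  set ρ := c₁ + c₂ * Real.sqrt (Real.log (Real.exp 1 + sdist i 0 + 2 * t)) with hρ
  have hG : ∀ᶠ z in 𝓝 (x i),
      |evolve U K t (siteObs g j) (Function.update x i z) - evolve U K t (siteObs g j) x| ≤
        Lg * Real.exp (-(sdist j i / 2) + ρ * t) * ‖z - x i‖ := by
    filter_upwards [hdecay t ht] with z hz
    refine (hgL _ _).trans ?_
    calc _ ≤ Lg * (‖z - x i‖ * Real.exp (-(sdist j i / 2) + ρ * t)) := by
          gcongr
          exact hz j
      _ = _ := by ring
  have hbr := abs_poissonBracket_le hLf (by positivity) hfL hG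
  calc _ ≤ Real.exp (b * t) * (2 * Lf * (Lg * Real.exp (-(sdist j i / 2) + ρ * t))) := by gcongr
    _ = 2 * Lf * Lg * Real.exp (b * t + (-(sdist j i / 2) + ρ * t)) := by
        rw [Real.exp_add (b * t)]
        ring
    _ ≤ 2 * Lf * Lg * Real.exp (-t) := by
        gcongr
        have hj' : t * Real.log t ^ α < sdist j i := by
          rw [sdist_comm]
          exact hj
        have h₁ := mul_le_mul_of_nonneg_left hrate ht.le
        rw [hρ]
        linarith

end Propagation

end AnharmonicLattice

end

/-- The first two conjuncts say that the time evolution and the Poisson brackets in the third one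
are well defined: on `X₀` there is exactly one solution from each state, and `Φ_t(x)_j` is
differentiable in `x_i`. The supremum is taken in `[0,∞]`. -/
theorem theorem2 (d : ℕ) (hd : 1 ≤ d) (K : ℝ) (hK : 0 < K)
    (U : Polynomial ℝ) (hUdeg : U.natDegree = 4) (hUlead : 0 < U.leadingCoeff)
    (hUnonneg : ∀ s : ℝ, 0 ≤ U.eval s)
    (ω : MeasureTheory.Measure (AnharmonicLattice.Config d))
    [MeasureTheory.IsProbabilityMeasure ω]
    (hstable : AnharmonicLattice.Superstable U K ω)
    (hinv : AnharmonicLattice.TimeInvariant U K ω) :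
    (∀ x ∈ AnharmonicLattice.X0 (d := d) U K,
      ∃! γ : ℝ → AnharmonicLattice.Config d, AnharmonicLattice.IsSolution U K γ ∧ γ 0 = x) ∧
    (∀ x ∈ AnharmonicLattice.X0 (d := d) U K, ∀ (t : ℝ) (i j : AnharmonicLattice.Site d),
      DifferentiableAt ℝ
        (fun z : ℝ × ℝ => AnharmonicLattice.flow U K t (Function.update x i z) j) (x i)) ∧
    (∀ f g : ℝ × ℝ → ℝ, AnharmonicLattice.BoundedDifferentiable f →
      AnharmonicLattice.BoundedDifferentiable g →
      ∀ α : ℝ, 1 / 2 < α → ∀ b : ℝ, 0 < b → ∀ i : AnharmonicLattice.Site d,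
      ∀ᵐ x ∂ω, x ∈ AnharmonicLattice.X0 (d := d) U K ∧
        Filter.Tendsto
          (fun t : ℝ => ⨆ (j : AnharmonicLattice.Site d)
            (_ : t * Real.log t ^ α < (AnharmonicLattice.siteDist i j : ℝ)),
            ENNReal.ofReal (Real.exp (b * t) *
              |AnharmonicLattice.poissonBracket (AnharmonicLattice.siteObs f i)
                (AnharmonicLattice.evolve U K t (AnharmonicLattice.siteObs g j)) x|))
          Filter.atTop (nhds 0)) := by
  obtain ⟨C, hC⟩ := AnharmonicLattice.exists_quarticBounds hUdeg hUlead hUnonneg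
  refine ⟨fun x hx => AnharmonicLattice.existsUnique_isSolution hd hC hK hx,
    fun x hx t i j => AnharmonicLattice.differentiableAt_flow hd hC hK hx t i j,
    fun f g hf hg α hα b _ i => ?_⟩
  filter_upwards [AnharmonicLattice.ae_logGrowth hd hC hK hstable hinv] with x hx
  obtain ⟨hx0, B, -, hB⟩ := hx
  exact ⟨hx0, hB.tendsto_poissonBracket hd hC hK hx0 hf hg hα b i⟩
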